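/- Setting. Let $d\ge 2$, let $D\subset\mathbb R^d$ be a non-empty bounded open connected set with Lipschitz boundary, and let $\alpha\in L^\infty(D,\mathbb R^{d\times d}_{\mathrm{sym}})$ and $\beta\in L^\infty(D,\mathbb R)$ be uniformly positive. Let $\mathbb L^2_{\alpha,\beta}(D)$ be the Hilbert space $L^2(D,\mathbb C^d)\times L^2(D)$ with $\|\{\mathbf v,p\}\|^2=\int_D(\alpha\mathbf v|\mathbf v)_{\mathbb C^d}+\int_D\beta|p|^2$. Let $\mathcal A^*$ be the operator in $\mathbb L^2_{\alpha,\beta}(D)$ given by $$\mathcal A^*\{\mathbf v,p\}=\tfrac1{\mathrm i}\{\alpha^{-1}\nabla p,\ \beta^{-1}\nabla\cdot\mathbf v\},\qquad \operatorname{dom}\mathcal A^*=\mathbb H(\operatorname{div},D)\times H^1(D),$$ where $\mathbb H(\operatorname{div},D)=\{\mathbf v\in L^2(D,\mathbb C^d):\nabla\cdot\mathbf v\in L^2(D)\}$. Let $\gamma_0:H^1(D)\to H^{1/2}(\partial D)$ be the scalar trace and let $\gamma_{\mathrm n}:\mathbb H(\operatorname{div},D)\to H^{-1/2}(\partial D)$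 be the outward normal trace, where $H^{-1/2}(\partial D)$ is the dual of $H^{1/2}(\partial D)$ with respect to the sesquilinear $L^2(\partial D)$-pairing $\langle\cdot,\cdot\rangle$. Fix a (deterministic) linear homeomorphism $V:L^2(\partial D)\to H^{1/2}(\partial D)$, and let $V^\natural:H^{-1/2}(\partial D)\to L^2(\partial D)$ be its adjoint with respect to this pairing, i.e. $(V^\natural h|f)_{L^2(\partial D)}=\langle h,Vf\rangle$. Let $(\Omega,\mathcal F,\mathbb P)$ be a complete probability space. A function $T$ defined on an event of probability $1$, whose values are bounded operators in a separable Hilbert space $\mathfrak X$, is a random bounded operator if $\omega\mapsto(T_\omega f|g)$ is measurable for all $f,g\in\mathfrak X$; it is a random contraction if, moreover, $\|T\|\le1$ a.s. An operator $T$ in $\mathfrak X$ is m-dissipative if $\mathbb C_+=\{z\in\mathbb C:\operatorname{Im}z>0\}\subseteq\rho(T)$ and $\|(T-z)^{-1}\|\le(\operatorname{Im}z)^{-1}$ for all $z\in\mathbb C_+$. A function $T:\omega\mapsto T_\omega$ whose values are operators in $\mathfrak X$ is random-m-dissipative if $T_\omega$ is a.s. m-dissipative and $(T-z)^{-1}$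 is a random bounded operator for every $z\in\mathbb C_+$; it is random-selfadjoint if $T_\omega$ is a.s. selfadjoint and $(T-z)^{-1}$ is a random bounded operator for every $z\in\mathbb C\setminus\mathbb R$. Theorem. Let $K$ be a random contraction in $L^2(\partial D)$, and let $\widehat{\mathcal A}:\omega\mapsto\widehat{\mathcal A}_\omega$ be the acoustic operator associated with the randomized boundary condition $$(K+I)V^{-1}\gamma_0(p)+(K-I)V^\natural\gamma_{\mathrm n}(\mathbf v)=0,$$ i.e. $\widehat{\mathcal A}_\omega$ is the restriction of $\mathcal A^*$ to those $\{\mathbf v,p\}\in\operatorname{dom}\mathcal A^*$ that satisfy this condition with $K=K_\omega$. Then: (i) $\widehat{\mathcal A}$ is a random-m-dissipative operator in $\mathbb L^2_{\alpha,\beta}(D)$. (ii) If, additionally, $K$ is a.s. unitary, then $\widehat{\mathcal A}$ is a random-selfadjoint operator. -/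

import Mathlib

open MeasureTheory Filter Topology
open scoped ENNReal

noncomputable section

namespace Acoustic

section Fields

open scoped ContDiff

/-! ## Domains, function spaces and weak derivatives -/

/-- The Euclidean space `ℝ^d`. -/
abbrev Sp (d : ℕ) : Type := EuclideanSpace ℝ (Fin d)

/-- The boundary of `O` is of Lipschitz regularity: near each boundary point, in suitable
Cartesian coordinates (a unit vector `ν` and its orthogonal hyperplane), `O` is the set of points
lying strictly below the graph of a Lipschitz function. -/
def HasLipschitzBoundary {d : ℕ} (O : Set (Sp d)) : Prop :=
  ∀ x₀ ∈ frontier O, ∃ (ν : Sp d) (φ : ((Submodule.span ℝ {ν})ᗮ : Submodule ℝ (Sp d)) → ℝ)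
    (L : NNReal) (r : ℝ), ‖ν‖ = 1 ∧ LipschitzWith L φ ∧ 0 < r ∧
      ∀ x ∈ Metric.ball x₀ r,
        x ∈ O ↔ inner ℝ ν x < φ (((Submodule.span ℝ {ν})ᗮ).orthogonalProjectionOnto x)

/-- `L²(O)`, complex valued. -/
abbrev L2 {d : ℕ} (O : Set (Sp d)) : Type := Lp ℂ 2 (volume.restrict O)

/-- `L²(O, ℂ^d)`. -/
abbrev L2Vec {d : ℕ} (O : Set (Sp d)) : Type :=
  Lp (EuclideanSpace ℂ (Fin d)) 2 (volume.restrict O)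

/-- The surface measure of the boundary: `(d-1)`-dimensional Hausdorff measure, normalized so as to
agree with Lebesgue measure on hyperplanes. -/
def surfaceMeasure {d : ℕ} (O : Set (Sp d)) : Measure (Sp d) :=
  (Measure.euclideanHausdorffMeasure (d - 1)).restrict (frontier O)

/-- `L²(∂O)`. -/
abbrev L2Bdry {d : ℕ} (O : Set (Sp d)) : Type := Lp ℂ 2 (surfaceMeasure O)

/-- Test functions on `O` : smooth with compact support in `O`. -/
def IsTestFunction {d : ℕ} (O : Set (Sp d)) (φ : Sp d → ℝ) : Prop :=
  ContDiff ℝ ∞ φ ∧ HasCompactSupport φ ∧ tsupport φ ⊆ O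

/-- The classical partial derivative `∂ᵢ u`. -/
def partialD {d : ℕ} {F : Type*} [NormedAddCommGroup F] [NormedSpace ℝ F]
    (i : Fin d) (u : Sp d → F) (x : Sp d) : F :=
  fderiv ℝ u x (EuclideanSpace.single i (1 : ℝ))

/-- The classical gradient of a complex valued function. -/
def classicalGrad {d : ℕ} (u : Sp d → ℂ) (x : Sp d) : EuclideanSpace ℂ (Fin d) :=
  WithLp.toLp 2 fun i => partialD i u x

/-- `p ∈ H¹(O)` and `∇ p = G`, in the sense of weak derivatives. -/
def HasWeakGrad {d : ℕ} (O : Set (Sp d)) (p : L2 O) (G : L2Vec O) : Prop :=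
  ∀ φ : Sp d → ℝ, IsTestFunction O φ → ∀ i : Fin d,
    ∫ x in O, ((partialD i φ x : ℝ) : ℂ) * p x = - ∫ x in O, (φ x : ℂ) * G x i

/-- `v ∈ H(div, O)` and `∇ · v = D`, in the sense of weak derivatives. -/
def HasWeakDiv {d : ℕ} (O : Set (Sp d)) (v : L2Vec O) (D : L2 O) : Prop :=
  ∀ φ : Sp d → ℝ, IsTestFunction O φ →
    ∫ x in O, ∑ i : Fin d, ((partialD i φ x : ℝ) : ℂ) * v x i = - ∫ x in O, (φ x : ℂ) * D x

/-! ## Trace spaces and traces -/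

/-- The Sobolev-Slobodeckij space `H^{1/2}(∂O)`, with its norm
`‖f‖² = ∫ |f|² + ∫∫ |f(x) - f(y)|² / |x - y|^d` over `∂O` (of dimension `d - 1`). It is realized as
the space of pairs `(f, F)` with `f ∈ L²(∂O)` and
`F(x, y) = (f(x) - f(y)) / |x - y|^(d/2)` in `L²(∂O × ∂O)`, so that `F` is determined by `f`. -/
def HHalf {d : ℕ} (O : Set (Sp d)) :
    Submodule ℂ (WithLp 2 (L2Bdry O × Lp ℂ 2 ((surfaceMeasure O).prod (surfaceMeasure O)))) where
  carrier := {z | ∃ f : Sp d → ℂ, z.fst =ᵐ[surfaceMeasure O] f ∧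
    z.snd =ᵐ[(surfaceMeasure O).prod (surfaceMeasure O)]
      fun q => (f q.1 - f q.2) / ((‖q.1 - q.2‖ ^ ((d : ℝ) / 2) : ℝ) : ℂ)}
  zero_mem' := by
    refine ⟨0, ?_, ?_⟩
    · exact Lp.coeFn_zero _ _ _
    · filter_upwards [Lp.coeFn_zero ℂ 2 ((surfaceMeasure O).prod (surfaceMeasure O))] with q hq
      simpa using hq
  add_mem' := by
    rintro z w ⟨f, hf, hF⟩ ⟨g, hg, hG⟩
    refine ⟨f + g, ?_, ?_⟩
    · exact (Lp.coeFn_add z.fst w.fst).trans (hf.add hg)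
    · filter_upwards [Lp.coeFn_add z.snd w.snd, hF, hG] with q h1 h2 h3
      rw [WithLp.add_snd, h1, Pi.add_apply, h2, h3]
      simp only [Pi.add_apply]
      ring
  smul_mem' := by
    rintro c z ⟨f, hf, hF⟩
    refine ⟨c • f, ?_, ?_⟩
    · exact (Lp.coeFn_smul c z.fst).trans (hf.const_smul c)
    · filter_upwards [Lp.coeFn_smul c z.snd, hF] with q h1 h2
      rw [WithLp.smul_snd, h1, Pi.smul_apply, h2]
      simp only [Pi.smul_apply, smul_eq_mul]
      ring

/-- The boundary function `f ∈ L²(∂O)` underlying an element of `H^{1/2}(∂O)`. -/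
def HHalf.fn {d : ℕ} {O : Set (Sp d)} (f : HHalf O) : L2Bdry O := f.1.fst

/-- `H^{-1/2}(∂O)`: the bounded antilinear functionals on `H^{1/2}(∂O)`. The value `h f` is the
sesquilinear `L²(∂O)`-pairing `⟨h, f⟩` (linear in `h`, antilinear in `f`); a function `g ∈ L²(∂O)`
acts as `f ↦ (g | f)`. -/
abbrev HMinusHalf {d : ℕ} (O : Set (Sp d)) : Type := HHalf O →L⋆[ℂ] ℂ

/-- For a bounded `V : L²(∂O) → H^{1/2}(∂O)`, the value `V^♮ h ∈ L²(∂O)` of the adjoint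
`V^♮ : H^{-1/2}(∂O) → L²(∂O)` with respect to the `L²(∂O)`-pairing: the Riesz representative of
the functional `f ↦ ⟨h, V f⟩`. -/
def natAdjoint {d : ℕ} {O : Set (Sp d)} (V : L2Bdry O →L[ℂ] HHalf O) (h : HMinusHalf O) :
    L2Bdry O :=
  (InnerProductSpace.toDual ℂ (L2Bdry O)).symm
    (((starL ℂ : ℂ ≃L⋆[ℂ] ℂ) : ℂ →L⋆[ℂ] ℂ).comp (h.comp V))

/-- The defining property `(V^♮ h | f) = ⟨h, V f⟩`. -/
theorem inner_natAdjoint {d : ℕ} {O : Set (Sp d)} (V : L2Bdry O →L[ℂ] HHalf O)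
    (h : HMinusHalf O) (f : L2Bdry O) : inner ℂ f (natAdjoint V h) = h (V f) := by
  rw [← inner_conj_symm, natAdjoint, InnerProductSpace.toDual_symm_apply]
  simp

theorem natAdjoint_zero {d : ℕ} {O : Set (Sp d)} (V : L2Bdry O →L[ℂ] HHalf O) :
    natAdjoint V 0 = 0 :=
  ext_inner_left ℂ fun f => by simp [inner_natAdjoint]

theorem natAdjoint_add {d : ℕ} {O : Set (Sp d)} (V : L2Bdry O →L[ℂ] HHalf O)
    (h k : HMinusHalf O) : natAdjoint V (h + k) = natAdjoint V h + natAdjoint V k :=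
  ext_inner_left ℂ fun f => by simp [inner_add_right, inner_natAdjoint]

theorem natAdjoint_smul {d : ℕ} {O : Set (Sp d)} (V : L2Bdry O →L[ℂ] HHalf O)
    (c : ℂ) (h : HMinusHalf O) : natAdjoint V (c • h) = c • natAdjoint V h :=
  ext_inner_left ℂ fun f => by simp [inner_smul_right, inner_natAdjoint]

/-- The scalar trace: `p ∈ H¹(O)` and `γ₀ p = g`. The operator `γ₀` is the extension by continuity
of the restriction `u ↦ u|_{∂O}` of functions smooth up to the boundary: there are smooth `uₙ` with
`uₙ → p` in `H¹(O)` and `uₙ|_{∂O} → g` in `L²(∂O)`. -/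
def IsTrace {d : ℕ} (O : Set (Sp d)) (p : L2 O) (g : L2Bdry O) : Prop :=
  ∃ G : L2Vec O, HasWeakGrad O p G ∧ ∃ u : ℕ → Sp d → ℂ, (∀ n, ContDiff ℝ ∞ (u n)) ∧
    Tendsto (fun n => eLpNorm (fun x => u n x - p x) 2 (volume.restrict O)) atTop (𝓝 0) ∧
    Tendsto (fun n => eLpNorm (fun x => classicalGrad (u n) x - G x) 2 (volume.restrict O))
      atTop (𝓝 0) ∧
    Tendsto (fun n => eLpNorm (fun x => u n x - g x) 2 (surfaceMeasure O)) atTop (𝓝 0)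

/-- The (outward) normal trace: `v ∈ H(div, O)` and `γₙ v = h` in `H^{-1/2}(∂O)`, in the sense of
`⟨γₙ v, γ₀ p⟩ = (v | ∇p) + (∇ · v | p)` for all `p ∈ H¹(O)`. Here `(a | b) = inner ℂ b a`. -/
def IsNormalTrace {d : ℕ} (O : Set (Sp d)) (v : L2Vec O) (h : HMinusHalf O) : Prop :=
  ∃ D : L2 O, HasWeakDiv O v D ∧
    ∀ (p : L2 O) (G : L2Vec O) (g : HHalf O), HasWeakGrad O p G → IsTrace O p (HHalf.fn g) →
      h g = inner ℂ G v + inner ℂ p D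

/-! ## The acoustic medium and its energy space -/

/-- The product `A v` of a real matrix and a complex vector. -/
def matAct {d : ℕ} (A : Matrix (Fin d) (Fin d) ℝ) (v : EuclideanSpace ℂ (Fin d)) :
    EuclideanSpace ℂ (Fin d) :=
  WithLp.toLp 2 fun i => ∑ j, (A i j : ℂ) * v j

/-- A bounded Lipschitz domain in `ℝ^d` together with material parameters
`α ∈ L^∞(O, ℝ^{d×d}_sym)`, `β ∈ L^∞(O, ℝ)`, both uniformly positive. -/
structure Medium (d : ℕ) where
  /-- the domain -/
  dom : Set (Sp d)
  isOpen_dom : IsOpen dom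
  isBounded_dom : Bornology.IsBounded dom
  isConnected_dom : IsConnected dom
  lipschitz_dom : HasLipschitzBoundary dom
  /-- the matrix parameter -/
  α : Sp d → Matrix (Fin d) (Fin d) ℝ
  /-- the scalar parameter -/
  β : Sp d → ℝ
  memLp_α : ∀ i j, MemLp (fun x => α x i j) ∞ (volume.restrict dom)
  symm_α : ∀ᵐ x ∂(volume.restrict dom), (α x).IsSymm
  pos_α : ∃ α₀ : ℝ, 0 < α₀ ∧ ∀ᵐ x ∂(volume.restrict dom), ∀ ξ : Fin d → ℝ,
    α₀ * ∑ i, ξ i ^ 2 ≤ ∑ i, ∑ j, ξ i * α x i j * ξ j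
  memLp_β : MemLp β ∞ (volume.restrict dom)
  pos_β : ∃ β₀ : ℝ, 0 < β₀ ∧ ∀ᵐ x ∂(volume.restrict dom), β₀ ≤ β x

variable {d : ℕ}

/-- The energy space: the linear space `L²(O, ℂ^d) × L²(O)` of pairs `{v, p}`, with the weighted
inner product defined below. -/
def EnergySpace (M : Medium d) : Type := L2Vec M.dom × L2 M.dom

namespace EnergySpace

variable {M : Medium d}

instance : AddCommGroup (EnergySpace M) := inferInstanceAs (AddCommGroup (L2Vec M.dom × L2 M.dom))
instance : Module ℂ (EnergySpace M) := inferInstanceAs (Module ℂ (L2Vec M.dom × L2 M.dom))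

/-- The component `v` of `{v, p}`. -/
def vel : EnergySpace M →ₗ[ℂ] L2Vec M.dom := LinearMap.fst ℂ (L2Vec M.dom) (L2 M.dom)

/-- The component `p` of `{v, p}`. -/
def pre : EnergySpace M →ₗ[ℂ] L2 M.dom := LinearMap.snd ℂ (L2Vec M.dom) (L2 M.dom)

theorem vel_add_ae (Φ Ψ : EnergySpace M) :
    vel (Φ + Ψ) =ᵐ[volume.restrict M.dom] fun x => vel Φ x + vel Ψ x := by
  rw [map_add]; exact Lp.coeFn_add _ _

theorem pre_add_ae (Φ Ψ : EnergySpace M) :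
    pre (Φ + Ψ) =ᵐ[volume.restrict M.dom] fun x => pre Φ x + pre Ψ x := by
  rw [map_add]; exact Lp.coeFn_add _ _

theorem vel_smul_ae (c : ℂ) (Φ : EnergySpace M) :
    vel (c • Φ) =ᵐ[volume.restrict M.dom] fun x => c • vel Φ x := by
  rw [map_smul]; exact Lp.coeFn_smul _ _

theorem pre_smul_ae (c : ℂ) (Φ : EnergySpace M) :
    pre (c • Φ) =ᵐ[volume.restrict M.dom] fun x => c • pre Φ x := by
  rw [map_smul]; exact Lp.coeFn_smul _ _

/-- The weighted inner product `∫ (α v | v') + ∫ β p conj(p')` of `Ψ = {v, p}` and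
`Φ = {v', p'}`, linear in `Ψ` and antilinear in `Φ`. -/
def weightedInner (Φ Ψ : EnergySpace M) : ℂ :=
  (∫ x in M.dom, inner ℂ (vel Φ x) (matAct (M.α x) (vel Ψ x))) +
    ∫ x in M.dom, (M.β x : ℂ) * inner ℂ (pre Φ x) (pre Ψ x)

theorem inner_matAct (A : Matrix (Fin d) (Fin d) ℝ) (u v : EuclideanSpace ℂ (Fin d)) :
    inner ℂ u (matAct A v) = ∑ i, ∑ j, (A i j : ℂ) * (starRingEnd ℂ (u i) * v j) := by
  simp only [matAct, PiLp.inner_apply, RCLike.inner_apply, Finset.sum_mul]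
  refine Finset.sum_congr rfl fun i _ => Finset.sum_congr rfl fun j _ => ?_
  ring

theorem re_inner_matAct (A : Matrix (Fin d) (Fin d) ℝ) (v : EuclideanSpace ℂ (Fin d)) :
    (inner ℂ v (matAct A v)).re =
      (∑ i, ∑ j, (v i).re * A i j * (v j).re) + ∑ i, ∑ j, (v i).im * A i j * (v j).im := by
  rw [inner_matAct, Complex.re_sum, ← Finset.sum_add_distrib]
  refine Finset.sum_congr rfl fun i _ => ?_
  rw [Complex.re_sum, ← Finset.sum_add_distrib]
  refine Finset.sum_congr rfl fun j _ => ?_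
  simp
  ring

theorem integrable_vel (Φ Ψ : EnergySpace M) :
    Integrable (fun x => inner ℂ (vel Φ x) (matAct (M.α x) (vel Ψ x)))
      (volume.restrict M.dom) := by
  simp_rw [inner_matAct]
  refine integrable_finsetSum _ fun i _ => integrable_finsetSum _ fun j _ => ?_
  have h1 : MemLp (fun x => starRingEnd ℂ (vel Φ x i)) 2 (volume.restrict M.dom) :=
    ((EuclideanSpace.proj (𝕜 := ℂ) i).comp_memLp' (Lp.memLp (vel Φ))).star
  have h2 : MemLp (fun x => vel Ψ x j) 2 (volume.restrict M.dom) :=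
    (EuclideanSpace.proj (𝕜 := ℂ) j).comp_memLp' (Lp.memLp (vel Ψ))
  have h3 : MemLp (fun x => (M.α x i j : ℂ)) ∞ (volume.restrict M.dom) := (M.memLp_α i j).ofReal
  exact (h1.integrable_mul h2).mul_of_top_right h3

theorem integrable_pre (Φ Ψ : EnergySpace M) :
    Integrable (fun x => (M.β x : ℂ) * inner ℂ (pre Φ x) (pre Ψ x))
      (volume.restrict M.dom) :=
  (L2.integrable_inner (𝕜 := ℂ) (pre Φ) (pre Ψ)).mul_of_top_right M.memLp_β.ofReal

theorem norm_vel_sq (Φ : EnergySpace M) :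
    ‖vel Φ‖ ^ 2 = ∫ x in M.dom, ‖vel Φ x‖ ^ 2 := by
  have h := L2.inner_def (𝕜 := ℂ) (vel Φ) (vel Φ)
  simp only [inner_self_eq_norm_sq_to_K] at h
  have h2 : ((‖vel Φ‖ ^ 2 : ℝ) : ℂ) = ((∫ x in M.dom, ‖vel Φ x‖ ^ 2 : ℝ) : ℂ) := by
    rw [← integral_complex_ofReal]
    push_cast
    exact h
  exact_mod_cast h2

theorem norm_pre_sq (Φ : EnergySpace M) :
    ‖pre Φ‖ ^ 2 = ∫ x in M.dom, ‖pre Φ x‖ ^ 2 := by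
  have h := L2.inner_def (𝕜 := ℂ) (pre Φ) (pre Φ)
  simp only [inner_self_eq_norm_sq_to_K] at h
  have h2 : ((‖pre Φ‖ ^ 2 : ℝ) : ℂ) = ((∫ x in M.dom, ‖pre Φ x‖ ^ 2 : ℝ) : ℂ) := by
    rw [← integral_complex_ofReal]
    push_cast
    exact h
  exact_mod_cast h2

theorem integrable_sq_vel (Φ : EnergySpace M) :
    Integrable (fun x => ‖vel Φ x‖ ^ 2) (volume.restrict M.dom) :=
  (Lp.memLp (vel Φ)).norm.integrable_sq

theorem integrable_sq_pre (Φ : EnergySpace M) :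
    Integrable (fun x => ‖pre Φ x‖ ^ 2) (volume.restrict M.dom) :=
  (Lp.memLp (pre Φ)).norm.integrable_sq

theorem re_weightedInner (Φ : EnergySpace M) :
    (weightedInner Φ Φ).re =
      (∫ x in M.dom, (inner ℂ (vel Φ x) (matAct (M.α x) (vel Φ x))).re) +
        ∫ x in M.dom, M.β x * ‖pre Φ x‖ ^ 2 := by
  have h1 := integral_re (integrable_vel Φ Φ)
  have h2 := integral_re (integrable_pre Φ Φ)
  simp only [RCLike.re_to_complex] at h1 h2
  rw [weightedInner, Complex.add_re, ← h1, ← h2]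
  congr 1
  refine integral_congr_ae (ae_of_all _ fun x => ?_)
  simp only [inner_self_eq_norm_sq_to_K, Complex.re_ofReal_mul]
  norm_cast

theorem lower_bound (M : Medium d) : ∃ c : ℝ, 0 < c ∧ ∀ Φ : EnergySpace M,
    c * (‖vel Φ‖ ^ 2 + ‖pre Φ‖ ^ 2) ≤ (weightedInner Φ Φ).re := by
  obtain ⟨a, ha, hα⟩ := M.pos_α
  obtain ⟨b, hb, hβ⟩ := M.pos_β
  refine ⟨min a b, lt_min ha hb, fun Φ => ?_⟩
  have h1 : a * ‖vel Φ‖ ^ 2 ≤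
      ∫ x in M.dom, (inner ℂ (vel Φ x) (matAct (M.α x) (vel Φ x))).re := by
    rw [norm_vel_sq, ← integral_const_mul]
    refine integral_mono_ae ((integrable_sq_vel Φ).const_mul a) (integrable_vel Φ Φ).re ?_
    filter_upwards [hα] with x hx
    change _ ≤ (inner ℂ (vel Φ x) (matAct (M.α x) (vel Φ x))).re
    rw [re_inner_matAct, EuclideanSpace.norm_sq_eq]
    have e : ∑ i, ‖vel Φ x i‖ ^ 2 = ∑ i, (vel Φ x i).re ^ 2 + ∑ i, (vel Φ x i).im ^ 2 := by
      rw [← Finset.sum_add_distrib]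
      refine Finset.sum_congr rfl fun i _ => ?_
      rw [Complex.sq_norm, Complex.normSq_apply]
      ring
    rw [e, mul_add]
    exact add_le_add (hx _) (hx _)
  have h2 : b * ‖pre Φ‖ ^ 2 ≤ ∫ x in M.dom, M.β x * ‖pre Φ x‖ ^ 2 := by
    rw [norm_pre_sq, ← integral_const_mul]
    refine integral_mono_ae ((integrable_sq_pre Φ).const_mul b)
      ((integrable_sq_pre Φ).mul_of_top_right M.memLp_β) ?_
    filter_upwards [hβ] with x hx
    exact mul_le_mul_of_nonneg_right hx (sq_nonneg _)
  rw [re_weightedInner]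
  have h3 : min a b * ‖vel Φ‖ ^ 2 ≤ a * ‖vel Φ‖ ^ 2 :=
    mul_le_mul_of_nonneg_right (min_le_left _ _) (sq_nonneg _)
  have h4 : min a b * ‖pre Φ‖ ^ 2 ≤ b * ‖pre Φ‖ ^ 2 :=
    mul_le_mul_of_nonneg_right (min_le_right _ _) (sq_nonneg _)
  linarith

theorem ae_bound {f : Sp d → ℝ} {μ : Measure (Sp d)} (hf : MemLp f ∞ μ) :
    ∃ C : ℝ, 0 ≤ C ∧ ∀ᵐ x ∂μ, |f x| ≤ C := by
  refine ⟨(eLpNorm f ∞ μ).toReal, ENNReal.toReal_nonneg, ?_⟩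
  filter_upwards [ae_le_eLpNormEssSup (f := f) (μ := μ)] with x hx
  rw [← eLpNorm_exponent_top] at hx
  have := ENNReal.toReal_mono hf.2.ne hx
  simpa using this

theorem upper_bound (M : Medium d) : ∃ C : ℝ, 0 < C ∧ ∀ Φ : EnergySpace M,
    (weightedInner Φ Φ).re ≤ C * (‖vel Φ‖ ^ 2 + ‖pre Φ‖ ^ 2) := by
  choose A hA0 hA using fun i j => ae_bound (M.memLp_α i j)
  obtain ⟨B, hB0, hB⟩ := ae_bound M.memLp_β
  have hS : 0 ≤ ∑ i, ∑ j, A i j := Finset.sum_nonneg fun i _ => Finset.sum_nonneg fun j _ => hA0 i j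
  refine ⟨(∑ i, ∑ j, A i j) + B + 1, by linarith, fun Φ => ?_⟩
  have h1 : ∫ x in M.dom, (inner ℂ (vel Φ x) (matAct (M.α x) (vel Φ x))).re ≤
      (∑ i, ∑ j, A i j) * ‖vel Φ‖ ^ 2 := by
    rw [norm_vel_sq, ← integral_const_mul]
    refine integral_mono_ae (integrable_vel Φ Φ).re ((integrable_sq_vel Φ).const_mul _) ?_
    have hA' : ∀ᵐ x ∂(volume.restrict M.dom), ∀ i j, |M.α x i j| ≤ A i j :=
      ae_all_iff.2 fun i => ae_all_iff.2 fun j => hA i j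
    filter_upwards [hA'] with x hx
    refine (Complex.re_le_norm _).trans ?_
    rw [inner_matAct, Finset.sum_mul]
    refine (norm_sum_le _ _).trans (Finset.sum_le_sum fun i _ => ?_)
    rw [Finset.sum_mul]
    refine (norm_sum_le _ _).trans (Finset.sum_le_sum fun j _ => ?_)
    rw [norm_mul, norm_mul, RCLike.norm_conj, Complex.norm_real, Real.norm_eq_abs, sq]
    exact mul_le_mul (hx i j) (mul_le_mul (PiLp.norm_apply_le _ i) (PiLp.norm_apply_le _ j)
      (norm_nonneg _) (norm_nonneg _)) (by positivity) (hA0 i j)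
  have h2 : ∫ x in M.dom, M.β x * ‖pre Φ x‖ ^ 2 ≤ B * ‖pre Φ‖ ^ 2 := by
    rw [norm_pre_sq, ← integral_const_mul]
    refine integral_mono_ae ((integrable_sq_pre Φ).mul_of_top_right M.memLp_β)
      ((integrable_sq_pre Φ).const_mul B) ?_
    filter_upwards [hB] with x hx
    exact mul_le_mul_of_nonneg_right ((le_abs_self _).trans hx) (sq_nonneg _)
  rw [re_weightedInner]
  nlinarith [sq_nonneg ‖vel Φ‖, sq_nonneg ‖pre Φ‖, mul_nonneg hB0 (sq_nonneg ‖vel Φ‖),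
    mul_nonneg hS (sq_nonneg ‖pre Φ‖)]

theorem conj_weightedInner (Φ Ψ : EnergySpace M) :
    starRingEnd ℂ (weightedInner Ψ Φ) = weightedInner Φ Ψ := by
  rw [weightedInner, weightedInner, map_add, ← integral_conj, ← integral_conj]
  congr 1
  · refine integral_congr_ae ?_
    filter_upwards [M.symm_α] with x hx
    rw [inner_matAct, inner_matAct, map_sum, Finset.sum_comm]
    simp_rw [map_sum]
    rw [Finset.sum_comm]
    rw [Finset.sum_comm]
    refine Finset.sum_congr rfl fun i _ => Finset.sum_congr rfl fun j _ => ?_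
    rw [map_mul, map_mul, Complex.conj_conj, Complex.conj_ofReal, hx.apply i j]
    ring
  · refine integral_congr_ae (ae_of_all _ fun x => ?_)
    simp only [map_mul, Complex.conj_ofReal, inner_conj_symm]

/-- The weighted inner product is an inner product. -/
@[reducible] def core (M : Medium d) : InnerProductSpace.Core ℂ (EnergySpace M) where
  inner := weightedInner
  conj_inner_symm := conj_weightedInner
  re_inner_nonneg Φ := by
    obtain ⟨c, hc, h⟩ := lower_bound M
    exact le_trans (by positivity) (h Φ)
  add_left Φ Φ' Ψ := by
    simp only [weightedInner]
    rw [add_add_add_comm, ← integral_add (integrable_vel _ _) (integrable_vel _ _),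
      ← integral_add (integrable_pre _ _) (integrable_pre _ _)]
    congr 1
    · refine integral_congr_ae ?_
      filter_upwards [vel_add_ae Φ Φ'] with x hx
      rw [hx, inner_add_left]
    · refine integral_congr_ae ?_
      filter_upwards [pre_add_ae Φ Φ'] with x hx
      rw [hx, inner_add_left, mul_add]
  smul_left Φ Ψ r := by
    simp only [weightedInner]
    rw [mul_add, ← integral_const_mul, ← integral_const_mul]
    congr 1
    · refine integral_congr_ae ?_
      filter_upwards [vel_smul_ae r Φ] with x hx
      rw [hx, inner_smul_left]
    · refine integral_congr_ae ?_
      filter_upwards [pre_smul_ae r Φ] with x hx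
      rw [hx, inner_smul_left]
      ring
  definite Φ hΦ := by
    obtain ⟨c, hc, h⟩ := lower_bound M
    have h0 := h Φ
    change weightedInner Φ Φ = 0 at hΦ
    rw [hΦ, Complex.zero_re] at h0
    have h1 : ‖vel Φ‖ ^ 2 + ‖pre Φ‖ ^ 2 ≤ 0 := by
      by_contra hcon
      exact absurd h0 (not_le.2 (mul_pos hc (not_le.1 hcon)))
    have h2 : ‖vel Φ‖ = 0 := by nlinarith [sq_nonneg ‖vel Φ‖, sq_nonneg ‖pre Φ‖]
    have h3 : ‖pre Φ‖ = 0 := by nlinarith [sq_nonneg ‖vel Φ‖, sq_nonneg ‖pre Φ‖]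
    exact Prod.ext (norm_eq_zero.1 h2) (norm_eq_zero.1 h3)

instance : NormedAddCommGroup (EnergySpace M) := (core M).toNormedAddCommGroup
instance : InnerProductSpace ℂ (EnergySpace M) := InnerProductSpace.ofCore (core M).toCore

theorem inner_def (Φ Ψ : EnergySpace M) : inner ℂ Φ Ψ = weightedInner Φ Ψ := rfl

theorem norm_sq (Φ : EnergySpace M) : ‖Φ‖ ^ 2 = (weightedInner Φ Φ).re := by
  rw [← inner_def, ← RCLike.re_to_complex, inner_self_eq_norm_sq]

instance : CompleteSpace (EnergySpace M) := by
  obtain ⟨c, hc, hl⟩ := lower_bound M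
  obtain ⟨C, hC, hu⟩ := upper_bound M
  let e : EnergySpace M ≃ₗ[ℂ] (L2Vec M.dom × L2 M.dom) := LinearEquiv.refl ℂ _
  have h1 : ∀ Φ : EnergySpace M, ‖e Φ‖ ≤ Real.sqrt c⁻¹ * ‖Φ‖ := fun Φ => by
    have h := hl Φ
    rw [← norm_sq] at h
    have hm : ‖e Φ‖ ^ 2 ≤ ‖vel Φ‖ ^ 2 + ‖pre Φ‖ ^ 2 := by
      have : ‖e Φ‖ = max ‖vel Φ‖ ‖pre Φ‖ := rfl
      rw [this]
      rcases max_choice ‖vel Φ‖ ‖pre Φ‖ with h | h <;> rw [h] <;>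
        nlinarith [sq_nonneg ‖vel Φ‖, sq_nonneg ‖pre Φ‖]
    refine (sq_le_sq₀ (norm_nonneg _) (by positivity)).1 ?_
    rw [mul_pow, Real.sq_sqrt (by positivity), inv_mul_eq_div, le_div_iff₀ hc]
    nlinarith
  have h2 : ∀ x : L2Vec M.dom × L2 M.dom, ‖e.symm x‖ ≤ Real.sqrt (2 * C) * ‖x‖ := fun x => by
    have h := hu (e.symm x)
    rw [← norm_sq] at h
    have ha : ‖vel (e.symm x)‖ ≤ ‖x‖ := norm_fst_le x
    have hb : ‖pre (e.symm x)‖ ≤ ‖x‖ := norm_snd_le x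
    refine (sq_le_sq₀ (norm_nonneg _) (by positivity)).1 ?_
    rw [mul_pow, Real.sq_sqrt (by positivity)]
    have ha2 := pow_le_pow_left₀ (norm_nonneg _) ha 2
    have hb2 := pow_le_pow_left₀ (norm_nonneg _) hb 2
    nlinarith
  exact (e.toContinuousLinearEquivOfBounds _ _ h1 h2).isUniformEmbedding.isUniformInducing
    |>.completeSpace_congr (e.surjective) |>.2 inferInstance

end EnergySpace

/-! ## Linearity of weak derivatives and traces -/

theorem integrable_partialD_mul {O : Set (Sp d)} {φ : Sp d → ℝ} (hφ : IsTestFunction O φ)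
    (i : Fin d) {f : Sp d → ℂ} (hf : MemLp f 2 (volume.restrict O)) :
    Integrable (fun x => ((partialD i φ x : ℝ) : ℂ) * f x) (volume.restrict O) := by
  have hc : Continuous (partialD i φ) :=
    (hφ.1.continuous_fderiv (by simp)).clm_apply continuous_const
  have hs : HasCompactSupport (partialD i φ) := (hφ.2.1.fderiv (𝕜 := ℝ)).comp_left
    (g := fun L : Sp d →L[ℝ] ℝ => L (EuclideanSpace.single i 1)) rfl
  exact (hc.memLp_of_hasCompactSupport hs (p := 2)).ofReal.integrable_mul hf

theorem integrable_test_mul {O : Set (Sp d)} {φ : Sp d → ℝ} (hφ : IsTestFunction O φ)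
    {f : Sp d → ℂ} (hf : MemLp f 2 (volume.restrict O)) :
    Integrable (fun x => (φ x : ℂ) * f x) (volume.restrict O) :=
  (hφ.1.continuous.memLp_of_hasCompactSupport hφ.2.1 (p := 2)).ofReal.integrable_mul hf

theorem memLp_coord {O : Set (Sp d)} (v : L2Vec O) (i : Fin d) :
    MemLp (fun x => v x i) 2 (volume.restrict O) :=
  (EuclideanSpace.proj (𝕜 := ℂ) i).comp_memLp' (Lp.memLp v)

theorem HasWeakGrad.zero (O : Set (Sp d)) : HasWeakGrad O 0 0 := by
  intro φ _ i
  have h1 : ∫ x in O, ((partialD i φ x : ℝ) : ℂ) * (0 : L2 O) x = 0 := by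
    refine integral_eq_zero_of_ae ?_
    filter_upwards [Lp.coeFn_zero ℂ 2 (volume.restrict O)] with x hx
    rw [hx]
    simp
  have h2 : ∫ x in O, (φ x : ℂ) * (0 : L2Vec O) x i = 0 := by
    refine integral_eq_zero_of_ae ?_
    filter_upwards [Lp.coeFn_zero (EuclideanSpace ℂ (Fin d)) 2 (volume.restrict O)] with x hx
    rw [hx]
    simp
  rw [h1, h2, neg_zero]

theorem HasWeakGrad.add {O : Set (Sp d)} {p q : L2 O} {G H : L2Vec O}
    (h : HasWeakGrad O p G) (k : HasWeakGrad O q H) : HasWeakGrad O (p + q) (G + H) := by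
  intro φ hφ i
  have h1 : ∫ x in O, ((partialD i φ x : ℝ) : ℂ) * (p + q) x =
      (∫ x in O, ((partialD i φ x : ℝ) : ℂ) * p x) + ∫ x in O, ((partialD i φ x : ℝ) : ℂ) * q x := by
    rw [← integral_add (integrable_partialD_mul hφ i (Lp.memLp p))
      (integrable_partialD_mul hφ i (Lp.memLp q))]
    refine integral_congr_ae ?_
    filter_upwards [Lp.coeFn_add p q] with x hx
    rw [hx, Pi.add_apply, mul_add]
  have h2 : ∫ x in O, (φ x : ℂ) * (G + H) x i =
      (∫ x in O, (φ x : ℂ) * G x i) + ∫ x in O, (φ x : ℂ) * H x i := by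
    rw [← integral_add (integrable_test_mul hφ (memLp_coord G i))
      (integrable_test_mul hφ (memLp_coord H i))]
    refine integral_congr_ae ?_
    filter_upwards [Lp.coeFn_add G H] with x hx
    rw [hx, Pi.add_apply, PiLp.add_apply, mul_add]
  rw [h1, h2, h φ hφ i, k φ hφ i]
  ring

theorem HasWeakGrad.smul {O : Set (Sp d)} {p : L2 O} {G : L2Vec O}
    (h : HasWeakGrad O p G) (c : ℂ) : HasWeakGrad O (c • p) (c • G) := by
  intro φ hφ i
  have h1 : ∫ x in O, ((partialD i φ x : ℝ) : ℂ) * (c • p) x =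
      c * ∫ x in O, ((partialD i φ x : ℝ) : ℂ) * p x := by
    rw [← integral_const_mul]
    refine integral_congr_ae ?_
    filter_upwards [Lp.coeFn_smul c p] with x hx
    rw [hx, Pi.smul_apply, smul_eq_mul]
    ring
  have h2 : ∫ x in O, (φ x : ℂ) * (c • G) x i = c * ∫ x in O, (φ x : ℂ) * G x i := by
    rw [← integral_const_mul]
    refine integral_congr_ae ?_
    filter_upwards [Lp.coeFn_smul c G] with x hx
    rw [hx, Pi.smul_apply, PiLp.smul_apply, smul_eq_mul]
    ring
  rw [h1, h2, h φ hφ i]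
  ring

theorem HasWeakDiv.zero (O : Set (Sp d)) : HasWeakDiv O 0 0 := by
  intro φ _
  have h1 : ∫ x in O, ∑ i : Fin d, ((partialD i φ x : ℝ) : ℂ) * (0 : L2Vec O) x i = 0 := by
    refine integral_eq_zero_of_ae ?_
    filter_upwards [Lp.coeFn_zero (EuclideanSpace ℂ (Fin d)) 2 (volume.restrict O)] with x hx
    rw [hx]
    simp
  have h2 : ∫ x in O, (φ x : ℂ) * (0 : L2 O) x = 0 := by
    refine integral_eq_zero_of_ae ?_
    filter_upwards [Lp.coeFn_zero ℂ 2 (volume.restrict O)] with x hx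
    rw [hx]
    simp
  rw [h1, h2, neg_zero]

theorem HasWeakDiv.add {O : Set (Sp d)} {v w : L2Vec O} {D E : L2 O}
    (h : HasWeakDiv O v D) (k : HasWeakDiv O w E) : HasWeakDiv O (v + w) (D + E) := by
  intro φ hφ
  have h1 : ∫ x in O, ∑ i : Fin d, ((partialD i φ x : ℝ) : ℂ) * (v + w) x i =
      (∫ x in O, ∑ i : Fin d, ((partialD i φ x : ℝ) : ℂ) * v x i) +
        ∫ x in O, ∑ i : Fin d, ((partialD i φ x : ℝ) : ℂ) * w x i := by
    rw [← integral_add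
      (integrable_finsetSum _ fun i _ => integrable_partialD_mul hφ i (memLp_coord v i))
      (integrable_finsetSum _ fun i _ => integrable_partialD_mul hφ i (memLp_coord w i))]
    refine integral_congr_ae ?_
    filter_upwards [Lp.coeFn_add v w] with x hx
    rw [hx, ← Finset.sum_add_distrib]
    exact Finset.sum_congr rfl fun i _ => by rw [Pi.add_apply, PiLp.add_apply, mul_add]
  have h2 : ∫ x in O, (φ x : ℂ) * (D + E) x =
      (∫ x in O, (φ x : ℂ) * D x) + ∫ x in O, (φ x : ℂ) * E x := by
    rw [← integral_add (integrable_test_mul hφ (Lp.memLp D)) (integrable_test_mul hφ (Lp.memLp E))]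
    refine integral_congr_ae ?_
    filter_upwards [Lp.coeFn_add D E] with x hx
    rw [hx, Pi.add_apply, mul_add]
  rw [h1, h2, h φ hφ, k φ hφ]
  ring

theorem HasWeakDiv.smul {O : Set (Sp d)} {v : L2Vec O} {D : L2 O}
    (h : HasWeakDiv O v D) (c : ℂ) : HasWeakDiv O (c • v) (c • D) := by
  intro φ hφ
  have h1 : ∫ x in O, ∑ i : Fin d, ((partialD i φ x : ℝ) : ℂ) * (c • v) x i =
      c * ∫ x in O, ∑ i : Fin d, ((partialD i φ x : ℝ) : ℂ) * v x i := by
    rw [← integral_const_mul]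
    refine integral_congr_ae ?_
    filter_upwards [Lp.coeFn_smul c v] with x hx
    rw [hx, Finset.mul_sum]
    refine Finset.sum_congr rfl fun i _ => ?_
    rw [Pi.smul_apply, PiLp.smul_apply, smul_eq_mul]
    ring
  have h2 : ∫ x in O, (φ x : ℂ) * (c • D) x = c * ∫ x in O, (φ x : ℂ) * D x := by
    rw [← integral_const_mul]
    refine integral_congr_ae ?_
    filter_upwards [Lp.coeFn_smul c D] with x hx
    rw [hx, Pi.smul_apply, smul_eq_mul]
    ring
  rw [h1, h2, h φ hφ]
  ring

/-- Weak gradients are unique. -/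
theorem HasWeakGrad.eq_zero {O : Set (Sp d)} (hO : IsOpen O) {G : L2Vec O}
    (h : HasWeakGrad O 0 G) : G = 0 := by
  have hz : ∀ i : Fin d, ∀ᵐ x ∂(volume.restrict O), G x i = 0 := by
    intro i
    have hm := memLp_coord G i
    have hloc : LocallyIntegrableOn (fun x => G x i) O (volume.restrict O) :=
      (hm.locallyIntegrable (by norm_num)).locallyIntegrableOn O
    have key := hO.ae_eq_zero_of_integral_contDiff_smul_eq_zero hloc (fun g hg1 hg2 hg3 => by
      have h1 : ∫ x in O, ((partialD i g x : ℝ) : ℂ) * (0 : L2 O) x = 0 := by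
        refine integral_eq_zero_of_ae ?_
        filter_upwards [Lp.coeFn_zero ℂ 2 (volume.restrict O)] with x hx
        rw [hx]
        simp
      have h2 := h g ⟨hg1, hg2, hg3⟩ i
      rw [h1, eq_comm, neg_eq_zero] at h2
      simpa [Complex.real_smul] using h2)
    filter_upwards [key, ae_restrict_mem hO.measurableSet] with x hx hxO using hx hxO
  refine Lp.ext ?_
  filter_upwards [ae_all_iff.2 hz, Lp.coeFn_zero (EuclideanSpace ℂ (Fin d)) 2 (volume.restrict O)]
    with x hx h0
  rw [h0]
  ext i
  simpa using hx i

/-- Weak divergences are unique. -/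
theorem HasWeakDiv.eq_zero {O : Set (Sp d)} (hO : IsOpen O) {D : L2 O}
    (h : HasWeakDiv O 0 D) : D = 0 := by
  have hloc : LocallyIntegrableOn (fun x => D x) O (volume.restrict O) :=
    ((Lp.memLp D).locallyIntegrable (by norm_num)).locallyIntegrableOn O
  have key := hO.ae_eq_zero_of_integral_contDiff_smul_eq_zero hloc (fun g hg1 hg2 hg3 => by
    have h1 : ∫ x in O, ∑ i : Fin d, ((partialD i g x : ℝ) : ℂ) * (0 : L2Vec O) x i = 0 := by
      refine integral_eq_zero_of_ae ?_
      filter_upwards [Lp.coeFn_zero (EuclideanSpace ℂ (Fin d)) 2 (volume.restrict O)] with x hx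
      rw [hx]
      simp
    have h2 := h g ⟨hg1, hg2, hg3⟩
    rw [h1, eq_comm, neg_eq_zero] at h2
    simpa [Complex.real_smul] using h2)
  refine Lp.ext ?_
  filter_upwards [key, ae_restrict_mem hO.measurableSet, Lp.coeFn_zero ℂ 2 (volume.restrict O)]
    with x hx hxO h0
  rw [h0]
  exact hx hxO

theorem classicalGrad_add {u w : Sp d → ℂ} (hu : ContDiff ℝ ∞ u) (hw : ContDiff ℝ ∞ w)
    (x : Sp d) : classicalGrad (u + w) x = classicalGrad u x + classicalGrad w x := by
  ext i
  simp [classicalGrad, partialD, fderiv_add (hu.differentiable (by simp) x)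
    (hw.differentiable (by simp) x)]

theorem classicalGrad_smul {u : Sp d → ℂ} (c : ℂ) (hu : ContDiff ℝ ∞ u)
    (x : Sp d) : classicalGrad (c • u) x = c • classicalGrad u x := by
  ext i
  simp [classicalGrad, partialD, fderiv_const_smul (hu.differentiable (by simp) x)]

theorem continuous_classicalGrad {u : Sp d → ℂ} (hu : ContDiff ℝ ∞ u) :
    Continuous (classicalGrad u) := by
  refine (PiLp.continuous_toLp 2 _).comp (continuous_pi fun i => ?_)
  exact (hu.continuous_fderiv (by simp)).clm_apply continuous_const

/-- `L²`-convergence is compatible with sums. -/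
theorem tendsto_eLpNorm_add {F : Type*} [NormedAddCommGroup F] {μ : Measure (Sp d)}
    {u w : ℕ → Sp d → F} {f g k : Lp F 2 μ} {s : ℕ → Sp d → F}
    (hu : ∀ n, AEStronglyMeasurable (u n) μ) (hw : ∀ n, AEStronglyMeasurable (w n) μ)
    (hs : ∀ n x, s n x = u n x + w n x) (hk : k = f + g)
    (h1 : Tendsto (fun n => eLpNorm (fun x => u n x - f x) 2 μ) atTop (𝓝 0))
    (h2 : Tendsto (fun n => eLpNorm (fun x => w n x - g x) 2 μ) atTop (𝓝 0)) :
    Tendsto (fun n => eLpNorm (fun x => s n x - k x) 2 μ) atTop (𝓝 0) := by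
  subst hk
  have h3 := h1.add h2
  rw [add_zero] at h3
  refine tendsto_of_tendsto_of_tendsto_of_le_of_le tendsto_const_nhds h3 (fun _ => bot_le)
    fun n => ?_
  have he : eLpNorm (fun x => s n x - (f + g : Lp F 2 μ) x) 2 μ =
      eLpNorm ((fun x => u n x - f x) + fun x => w n x - g x) 2 μ := by
    refine eLpNorm_congr_ae ?_
    filter_upwards [Lp.coeFn_add f g] with x hx
    rw [hs, hx, Pi.add_apply, Pi.add_apply]
    abel
  change eLpNorm (fun x => s n x - (f + g : Lp F 2 μ) x) 2 μ ≤ _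
  rw [he]
  exact eLpNorm_add_le ((hu n).sub (Lp.aestronglyMeasurable f))
    ((hw n).sub (Lp.aestronglyMeasurable g)) (by norm_num)

/-- `L²`-convergence is compatible with scalar multiples. -/
theorem tendsto_eLpNorm_smul {F : Type*} [NormedAddCommGroup F] [NormedSpace ℂ F]
    {μ : Measure (Sp d)} {u : ℕ → Sp d → F} {f k : Lp F 2 μ} {s : ℕ → Sp d → F} (c : ℂ)
    (hs : ∀ n x, s n x = c • u n x) (hk : k = c • f)
    (h1 : Tendsto (fun n => eLpNorm (fun x => u n x - f x) 2 μ) atTop (𝓝 0)) :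
    Tendsto (fun n => eLpNorm (fun x => s n x - k x) 2 μ) atTop (𝓝 0) := by
  subst hk
  have he : ∀ n, eLpNorm (fun x => s n x - (c • f : Lp F 2 μ) x) 2 μ =
      ‖c‖ₑ * eLpNorm (fun x => u n x - f x) 2 μ := fun n => by
    rw [← eLpNorm_const_smul]
    refine eLpNorm_congr_ae ?_
    filter_upwards [Lp.coeFn_smul c f] with x hx
    rw [hs, hx, Pi.smul_apply, Pi.smul_apply, smul_sub]
  simp_rw [he]
  simpa using ENNReal.Tendsto.const_mul h1 (Or.inr (by simp))

theorem IsTrace.zero (O : Set (Sp d)) : IsTrace O 0 0 := by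
  refine ⟨0, HasWeakGrad.zero O, fun _ => 0, fun _ => contDiff_const, ?_, ?_, ?_⟩
  · refine tendsto_const_nhds.congr fun n => ?_
    rw [eq_comm, ← eLpNorm_zero (p := 2) (μ := volume.restrict O) (ε := ℂ)]
    refine eLpNorm_congr_ae ?_
    filter_upwards [Lp.coeFn_zero ℂ 2 (volume.restrict O)] with x hx
    rw [hx]
    simp
  · refine tendsto_const_nhds.congr fun n => ?_
    rw [eq_comm, ← eLpNorm_zero (p := 2) (μ := volume.restrict O)
      (ε := EuclideanSpace ℂ (Fin d))]
    refine eLpNorm_congr_ae ?_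
    filter_upwards [Lp.coeFn_zero (EuclideanSpace ℂ (Fin d)) 2 (volume.restrict O)] with x hx
    rw [hx]
    ext i
    simp [classicalGrad, partialD]
  · refine tendsto_const_nhds.congr fun n => ?_
    rw [eq_comm, ← eLpNorm_zero (p := 2) (μ := surfaceMeasure O) (ε := ℂ)]
    refine eLpNorm_congr_ae ?_
    filter_upwards [Lp.coeFn_zero ℂ 2 (surfaceMeasure O)] with x hx
    rw [hx]
    simp

theorem IsTrace.add {O : Set (Sp d)} {p q : L2 O} {f g : L2Bdry O}
    (h : IsTrace O p f) (k : IsTrace O q g) : IsTrace O (p + q) (f + g) := by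
  obtain ⟨G, hG, u, hu, h1, h2, h3⟩ := h
  obtain ⟨H, hH, w, hw, k1, k2, k3⟩ := k
  refine ⟨G + H, hG.add hH, fun n => u n + w n, fun n => (hu n).add (hw n), ?_, ?_, ?_⟩
  · exact tendsto_eLpNorm_add (fun n => (hu n).continuous.aestronglyMeasurable)
      (fun n => (hw n).continuous.aestronglyMeasurable) (fun _ _ => rfl) rfl h1 k1
  · exact tendsto_eLpNorm_add (fun n => (continuous_classicalGrad (hu n)).aestronglyMeasurable)
      (fun n => (continuous_classicalGrad (hw n)).aestronglyMeasurable)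
      (fun n x => classicalGrad_add (hu n) (hw n) x) rfl h2 k2
  · exact tendsto_eLpNorm_add (fun n => (hu n).continuous.aestronglyMeasurable)
      (fun n => (hw n).continuous.aestronglyMeasurable) (fun _ _ => rfl) rfl h3 k3

theorem IsTrace.smul {O : Set (Sp d)} {p : L2 O} {f : L2Bdry O}
    (h : IsTrace O p f) (c : ℂ) : IsTrace O (c • p) (c • f) := by
  obtain ⟨G, hG, u, hu, h1, h2, h3⟩ := h
  refine ⟨c • G, hG.smul c, fun n => c • u n, fun n => contDiff_const.smul (hu n), ?_, ?_, ?_⟩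
  · exact tendsto_eLpNorm_smul c (fun _ _ => rfl) rfl h1
  · exact tendsto_eLpNorm_smul c (fun n x => classicalGrad_smul c (hu n) x) rfl h2
  · exact tendsto_eLpNorm_smul c (fun _ _ => rfl) rfl h3

theorem IsNormalTrace.zero (O : Set (Sp d)) : IsNormalTrace O 0 0 :=
  ⟨0, HasWeakDiv.zero O, fun p G g _ _ => by simp⟩

theorem IsNormalTrace.add {O : Set (Sp d)} {v w : L2Vec O} {h k : HMinusHalf O}
    (hv : IsNormalTrace O v h) (hw : IsNormalTrace O w k) : IsNormalTrace O (v + w) (h + k) := by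
  obtain ⟨D, hD, h1⟩ := hv
  obtain ⟨E, hE, h2⟩ := hw
  refine ⟨D + E, hD.add hE, fun p G g hG hg => ?_⟩
  rw [add_apply, h1 p G g hG hg, h2 p G g hG hg, inner_add_right,
    inner_add_right]
  ring

theorem IsNormalTrace.smul {O : Set (Sp d)} {v : L2Vec O} {h : HMinusHalf O}
    (hv : IsNormalTrace O v h) (c : ℂ) : IsNormalTrace O (c • v) (c • h) := by
  obtain ⟨D, hD, h1⟩ := hv
  refine ⟨c • D, hD.smul c, fun p G g hG hg => ?_⟩
  rw [smul_apply, h1 p G g hG hg, inner_smul_right, inner_smul_right,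
    smul_eq_mul, mul_add]

end Fields

/-! ## The acoustic operators -/

variable {d : ℕ}

theorem matAct_zero (A : Matrix (Fin d) (Fin d) ℝ) : matAct A 0 = 0 := by
  ext i
  simp [matAct]

theorem matAct_add (A : Matrix (Fin d) (Fin d) ℝ) (u v : EuclideanSpace ℂ (Fin d)) :
    matAct A (u + v) = matAct A u + matAct A v := by
  ext i
  simp [matAct, mul_add, Finset.sum_add_distrib]

theorem matAct_smul (A : Matrix (Fin d) (Fin d) ℝ) (c : ℂ) (v : EuclideanSpace ℂ (Fin d)) :
    matAct A (c • v) = c • matAct A v := by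
  ext i
  simp [matAct, Finset.mul_sum, mul_left_comm]

open EnergySpace

/-- The graph of `𝒜*` : the pairs `({v, p}, {w, q})` with `v ∈ H(div, O)`, `p ∈ H¹(O)`,
`w = (1/i) α⁻¹ ∇p` and `q = (1/i) β⁻¹ ∇·v`. -/
def maxGraph (M : Medium d) : Submodule ℂ (EnergySpace M × EnergySpace M) where
  carrier := {z | ∃ (G : L2Vec M.dom) (D : L2 M.dom),
    HasWeakGrad M.dom (pre z.1) G ∧ HasWeakDiv M.dom (vel z.1) D ∧
    vel z.2 =ᵐ[volume.restrict M.dom] (fun x => (1 / Complex.I) • matAct (M.α x)⁻¹ (G x)) ∧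
    pre z.2 =ᵐ[volume.restrict M.dom] (fun x => (1 / Complex.I) * (((M.β x)⁻¹ : ℝ) * D x))}
  zero_mem' := by
    refine ⟨0, 0, ?_, ?_, ?_, ?_⟩
    · simpa using HasWeakGrad.zero M.dom
    · simpa using HasWeakDiv.zero M.dom
    · simp only [Prod.snd_zero, map_zero]
      filter_upwards [Lp.coeFn_zero (EuclideanSpace ℂ (Fin d)) 2 (volume.restrict M.dom)] with x hx
      rw [hx]
      simp [matAct_zero]
    · simp only [Prod.snd_zero, map_zero]
      filter_upwards [Lp.coeFn_zero ℂ 2 (volume.restrict M.dom)] with x hx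
      rw [hx]
      simp
  add_mem' := by
    rintro z w ⟨G, D, h1, h2, h3, h4⟩ ⟨H, E, k1, k2, k3, k4⟩
    refine ⟨G + H, D + E, ?_, ?_, ?_, ?_⟩
    · simpa using h1.add k1
    · simpa using h2.add k2
    · filter_upwards [vel_add_ae z.2 w.2, Lp.coeFn_add G H, h3, k3] with x e1 e2 e3 e4
      rw [Prod.snd_add, e1, e2, e3, e4, Pi.add_apply, matAct_add, smul_add]
    · filter_upwards [pre_add_ae z.2 w.2, Lp.coeFn_add D E, h4, k4] with x e1 e2 e3 e4
      rw [Prod.snd_add, e1, e2, e3, e4, Pi.add_apply]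
      ring
  smul_mem' := by
    rintro c z ⟨G, D, h1, h2, h3, h4⟩
    refine ⟨c • G, c • D, ?_, ?_, ?_, ?_⟩
    · simpa using h1.smul c
    · simpa using h2.smul c
    · filter_upwards [vel_smul_ae c z.2, Lp.coeFn_smul c G, h3] with x e1 e2 e3
      rw [Prod.smul_snd, e1, e2, e3, Pi.smul_apply, matAct_smul, smul_comm]
    · filter_upwards [pre_smul_ae c z.2, Lp.coeFn_smul c D, h4] with x e1 e2 e3
      rw [Prod.smul_snd, e1, e2, e3, Pi.smul_apply, smul_eq_mul, smul_eq_mul]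
      ring

/-- `maxGraph M` is the graph of an operator. -/
theorem maxGraph_functional (M : Medium d) (z : EnergySpace M × EnergySpace M)
    (hz : z ∈ maxGraph M) (h0 : z.1 = 0) : z.2 = 0 := by
  obtain ⟨G, D, h1, h2, h3, h4⟩ := hz
  rw [h0, map_zero] at h1 h2
  rw [h1.eq_zero M.isOpen_dom] at h3
  rw [h2.eq_zero M.isOpen_dom] at h4
  refine Prod.ext (Lp.ext ?_) (Lp.ext ?_)
  · refine h3.trans ?_
    change _ =ᵐ[volume.restrict M.dom] (0 : L2Vec M.dom)
    filter_upwards [Lp.coeFn_zero (EuclideanSpace ℂ (Fin d)) 2 (volume.restrict M.dom)] with x hx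
    rw [hx]
    simp [matAct_zero]
  · refine h4.trans ?_
    change _ =ᵐ[volume.restrict M.dom] (0 : L2 M.dom)
    filter_upwards [Lp.coeFn_zero ℂ 2 (volume.restrict M.dom)] with x hx
    rw [hx]
    simp

/-- The acoustic operator `𝒜* : {v, p} ↦ (1/i) {α⁻¹ ∇p, β⁻¹ ∇·v}` in the energy space, with its
maximal domain `H(div, O) × H¹(O)`. -/
def maxOperator (M : Medium d) : EnergySpace M →ₗ.[ℂ] EnergySpace M := (maxGraph M).toLinearPMap

/-- The pairs `{v, p} ∈ H(div, O) × H¹(O)` satisfying the boundary condition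
`(K + I) V⁻¹ γ₀(p) + (K - I) V^♮ γₙ(v) = 0`. -/
def boundaryCondition (M : Medium d) (V : L2Bdry M.dom ≃L[ℂ] HHalf M.dom)
    (K : L2Bdry M.dom →L[ℂ] L2Bdry M.dom) : Submodule ℂ (EnergySpace M) where
  carrier := {Ψ | ∃ (g : HHalf M.dom) (h : HMinusHalf M.dom),
    IsTrace M.dom (pre Ψ) (HHalf.fn g) ∧ IsNormalTrace M.dom (vel Ψ) h ∧
    (K + 1) (V.symm g) + (K - 1) (natAdjoint (V : L2Bdry M.dom →L[ℂ] HHalf M.dom) h) = 0}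
  zero_mem' := by
    refine ⟨0, 0, ?_, ?_, ?_⟩
    · rw [map_zero]
      exact IsTrace.zero M.dom
    · rw [map_zero]
      exact IsNormalTrace.zero M.dom
    · rw [natAdjoint_zero, map_zero, map_zero, map_zero, add_zero]
  add_mem' := by
    rintro Φ Ψ ⟨g, h, h1, h2, h3⟩ ⟨g', h', k1, k2, k3⟩
    refine ⟨g + g', h + h', ?_, ?_, ?_⟩
    · rw [map_add]
      exact h1.add k1
    · rw [map_add]
      exact h2.add k2
    · rw [natAdjoint_add, map_add, map_add, map_add, add_add_add_comm, h3, k3, add_zero]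
  smul_mem' := by
    rintro c Φ ⟨g, h, h1, h2, h3⟩
    refine ⟨c • g, c • h, ?_, ?_, ?_⟩
    · rw [map_smul]
      exact h1.smul c
    · rw [map_smul]
      exact h2.smul c
    · rw [natAdjoint_smul, map_smul, map_smul, map_smul, ← smul_add, h3, smul_zero]

/-- The acoustic operator associated with the boundary condition
`(K + I) V⁻¹ γ₀(p) + (K - I) V^♮ γₙ(v) = 0` : the restriction of `𝒜*` to the elements of its domain
that satisfy this condition. -/
def acousticOperator (M : Medium d) (V : L2Bdry M.dom ≃L[ℂ] HHalf M.dom)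
    (K : L2Bdry M.dom →L[ℂ] L2Bdry M.dom) : EnergySpace M →ₗ.[ℂ] EnergySpace M :=
  (maxOperator M).domRestrict (boundaryCondition M V K)

/-! ## m-dissipative and random operators -/

section Operators

variable {X : Type*} [NormedAddCommGroup X] [InnerProductSpace ℂ X]

/-- `z` is in the resolvent set of `T` and `R = (T - z)⁻¹`. -/
def IsResolvent (T : X →ₗ.[ℂ] X) (z : ℂ) (R : X →L[ℂ] X) : Prop :=
  (∀ x : T.domain, R (T x - z • (x : X)) = x) ∧
    ∀ f : X, ∃ hf : R f ∈ T.domain, T ⟨R f, hf⟩ - z • R f = f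

/-- m-dissipative operators: `ℂ₊ ⊆ ρ(T)` and `‖(T - z)⁻¹‖ ≤ 1 / Im z` for `z ∈ ℂ₊`. -/
def IsMDissipative (T : X →ₗ.[ℂ] X) : Prop :=
  ∀ z : ℂ, 0 < z.im → ∃ R : X →L[ℂ] X, IsResolvent T z R ∧ ‖R‖ ≤ (z.im)⁻¹

variable {Ω : Type*} [MeasurableSpace Ω]

/-- Random bounded operators: `ω ↦ (T_ω f | g)` is a random variable for all `f, g`. -/
def IsRandomBounded (T : Ω → X →L[ℂ] X) : Prop :=
  ∀ f g : X, Measurable fun ω => inner ℂ g (T ω f)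

/-- Random contractions. -/
def IsRandomContraction (P : Measure Ω) (T : Ω → X →L[ℂ] X) : Prop :=
  IsRandomBounded T ∧ ∀ᵐ ω ∂P, ‖T ω‖ ≤ 1

/-- `ω ↦ (T_ω - z)⁻¹` (defined on an event of probability one) is a random bounded operator. -/
def HasRandomResolvent (P : Measure Ω) (T : Ω → X →ₗ.[ℂ] X) (z : ℂ) : Prop :=
  ∃ R : Ω → X →L[ℂ] X, IsRandomBounded R ∧ ∀ᵐ ω ∂P, IsResolvent (T ω) z (R ω)

/-- Random-m-dissipative operators. -/
def IsRandomMDissipative (P : Measure Ω) (T : Ω → X →ₗ.[ℂ] X) : Prop :=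
  (∀ᵐ ω ∂P, IsMDissipative (T ω)) ∧ ∀ z : ℂ, 0 < z.im → HasRandomResolvent P T z

/-- Random-selfadjoint operators. -/
def IsRandomSelfAdjoint [CompleteSpace X] (P : Measure Ω) (T : Ω → X →ₗ.[ℂ] X) : Prop :=
  (∀ᵐ ω ∂P, IsSelfAdjoint (T ω)) ∧ ∀ z : ℂ, z.im ≠ 0 → HasRandomResolvent P T z

end Operators

end Acoustic

end

/-! Put a = V⁻¹γ₀p and b = V^♮γₙv. Green's formula for `𝒜*` becomes (a₁, b₂) + (b₁, a₂) = i(⟨Ψ₁,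
𝒜*Ψ₂⟩ - ⟨𝒜*Ψ₁, Ψ₂⟩), and the boundary condition becomes K(a + b) = b - a: the operator K sends one
wave amplitude at the boundary to the other. As ‖a + b‖² - ‖b - a‖² = 4 Re (a, b) = -4 Im ⟨Ψ, 𝒜*Ψ⟩,
contractivity of K is exactly a sign condition on the energy flux. It yields ‖Ψ‖ ≤ (Im z)⁻¹ ‖(𝒜* -
z)Ψ‖ on the domain, hence injectivity and the resolvent bound.

Solvability has to be obtained measurably in ω. First prescribe c = b - a: the problem (𝒜* - z)Ψ = f
is then coercive and deterministic, and Lax-Milgram solves it (`acousticRelation_solvable`). The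
other amplitude is a + b = Mc + lf, and the energy identity together with the bound of a, b by the
graph norm gives ‖M‖ < 1 (`BoundarySystem.exists_norm_lt_one`). The condition K(Mc + lf) = c is
solved by a Neumann series in KM, whose terms are measurable on each vector
(`BoundarySystem.exists_random_solution`).

If K is unitary, Green's formula makes the restriction symmetric. Reversing the velocity turns `𝒜*`
into `-𝒜*` and b into -b, so the lower half plane for K is the upper half plane for K⁻¹ = K*
(`BoundarySystem.reflect`). Both half planes being covered, the operator is selfadjoint.

The bound on a needs the trace theorem H¹ → H^{1/2} (`traceBounded`), the bound on b a bounded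
lifting H^{1/2} → H¹ (`traceLifting`). Both are proved on the Lipschitz boundary without flattening
it. The trace estimate compares values at boundary points with values in interior cones and uses a
Hardy-type inequality along the rays. The lifting averages the boundary function against the kernels
(|x - y|² + ε²)^{-d}, which gives smooth functions bounded in H¹, and takes a weak limit. -/

noncomputable section

namespace Acoustic

/-! ## Abstract boundary systems and their random restrictions -/

section Abstract

variable {X B : Type*} [NormedAddCommGroup X] [InnerProductSpace ℂ X]
  [NormedAddCommGroup B] [InnerProductSpace ℂ B]

/-- An abstract boundary system: `Gr Ψ Θ a b` says that `Θ` is the value at `Ψ` of a maximal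
operator, and that `a`, `b` are the boundary data of `Ψ`. -/
structure BoundarySystem (Gr : X → X → B → B → Prop) (J : X →L[ℂ] X) : Prop where
  green : ∀ {Ψ₁ Θ₁ a₁ b₁ Ψ₂ Θ₂ a₂ b₂}, Gr Ψ₁ Θ₁ a₁ b₁ → Gr Ψ₂ Θ₂ a₂ b₂ →
    inner ℂ a₁ b₂ + inner ℂ b₁ a₂ = Complex.I * (inner ℂ Ψ₁ Θ₂ - inner ℂ Θ₁ Ψ₂)
  solvable : ∀ z : ℂ, 0 < z.im → ∃ (S : B × X →L[ℂ] X) (A : B × X →L[ℂ] B),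
    ∀ c f, Gr (S (c, f)) (f + z • S (c, f)) (A (c, f)) (A (c, f) + c)
  bound : ∃ C : ℝ, ∀ {Ψ Θ a b}, Gr Ψ Θ a b → ‖a‖ + ‖b‖ ≤ C * (‖Ψ‖ + ‖Θ‖)
  flip : ∀ {Ψ Θ a b}, Gr Ψ Θ a b → Gr (J Ψ) (-J Θ) a (-b)
  flip_flip : ∀ Ψ, J (J Ψ) = Ψ

/-- `T` is the restriction of the maximal operator by the condition `K (a + b) = b - a`. -/
def IsRestriction (Gr : X → X → B → B → Prop) (K : B →L[ℂ] B) (T : X →ₗ.[ℂ] X) : Prop :=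
  ∀ Ψ Θ, (∃ h : Ψ ∈ T.domain, T ⟨Ψ, h⟩ = Θ) ↔ ∃ a b, Gr Ψ Θ a b ∧ K (a + b) = b - a

variable {Gr : X → X → B → B → Prop} {J : X →L[ℂ] X}

/-- Polarization: it turns the flux Re (a, b) into a comparison of the two amplitudes that K
relates. -/
theorem norm_add_sq_sub_norm_sub_sq (a b : B) :
    ‖a + b‖ ^ 2 - ‖b - a‖ ^ 2 = 4 * (inner ℂ a b).re := by
  have h1 := norm_add_sq (𝕜 := ℂ) a b
  have h2 := norm_sub_sq (𝕜 := ℂ) b a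
  rw [inner_re_symm (𝕜 := ℂ) b a] at h2
  simp only [RCLike.re_to_complex] at h1 h2
  linarith

/-- The energy balance: Green's formula on the diagonal. -/
theorem BoundarySystem.re_inner (h : BoundarySystem Gr J) {Ψ Θ : X} {a b : B}
    (hG : Gr Ψ Θ a b) : (inner ℂ a b).re = - (inner ℂ Ψ Θ).im := by
  have := congrArg Complex.re (h.green hG hG)
  rw [← inner_conj_symm b a, ← inner_conj_symm Θ Ψ] at this
  simp only [Complex.add_re, Complex.conj_re, Complex.I_mul_re, Complex.sub_im,
    Complex.conj_im] at this
  linarith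

theorem BoundarySystem.im_inner_nonpos (h : BoundarySystem Gr J) {Ψ Θ : X} {a b : B}
    (hG : Gr Ψ Θ a b) {K : B →L[ℂ] B} (hK : ‖K‖ ≤ 1) (hab : K (a + b) = b - a) :
    (inner ℂ Ψ Θ).im ≤ 0 := by
  have h1 := h.re_inner hG
  have h2 := norm_add_sq_sub_norm_sub_sq a b
  have h3 : ‖b - a‖ ≤ ‖a + b‖ := by
    rw [← hab]
    exact (K.le_opNorm _).trans (mul_le_of_le_one_left (norm_nonneg _) hK)
  have h4 := pow_le_pow_left₀ (norm_nonneg _) h3 2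
  linarith

/-- Im ⟨Ψ, Θ - zΨ⟩ ≤ -(Im z)‖Ψ‖², while Cauchy-Schwarz bounds the left side from below by -‖Ψ‖ ‖Θ -
zΨ‖. -/
theorem norm_le_of_im_inner_nonpos {z : ℂ} (hz : 0 < z.im) {Ψ Θ : X}
    (h : (inner ℂ Ψ Θ).im ≤ 0) : ‖Ψ‖ ≤ (z.im)⁻¹ * ‖Θ - z • Ψ‖ := by
  rcases eq_or_ne Ψ 0 with rfl | h0
  · simp only [norm_zero]; positivity
  have h1 : (inner ℂ Ψ (Θ - z • Ψ)).im = (inner ℂ Ψ Θ).im - z.im * ‖Ψ‖ ^ 2 := by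
    rw [inner_sub_right, inner_smul_right, inner_self_eq_norm_sq_to_K, Complex.sub_im]
    change _ - (z * ((‖Ψ‖ : ℂ) ^ 2)).im = _
    rw [← Complex.ofReal_pow, Complex.im_mul_ofReal]
  have h2 : |(inner ℂ Ψ (Θ - z • Ψ)).im| ≤ ‖Ψ‖ * ‖Θ - z • Ψ‖ :=
    (Complex.abs_im_le_norm _).trans (norm_inner_le_norm _ _)
  have h3 := neg_le_of_abs_le h2
  have h4 : 0 < ‖Ψ‖ := norm_pos_iff.2 h0
  rw [inv_mul_eq_div, le_div_iff₀ hz]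
  have : z.im * ‖Ψ‖ * ‖Ψ‖ ≤ ‖Θ - z • Ψ‖ * ‖Ψ‖ := by nlinarith
  nlinarith [le_of_mul_le_mul_right this h4]

/-- For f = 0 the energy balance reads ‖2a + c‖² = ‖c‖² - 4 (Im z)‖Ψ‖². The loss is a fixed fraction
of ‖c‖², because c = b - a is controlled by the graph norm, which here is at most (1 + |z|)‖Ψ‖.
Strictness is what makes the Neumann series converge even when ‖K‖ = 1. -/
theorem BoundarySystem.exists_norm_lt_one (h : BoundarySystem Gr J) {z : ℂ} (hz : 0 < z.im)
    {S : B × X →L[ℂ] X} {A : B × X →L[ℂ] B}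
    (hS : ∀ c f, Gr (S (c, f)) (f + z • S (c, f)) (A (c, f)) (A (c, f) + c)) :
    ∃ q : ℝ, 0 ≤ q ∧ q < 1 ∧ ∀ c, ‖(2 : ℂ) • A (c, 0) + c‖ ≤ q * ‖c‖ := by
  obtain ⟨C₀, hC₀⟩ := h.bound
  set C := max C₀ 1 with hCdef
  have hC : 0 < C := lt_max_of_lt_right one_pos
  set t : ℝ := 4 * z.im / (C * (1 + ‖z‖)) ^ 2 with ht
  have htp : 0 < t := by positivity
  refine ⟨√(1 - t), Real.sqrt_nonneg _, ?_, fun c => ?_⟩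
  · rw [Real.sqrt_lt' one_pos]; linarith
  have hG := hS c 0
  rw [zero_add] at hG
  set Ψ := S (c, 0)
  set a := A (c, 0)
  have h1 := h.re_inner hG
  have h2 := norm_add_sq_sub_norm_sub_sq a (a + c)
  rw [h1, add_sub_cancel_left, inner_smul_right, inner_self_eq_norm_sq_to_K] at h2
  have h3 : ‖c‖ ≤ C * (1 + ‖z‖) * ‖Ψ‖ := by
    calc ‖c‖ = ‖(a + c) - a‖ := by simp
      _ ≤ ‖a‖ + ‖a + c‖ := by rw [add_comm ‖a‖]; exact norm_sub_le _ _
      _ ≤ C₀ * (‖Ψ‖ + ‖z • Ψ‖) := hC₀ hG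
      _ ≤ C * (‖Ψ‖ + ‖z • Ψ‖) := mul_le_mul_of_nonneg_right (le_max_left _ _) (by positivity)
      _ = _ := by rw [norm_smul]; ring
  have h4 : t * ‖c‖ ^ 2 ≤ 4 * (z.im * ‖Ψ‖ ^ 2) := by
    have := pow_le_pow_left₀ (norm_nonneg _) h3 2
    rw [ht, div_mul_eq_mul_div, div_le_iff₀ (by positivity)]
    rw [mul_pow] at this
    nlinarith [mul_le_mul_of_nonneg_left this hz.le]
  have h5 : ((z * ((‖Ψ‖ : ℂ) ^ 2))).im = z.im * ‖Ψ‖ ^ 2 := by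
    rw [← Complex.ofReal_pow, Complex.im_mul_ofReal]
  have h6 : a + (a + c) = (2 : ℂ) • a + c := by rw [two_smul, add_assoc]
  change _ = 4 * -(z * ((‖Ψ‖ : ℂ) ^ 2)).im at h2
  rw [h5, h6] at h2
  refine abs_le_of_sq_le_sq' ?_ (by positivity) |>.2
  rw [mul_pow]
  -- Nothing excludes t > 1 beforehand. The real square root is then 0, and the estimate forces the
  -- left side to vanish.
  rcases le_total 0 (1 - t) with h7 | h7
  · rw [Real.sq_sqrt h7]; linarith
  · have : 0 ≤ √(1 - t) ^ 2 * ‖c‖ ^ 2 := by positivity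
    nlinarith [sq_nonneg ‖c‖]

variable {Ω : Type*} [MeasurableSpace Ω]

/-- Pettis' theorem for a separable Hilbert space. Distinct vectors of an orthonormal basis have
distance √2, so balls of radius 1/2 around them are disjoint and the basis is countable; the
expansion of u is then a limit of measurable finite sums. -/
theorem measurable_of_measurable_inner [CompleteSpace B] [SecondCountableTopology B]
    [MeasurableSpace B] [BorelSpace B]
    {u : Ω → B} (hu : ∀ g, Measurable fun ω => inner ℂ g (u ω)) : Measurable u := by
  obtain ⟨w, b, hb⟩ := exists_hilbertBasis ℂ B
  have : Countable w := by
    refine Pairwise.countable_of_isOpen_disjoint (s := fun i : w => Metric.ball (b i) (1 / 2))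
      (fun i j hij => ?_) (fun i => Metric.isOpen_ball) (fun i => ⟨b i, by simp⟩)
    refine Metric.ball_disjoint_ball ?_
    have h1 := norm_sub_sq (𝕜 := ℂ) (b i) (b j)
    rw [b.orthonormal.2 hij, b.orthonormal.1, b.orthonormal.1] at h1
    rw [dist_eq_norm]
    refine (abs_le_of_sq_le_sq' ?_ (norm_nonneg _)).2
    rw [h1]; norm_num
  refine measurable_of_tendsto_metrizable' (atTop : Filter (Finset w))
    (f := fun s ω => ∑ i ∈ s, inner ℂ (b i) (u ω) • b i) (fun s => ?_) ?_
  · refine Finset.measurable_sum s fun i _ => (hu _).smul_const _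
  · refine tendsto_pi_nhds.2 fun ω => ?_
    have := b.hasSum_repr (u ω)
    simp only [b.repr_apply_apply] at this
    exact this

/-- (x, ω) ↦ K ω x is a Carathéodory function, continuous in x and measurable in ω, hence jointly
measurable. This allows random operators to be composed. -/
theorem measurable_apply_of_isRandomBounded [CompleteSpace B] [SecondCountableTopology B]
    [MeasurableSpace B] [BorelSpace B] {K : Ω → B →L[ℂ] B} (hK : IsRandomBounded K)
    {u : Ω → B} (hu : Measurable u) : Measurable fun ω => K ω (u ω) := by
  have h := measurable_uncurry_of_continuous_of_measurable (u := fun (x : B) (ω : Ω) => K ω x)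
    (fun ω => (K ω).continuous) (fun x => measurable_of_measurable_inner fun g => hK x g)
  exact h.comp (hu.prodMk measurable_id)

/-- The core of the argument: with c = b - a as unknown, the random boundary condition is a linear
fixed point equation on the boundary space alone, and ω enters only through K. -/
theorem BoundarySystem.exists_random_solution [CompleteSpace B] [SecondCountableTopology B]
    (h : BoundarySystem Gr J) {z : ℂ} (hz : 0 < z.im) {K : Ω → B →L[ℂ] B}
    (hK : IsRandomBounded K) (hK1 : ∀ ω, ‖K ω‖ ≤ 1) :
    ∃ R : Ω → X →L[ℂ] X, IsRandomBounded R ∧ ∀ ω f, ∃ a b,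
      Gr (R ω f) (f + z • R ω f) a b ∧ K ω (a + b) = b - a := by
  borelize B
  obtain ⟨S, A, hS⟩ := h.solvable z hz
  obtain ⟨q, hq0, hq1, hq⟩ := h.exists_norm_lt_one hz hS
  -- Since b = a + c, the sum a + b = 2A(c, f) + c equals Mc + lf.
  let M : B →L[ℂ] B := (2 : ℂ) • A.comp (ContinuousLinearMap.inl ℂ B X) + 1
  let l : X →L[ℂ] B := (2 : ℂ) • A.comp (ContinuousLinearMap.inr ℂ B X)
  have hM : ‖M‖ ≤ q := M.opNorm_le_bound hq0 hq
  have hKM : ∀ ω, ‖K ω * M‖ < 1 := fun ω =>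
    ((norm_mul_le _ _).trans (mul_le_of_le_one_left (norm_nonneg _) (hK1 ω))).trans_lt
      (hM.trans_lt hq1)
  -- c = (1 - KM)⁻¹ K l f.
  let c : Ω → X →L[ℂ] B := fun ω => (∑' n : ℕ, (K ω * M) ^ n).comp ((K ω).comp l)
  have hsum : ∀ ω, Summable fun n : ℕ => (K ω * M) ^ n := fun ω =>
    summable_geometric_of_norm_lt_one (hKM ω)
  have hc : ∀ ω f, K ω (M (c ω f) + l f) = c ω f := fun ω f => by
    have h1 : (1 - K ω * M) * ∑' n : ℕ, (K ω * M) ^ n = 1 :=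
      (hsum ω).one_sub_mul_tsum_pow
    have h2 := congrArg (fun T : B →L[ℂ] B => T (K ω (l f))) h1
    simp only [sub_mul, one_mul] at h2
    change c ω f - K ω (M (c ω f)) = K ω (l f) at h2
    rw [map_add, ← h2]; abel
  have hcm : ∀ f, Measurable fun ω => c ω f := fun f => by
    -- Measurability is only available after evaluation on vectors, so the powers are applied one
    -- factor at a time.
    have hpow : ∀ n : ℕ, Measurable fun ω => ((K ω * M) ^ n) (K ω (l f)) := fun n => by
      induction n with
      | zero => exact measurable_apply_of_isRandomBounded hK measurable_const
      | succ n ih =>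
        simp_rw [pow_succ', mul_apply_eq_comp]
        exact measurable_apply_of_isRandomBounded hK (M.continuous.measurable.comp ih)
    refine measurable_of_tendsto_metrizable (f := fun N ω =>
      ∑ n ∈ Finset.range N, ((K ω * M) ^ n) (K ω (l f)))
      (fun N => Finset.measurable_sum _ fun n _ => hpow n) (tendsto_pi_nhds.2 fun ω => ?_)
    have h1 := (hsum ω).hasSum.tendsto_sum_nat
    have h2 := ((ContinuousLinearMap.apply ℂ B (K ω (l f))).continuous.tendsto _).comp h1
    refine h2.congr fun N => ?_
    simp
  refine ⟨fun ω => S.comp ((c ω).prod (ContinuousLinearMap.id ℂ X)), fun f g => ?_,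
    fun ω f => ?_⟩
  · have : Measurable fun ω => inner ℂ g (S.comp (ContinuousLinearMap.inl ℂ B X) (c ω f)) :=
      (((innerSL ℂ g).comp (S.comp (ContinuousLinearMap.inl ℂ B X))).continuous.measurable).comp
        (hcm f)
    convert! this.add_const (inner ℂ g (S (0, f))) using 2 with ω
    rw [← inner_add_right]
    simp [← map_add]
  · refine ⟨A (c ω f, f), A (c ω f, f) + c ω f, hS (c ω f) f, ?_⟩
    rw [add_sub_cancel_left]
    conv_rhs => rw [← hc]
    congr 1
    have : A (c ω f, f) = A (c ω f, 0) + A (0, f) := by rw [← map_add]; simp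
    simp only [this, M, l]
    simp [two_smul]
    abel

theorem isResolvent_of_solution {T : X →ₗ.[ℂ] X} {z : ℂ} {R : X →L[ℂ] X} {C : ℝ}
    (hT : ∀ x : T.domain, ‖(x : X)‖ ≤ C * ‖T x - z • (x : X)‖)
    (hR : ∀ f, ∃ h : R f ∈ T.domain, T ⟨R f, h⟩ = f + z • R f) : IsResolvent T z R := by
  have h2 : ∀ f : X, ∃ hf : R f ∈ T.domain, T ⟨R f, hf⟩ - z • R f = f := fun f => by
    obtain ⟨h, e⟩ := hR f
    exact ⟨h, by rw [e]; abel⟩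
  refine ⟨fun x => ?_, h2⟩
  obtain ⟨h, e⟩ := h2 (T x - z • (x : X))
  generalize R (T x - z • (x : X)) = y at h e ⊢
  have h3 := hT (⟨y, h⟩ - x)
  have h4 : T (⟨y, h⟩ - x) - z • (((⟨y, h⟩ - x : T.domain)) : X) = 0 := by
    rw [LinearPMap.map_sub, Submodule.coe_sub, smul_sub, sub_sub_sub_comm, e, sub_self]
  rw [h4, norm_zero, mul_zero] at h3
  have := norm_le_zero_iff.1 h3
  rwa [Submodule.coe_sub, sub_eq_zero] at this

theorem IsRestriction.norm_le (h : BoundarySystem Gr J) {K : B →L[ℂ] B} (hK : ‖K‖ ≤ 1)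
    {T : X →ₗ.[ℂ] X} (hT : IsRestriction Gr K T) {z : ℂ} (hz : 0 < z.im) (x : T.domain) :
    ‖(x : X)‖ ≤ (z.im)⁻¹ * ‖T x - z • (x : X)‖ := by
  obtain ⟨a, b, hG, hab⟩ := (hT x (T x)).1 ⟨x.2, rfl⟩
  exact norm_le_of_im_inner_nonpos hz (h.im_inner_nonpos hG hK hab)

theorem IsRestriction.hasRandomResolvent [CompleteSpace B] [SecondCountableTopology B]
    (h : BoundarySystem Gr J) (P : Measure Ω) {K K' : Ω → B →L[ℂ] B} (hK : IsRandomBounded K')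
    (hK1 : ∀ ω, ‖K' ω‖ ≤ 1) (hKK : ∀ᵐ ω ∂P, K' ω = K ω)
    {T : Ω → X →ₗ.[ℂ] X} (hT : ∀ ω, IsRestriction Gr (K ω) (T ω)) {z : ℂ} (hz : 0 < z.im) :
    HasRandomResolvent P T z := by
  obtain ⟨R, hR, hR2⟩ := h.exists_random_solution hz hK hK1
  refine ⟨R, hR, ?_⟩
  filter_upwards [hKK] with ω hω
  have hb := hK1 ω
  have hs := hR2 ω
  rw [hω] at hb hs
  exact isResolvent_of_solution ((hT ω).norm_le h hb hz) fun f => (hT ω _ _).2 (hs f)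

theorem IsRestriction.isMDissipative [CompleteSpace B] [SecondCountableTopology B]
    (h : BoundarySystem Gr J) {K : B →L[ℂ] B} (hK : ‖K‖ ≤ 1)
    {T : X →ₗ.[ℂ] X} (hT : IsRestriction Gr K T) : IsMDissipative T := fun z hz => by
  -- A deterministic K is a random one over a one-point space.
  obtain ⟨R, -, hR⟩ := h.exists_random_solution (Ω := Unit) hz (K := fun _ => K)
    (fun f g => measurable_const) (fun _ => hK)
  have hs : ∀ f, ∃ h : R () f ∈ T.domain, T ⟨R () f, h⟩ = f + z • R () f :=
    fun f => (hT _ _).2 (hR () f)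
  have hb := hT.norm_le h hK hz
  refine ⟨R (), isResolvent_of_solution hb hs,
    (R ()).opNorm_le_bound (by positivity) fun f => ?_⟩
  obtain ⟨h1, h2⟩ := hs f
  have := hb ⟨_, h1⟩
  rwa [h2, add_sub_cancel_right] at this

/-- The reflected solution operator, for the lower half plane. -/
theorem BoundarySystem.reflect (h : BoundarySystem Gr J) {z : ℂ} {K K' : B →L[ℂ] B}
    (hKK : ∀ y, K (K' y) = y) {R : X →L[ℂ] X}
    (hR : ∀ f, ∃ a b, Gr (R f) (f + (-z) • R f) a b ∧ K' (a + b) = b - a) (f : X) :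
    ∃ a b, Gr ((-(J.comp (R.comp J))) f) (f + z • (-(J.comp (R.comp J))) f) a b ∧
      K (a + b) = b - a := by
  -- With Ψ = R(-Jf) and Θ = -Jf - zΨ, the flipped value is -JΘ = f + zJΨ, so JΨ solves the problem
  -- at z. The condition K'(a + b) = b - a inverts to K(a - b) = -b - a.
  obtain ⟨a, b, hG, hab⟩ := hR (-(J f))
  refine ⟨a, -b, ?_, ?_⟩
  · convert! h.flip hG using 1
    · simp
    · simp [h.flip_flip, add_comm]
  · have := hKK (a + b)
    rw [hab] at this
    rw [← sub_eq_add_neg, ← neg_sub b a, map_neg, this]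
    abel

/-- The estimate of the upper half plane, applied to -z and -Θ. -/
theorem norm_le_of_im_inner_eq_zero {z : ℂ} (hz : z.im < 0) {Ψ Θ : X}
    (h : (inner ℂ Ψ Θ).im = 0) : ‖Ψ‖ ≤ (-z.im)⁻¹ * ‖Θ - z • Ψ‖ := by
  have h1 := norm_le_of_im_inner_nonpos (z := -z) (by simpa using hz) (Ψ := Ψ) (Θ := -Θ)
    (by simp [h])
  rwa [neg_smul, ← neg_sub', norm_neg, Complex.neg_im] at h1

/-- An isometry K gives (b₁ - a₁, b₂ - a₂) = (a₁ + b₁, a₂ + b₂). Expanding leaves (a₁, b₂) + (b₁,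
a₂) = 0, which is the boundary term of Green's formula. -/
theorem BoundarySystem.formally_symmetric (h : BoundarySystem Gr J) {K : B →L[ℂ] B}
    (hK : ∀ x y, inner ℂ (K x) (K y) = inner ℂ x y) {Ψ₁ Θ₁ a₁ b₁ Ψ₂ Θ₂ a₂ b₂}
    (h₁ : Gr Ψ₁ Θ₁ a₁ b₁) (h₂ : Gr Ψ₂ Θ₂ a₂ b₂)
    (e₁ : K (a₁ + b₁) = b₁ - a₁) (e₂ : K (a₂ + b₂) = b₂ - a₂) :
    inner ℂ Ψ₁ Θ₂ = inner ℂ Θ₁ Ψ₂ := by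
  have h3 := h.green h₁ h₂
  have h4 := hK (a₁ + b₁) (a₂ + b₂)
  rw [e₁, e₂] at h4
  simp only [inner_add_left, inner_add_right, inner_sub_left, inner_sub_right] at h4
  have h5 : inner ℂ a₁ b₂ + inner ℂ b₁ a₂ = 0 := by linear_combination (-1 / 2 : ℂ) * h4
  rw [h5] at h3
  have := (mul_eq_zero.1 h3.symm).resolve_left Complex.I_ne_zero
  exact sub_eq_zero.1 this

/-- The classical range criterion. Density of the domain is not assumed: it follows from symmetry
and the two surjectivities. -/
theorem isSelfAdjoint_of_resolvents [CompleteSpace X] {T : X →ₗ.[ℂ] X}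
    (hs : ∀ x y : T.domain, inner ℂ (x : X) (T y) = inner ℂ (T x) (y : X))
    (h1 : ∀ f : X, ∃ x : T.domain, T x - Complex.I • (x : X) = f)
    (h2 : ∀ f : X, ∃ x : T.domain, T x + Complex.I • (x : X) = f) : IsSelfAdjoint T := by
  have hd : Dense (T.domain : Set X) := by
    rw [Submodule.dense_iff_topologicalClosure_eq_top,
      Submodule.topologicalClosure_eq_top_iff, Submodule.eq_bot_iff]
    intro y hy
    -- Write y = (T - i)x and x = (T + i)u. By symmetry ⟨x, x⟩ = ⟨(T - i)x, u⟩ = ⟨y, u⟩ = 0.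
    obtain ⟨x, rfl⟩ := h1 y
    obtain ⟨u, hu⟩ := h2 (x : X)
    have h3 := (Submodule.mem_orthogonal' _ _).1 hy u u.2
    have h4 : inner ℂ (x : X) (x : X) = (0 : ℂ) := by
      rw [← h3]
      nth_rw 2 [← hu]
      rw [inner_add_right, hs, inner_smul_right, inner_sub_left, inner_smul_left]
      simp
    have h5 : x = 0 := by
      ext; exact inner_self_eq_zero.1 h4
    rw [h5]; simp
  rw [LinearPMap.isSelfAdjoint_def]
  have hle : T ≤ T.adjoint :=
    LinearPMap.IsFormalAdjoint.le_adjoint hd fun x y => (hs x y).symm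
  refine (LinearPMap.eq_of_le_of_domain_eq hle (le_antisymm hle.1 fun y hy => ?_)).symm
  -- If (T - i)x = (T* - i)y, then y - x is orthogonal to the range of T + i, which is everything;
  -- hence y = x lies in the domain of T.
  obtain ⟨x, hx⟩ := h1 (T.adjoint ⟨y, hy⟩ - Complex.I • y)
  suffices y = x by rw [this]; exact x.2
  rw [← sub_eq_zero]
  obtain ⟨u, hu⟩ := h2 (y - x)
  have h3 := T.adjoint_isFormalAdjoint hd ⟨y, hy⟩ u
  have h4 := hs x u
  refine inner_self_eq_zero (𝕜 := ℂ).1 ?_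
  nth_rw 2 [← hu]
  rw [inner_add_right, inner_sub_left, inner_smul_right, inner_sub_left]
  change inner ℂ _ _ = inner ℂ y _ at h3
  rw [← h3, h4]
  have h5 := congrArg (fun f => inner ℂ f (u : X)) hx
  simp only [inner_sub_left, inner_smul_left, Complex.conj_I] at h5
  linear_combination -h5

theorem inner_map_map_of_mem_unitary [CompleteSpace B] {K : B →L[ℂ] B}
    (hK : K ∈ unitary (B →L[ℂ] B)) (x y : B) : inner ℂ (K x) (K y) = inner ℂ x y := by
  have h1 := (Unitary.mem_iff.1 hK).1
  rw [← ContinuousLinearMap.adjoint_inner_right, ← ContinuousLinearMap.star_eq_adjoint]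
  change inner ℂ x ((star K * K) y) = _
  rw [h1]; rfl

theorem IsRestriction.norm_le_of_unitary [CompleteSpace B] (h : BoundarySystem Gr J)
    {K : B →L[ℂ] B} (hK : K ∈ unitary (B →L[ℂ] B))
    {T : X →ₗ.[ℂ] X} (hT : IsRestriction Gr K T) {z : ℂ} (hz : z.im < 0) (x : T.domain) :
    ‖(x : X)‖ ≤ (-z.im)⁻¹ * ‖T x - z • (x : X)‖ := by
  obtain ⟨a, b, hG, hab⟩ := (hT x (T x)).1 ⟨x.2, rfl⟩
  refine norm_le_of_im_inner_eq_zero hz ?_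
  have := h.formally_symmetric (inner_map_map_of_mem_unitary hK) hG hG hab hab
  rw [← inner_conj_symm] at this
  exact Complex.conj_eq_iff_im.1 (by rw [inner_conj_symm]; simpa using this.symm)

theorem IsRestriction.isSelfAdjoint_of_unitary [CompleteSpace X] [CompleteSpace B] [SecondCountableTopology B]
    (h : BoundarySystem Gr J) {K : B →L[ℂ] B} (hK : K ∈ unitary (B →L[ℂ] B)) (hK1 : ‖K‖ ≤ 1)
    {T : X →ₗ.[ℂ] X} (hT : IsRestriction Gr K T) : IsSelfAdjoint T := by
  have hsu : ‖star K‖ ≤ 1 := by rwa [norm_star]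
  refine isSelfAdjoint_of_resolvents (fun x y => ?_) (fun f => ?_) fun f => ?_
  · obtain ⟨a, b, hG, hab⟩ := (hT x (T x)).1 ⟨x.2, rfl⟩
    obtain ⟨a', b', hG', hab'⟩ := (hT y (T y)).1 ⟨y.2, rfl⟩
    exact h.formally_symmetric (inner_map_map_of_mem_unitary hK) hG hG' hab hab'
  · obtain ⟨R, ⟨-, hR⟩, -⟩ := hT.isMDissipative h hK1 Complex.I (by simp)
    obtain ⟨hf, e⟩ := hR f
    exact ⟨⟨_, hf⟩, e⟩
  -- Surjectivity of T + i is the problem at -i for K, the reflection of the problem at i for K*.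
  · obtain ⟨R, -, hR⟩ := h.exists_random_solution (Ω := Unit) (z := Complex.I) (by simp)
      (K := fun _ => star K) (fun f g => measurable_const) (fun _ => hsu)
    have h1 := h.reflect (z := -Complex.I) (K := K) (K' := star K) (fun y => by
      change (K * star K) y = y
      rw [(Unitary.mem_iff.1 hK).2]; rfl) (R := R ()) (by simpa using hR ()) f
    obtain ⟨hf, e⟩ := (hT _ _).2 h1
    refine ⟨⟨_, hf⟩, ?_⟩
    rw [e]; simp

theorem IsRestriction.hasRandomResolvent_of_unitary [CompleteSpace B] [SecondCountableTopology B]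
    [CompleteSpace X] (h : BoundarySystem Gr J) (P : Measure Ω) {K K' : Ω → B →L[ℂ] B}
    (hK : IsRandomBounded K') (hK1 : ∀ ω, ‖K' ω‖ ≤ 1) (hKK : ∀ᵐ ω ∂P, K' ω = K ω)
    (hu : ∀ᵐ ω ∂P, K ω ∈ unitary (B →L[ℂ] B))
    {T : Ω → X →ₗ.[ℂ] X} (hT : ∀ ω, IsRestriction Gr (K ω) (T ω)) {z : ℂ} (hz : z.im < 0) :
    HasRandomResolvent P T z := by
  have hsm : IsRandomBounded fun ω => star (K' ω) := fun f g => by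
    simp_rw [ContinuousLinearMap.star_eq_adjoint, ContinuousLinearMap.adjoint_inner_right,
      ← inner_conj_symm _ f]
    exact (Complex.continuous_conj.measurable).comp (hK g f)
  obtain ⟨R, hR, hR2⟩ := h.exists_random_solution (z := -z) (by simpa using hz) hsm
    (fun ω => by rw [norm_star]; exact hK1 ω)
  refine ⟨fun ω => -(J.comp ((R ω).comp J)), fun f g => ?_, ?_⟩
  · have := hR (J f) (-(ContinuousLinearMap.adjoint J g))
    convert! this using 2 with ω
    rw [inner_neg_left, ContinuousLinearMap.adjoint_inner_left]
    simp
  · filter_upwards [hKK, hu] with ω e1 e2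
    have hs := h.reflect (z := z) (K := K ω) (K' := star (K ω)) (fun y => by
      change (K ω * star (K ω)) y = y
      rw [(Unitary.mem_iff.1 e2).2]; rfl) (R := R ω) (by rw [← e1]; exact hR2 ω)
    exact isResolvent_of_solution ((hT ω).norm_le_of_unitary h e2 hz) fun f => (hT ω _ _).2 (hs f)

/-- The random restrictions of a boundary system: by contractions they are random-m-dissipative,
by unitary operators random-selfadjoint. -/
theorem BoundarySystem.main [CompleteSpace B] [SecondCountableTopology B] [CompleteSpace X]
    (h : BoundarySystem Gr J) (P : Measure Ω) [P.IsComplete] {K : Ω → B →L[ℂ] B}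
    (hK : IsRandomContraction P K) {T : Ω → X →ₗ.[ℂ] X}
    (hT : ∀ ω, IsRestriction Gr (K ω) (T ω)) :
    IsRandomMDissipative P T ∧
      ((∀ᵐ ω ∂P, K ω ∈ unitary (B →L[ℂ] B)) → IsRandomSelfAdjoint P T) := by
  classical
  obtain ⟨hKm, hK1⟩ := hK
  -- The complement is a null set, so completeness of the probability space gives measurability.
  have hmeas : MeasurableSet {ω | ‖K ω‖ ≤ 1} := by
    have : MeasurableSet {ω | ‖K ω‖ ≤ 1}ᶜ := Measure.IsComplete.out' _ hK1
    simpa using this.compl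
  -- The solution operators are built for every ω, so K is changed off the almost sure event into a
  -- contraction everywhere.
  let K' : Ω → B →L[ℂ] B := fun ω => if ‖K ω‖ ≤ 1 then K ω else 0
  have hK'm : IsRandomBounded K' := fun f g => by
    have : (fun ω => inner ℂ g (K' ω f)) = fun ω => if ‖K ω‖ ≤ 1 then inner ℂ g (K ω f) else 0 := by
      funext ω
      simp only [K']
      split_ifs <;> simp
    rw [this]
    exact Measurable.ite hmeas (hKm f g) measurable_const
  have hK'1 : ∀ ω, ‖K' ω‖ ≤ 1 := fun ω => by
    simp only [K']
    split_ifs with h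
    · exact h
    · simp
  have hKK : ∀ᵐ ω ∂P, K' ω = K ω := by
    filter_upwards [hK1] with ω hω
    simp [K', hω]
  refine ⟨⟨?_, fun z hz => IsRestriction.hasRandomResolvent h P hK'm hK'1 hKK hT hz⟩,
    fun hu => ⟨?_, fun z hz => ?_⟩⟩
  · filter_upwards [hK1] with ω hω using (hT ω).isMDissipative h hω
  · filter_upwards [hK1, hu] with ω h1 h2 using (hT ω).isSelfAdjoint_of_unitary h h2 h1
  · rcases lt_or_gt_of_ne hz with hz | hz
    · exact IsRestriction.hasRandomResolvent_of_unitary h P hK'm hK'1 hKK hu hT hz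
    · exact IsRestriction.hasRandomResolvent h P hK'm hK'1 hKK hT hz

end Abstract

end Acoustic

end

noncomputable section

namespace Acoustic

/-! ## Two facts on Hilbert spaces -/

section Hilbert

variable {E F G : Type*} [NormedAddCommGroup E] [InnerProductSpace ℂ E] [CompleteSpace E]
  [NormedAddCommGroup F] [InnerProductSpace ℂ F] [CompleteSpace F]
  [NormedAddCommGroup G] [NormedSpace ℂ G]

/-- Coercivity bounds T from below, so T is injective with closed range. A vector w orthogonal to
the range satisfies ⟨w, Tw⟩ = 0 and vanishes. -/
theorem bijective_of_coercive (T : E →L[ℂ] E) {c : ℝ} (hc : 0 < c)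
    (hT : ∀ w, c * ‖w‖ ^ 2 ≤ (inner ℂ w (T w)).re) : Function.Bijective T := by
  have hb : ∀ w, c * ‖w‖ ≤ ‖T w‖ := fun w => by
    rcases eq_or_ne w 0 with rfl | h0
    · simp
    have h1 : 0 < ‖w‖ := norm_pos_iff.2 h0
    have h2 := (hT w).trans ((Complex.re_le_norm _).trans (norm_inner_le_norm w (T w)))
    refine le_of_mul_le_mul_left ?_ h1
    nlinarith
  have ha : AntilipschitzWith (Real.toNNReal c⁻¹) T := by
    refine ContinuousLinearMap.antilipschitz_of_bound T fun w => ?_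
    rw [Real.coe_toNNReal _ (by positivity), inv_mul_eq_div, le_div_iff₀ hc, mul_comm]
    exact hb w
  refine ⟨ha.injective, ?_⟩
  have hcl : IsClosed (T.range : Set E) := ha.isClosed_range T.uniformContinuous
  have : CompleteSpace T.range := hcl.completeSpace_coe
  refine LinearMap.range_eq_top.1 (?_ : T.range = ⊤)
  rw [← Submodule.orthogonal_eq_bot_iff, Submodule.eq_bot_iff]
  intro w hw
  have h1 := (Submodule.mem_orthogonal' _ _).1 hw (T w) ⟨w, rfl⟩
  have h2 := hT w
  rw [h1, Complex.zero_re] at h2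
  have h3 : ‖w‖ ^ 2 ≤ 0 := by
    by_contra hcon
    exact absurd h2 (not_le.2 (mul_pos hc (not_le.1 hcon)))
  exact norm_eq_zero.1 (by nlinarith [sq_nonneg ‖w‖])

/-- The Lax-Milgram lemma on a closed subspace. -/
theorem exists_solution_of_coercive (W : Submodule ℂ E) (hW : IsClosed (W : Set E)) (T : E →L[ℂ] E)
    {c : ℝ} (hc : 0 < c) (hT : ∀ w, c * ‖w‖ ^ 2 ≤ (inner ℂ w (T w)).re) :
    ∃ L : E →L[ℂ] E, ∀ e, L e ∈ W ∧ ∀ w ∈ W, inner ℂ w (T (L e)) = inner ℂ w e := by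
  have : CompleteSpace W := hW.completeSpace_coe
  -- The compression of T to W inherits coercivity, since projecting does not change inner products
  -- with vectors of W.
  let A : W →L[ℂ] W := W.orthogonalProjectionOnto.comp (T.comp W.subtypeL)
  have hA : Function.Bijective A := bijective_of_coercive A hc fun w => by
    change _ ≤ (inner ℂ (w : E) ((W.orthogonalProjectionOnto (T w) : W) : E)).re
    have h1 := Submodule.inner_orthogonalProjectionOnto_eq_of_mem_left w (T w)
    rw [Submodule.coe_inner] at h1
    rw [h1]
    exact hT w
  let e := ContinuousLinearEquiv.ofBijective A (LinearMap.ker_eq_bot.2 hA.1)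
    (LinearMap.range_eq_top.2 hA.2)
  refine ⟨W.subtypeL.comp ((e.symm : W →L[ℂ] W).comp W.orthogonalProjectionOnto), fun f =>
    ⟨(e.symm (W.orthogonalProjectionOnto f)).2, fun w hw => ?_⟩⟩
  have h1 : A (e.symm (W.orthogonalProjectionOnto f)) = W.orthogonalProjectionOnto f :=
    e.apply_symm_apply _
  have h2 := congrArg (fun y : W => inner ℂ w (y : E)) h1
  simp only [A, ContinuousLinearMap.comp_apply, Submodule.subtypeL_apply] at h2
  have h3 := fun y => Submodule.inner_orthogonalProjectionOnto_eq_of_mem_left (⟨w, hw⟩ : W) y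
  simp only [Submodule.coe_inner] at h3
  rw [h3, h3] at h2
  exact h2

/-- Bounded sequences have weak limits, and closed subspaces are weakly closed. -/
theorem exists_mem_of_bounded (Z : Submodule ℂ (F × G)) (hZ : IsClosed (Z : Set (F × G)))
    {C : ℝ} {x : ℕ → F} {y : ℕ → G} {y₀ : G} (hx : ∀ n, ‖x n‖ ≤ C)
    (hy : Tendsto y atTop (𝓝 y₀)) (h : ∀ n, (x n, y n) ∈ Z) :
    ∃ x₀, ‖x₀‖ ≤ C ∧ (x₀, y₀) ∈ Z := by
  -- Along an ultrafilter every bounded scalar sequence converges, so a weak limit exists without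
  -- extracting subsequences and without separability. The limit functional is bounded by C, and
  -- Riesz represents it by x₀.
  let U : Ultrafilter ℕ := Ultrafilter.of atTop
  have hU : (U : Filter ℕ) ≤ atTop := Ultrafilter.of_le _
  have hC : 0 ≤ C := (norm_nonneg _).trans (hx 0)
  have hb : ∀ f n, ‖inner ℂ (x n) f‖ ≤ C * ‖f‖ := fun f n =>
    (norm_inner_le_norm _ _).trans (mul_le_mul_of_nonneg_right (hx n) (norm_nonneg _))
  have hlim : ∀ f, ∃ l, Tendsto (fun n => inner ℂ (x n) f) U (𝓝 l) := fun f => by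
    obtain ⟨l, -, hl⟩ := (isCompact_closedBall (0 : ℂ) (C * ‖f‖)).ultrafilter_le_nhds
      (U.map fun n => inner ℂ (x n) f) (by
        rw [Ultrafilter.coe_map]
        exact tendsto_principal.2 (Eventually.of_forall fun n => by simpa using hb f n))
    exact ⟨l, hl⟩
  choose ℓ hℓ using hlim
  let L : F →L[ℂ] ℂ := LinearMap.mkContinuous
    { toFun := ℓ
      map_add' := fun f g => tendsto_nhds_unique (hℓ _) (by
        simpa only [inner_add_right] using (hℓ f).add (hℓ g))
      map_smul' := fun c f => tendsto_nhds_unique (hℓ _) (by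
        simpa only [inner_smul_right, smul_eq_mul, RingHom.id_apply] using (hℓ f).const_mul c) }
    C fun f => le_of_tendsto (hℓ f).norm (Eventually.of_forall (hb f))
  let x₀ := (InnerProductSpace.toDual ℂ F).symm L
  have hx₀ : ∀ f, Tendsto (fun n => inner ℂ (x n) f) U (𝓝 (inner ℂ x₀ f)) := fun f => by
    rw [InnerProductSpace.toDual_symm_apply]; exact hℓ f
  refine ⟨x₀, ?_, ?_⟩
  · rw [LinearIsometryEquiv.norm_map]
    exact LinearMap.mkContinuous_norm_le _ hC _
  by_contra hcon
  -- Mazur's argument: a functional separating the limit from Z splits into a part on F, continuous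
  -- along the weak convergence, and a part on G, continuous along the norm convergence.
  obtain ⟨f, u, hf1, hf2⟩ := RCLike.geometric_hahn_banach_point_closed (𝕜 := ℂ)
    (Z.restrictScalars ℝ).convex hZ hcon
  let f₁ : StrongDual ℂ F := f.comp (ContinuousLinearMap.inl ℂ F G)
  let f₂ : StrongDual ℂ G := f.comp (ContinuousLinearMap.inr ℂ F G)
  have hf : ∀ a b, f (a, b) = f₁ a + f₂ b := fun a b => by
    simp only [f₁, f₂, ContinuousLinearMap.comp_apply, ContinuousLinearMap.inl_apply,
      ContinuousLinearMap.inr_apply, ← map_add]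
    simp
  have h₁ : ∀ a, f₁ a = starRingEnd ℂ (inner ℂ a ((InnerProductSpace.toDual ℂ F).symm f₁)) :=
    fun a => by rw [inner_conj_symm, InnerProductSpace.toDual_symm_apply]
  have h3 : Tendsto (fun n => f (x n, y n)) U (𝓝 (f (x₀, y₀))) := by
    simp only [hf, h₁]
    exact ((Complex.continuous_conj.tendsto _).comp (hx₀ _)).add
      ((f₂.continuous.tendsto _).comp (hy.mono_left hU))
  have h4 : u ≤ RCLike.re (f (x₀, y₀)) :=
    ge_of_tendsto ((RCLike.continuous_re.tendsto _).comp h3)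
      (Eventually.of_forall fun n => (hf2 _ (h n)).le)
  exact absurd hf1 (not_lt.2 h4)

end Hilbert

end Acoustic

noncomputable section

namespace Acoustic

/-! ## Multiplication by the material parameters -/

section Media

variable {d : ℕ}

theorem norm_le_sum_norm (x : EuclideanSpace ℂ (Fin d)) : ‖x‖ ≤ ∑ i, ‖x i‖ := by
  conv_lhs => rw [← (EuclideanSpace.basisFun (Fin d) ℂ).sum_repr x]
  refine (norm_sum_le _ _).trans (Finset.sum_le_sum fun i _ => ?_)
  rw [norm_smul]
  simp

theorem norm_matAct_le (A : Matrix (Fin d) (Fin d) ℝ) (v : EuclideanSpace ℂ (Fin d)) :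
    ‖matAct A v‖ ≤ (∑ i, ∑ j, |A i j|) * ‖v‖ := by
  refine (norm_le_sum_norm _).trans ?_
  rw [Finset.sum_mul]
  refine Finset.sum_le_sum fun i _ => ?_
  rw [Finset.sum_mul]
  change ‖∑ j, (A i j : ℂ) * v j‖ ≤ _
  refine (norm_sum_le _ _).trans (Finset.sum_le_sum fun j _ => ?_)
  rw [norm_mul, Complex.norm_real, Real.norm_eq_abs]
  exact mul_le_mul_of_nonneg_left (PiLp.norm_apply_le _ j) (abs_nonneg _)

theorem matAct_mul (A B : Matrix (Fin d) (Fin d) ℝ) (v : EuclideanSpace ℂ (Fin d)) :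
    matAct (A * B) v = matAct A (matAct B v) := by
  ext i
  simp only [matAct, Matrix.mul_apply, Complex.ofReal_sum, Complex.ofReal_mul, Finset.sum_mul,
    Finset.mul_sum]
  rw [Finset.sum_comm]
  exact Finset.sum_congr rfl fun j _ => Finset.sum_congr rfl fun k _ => by ring

theorem matAct_one (v : EuclideanSpace ℂ (Fin d)) : matAct 1 v = v := by
  ext i
  change ∑ j, (((1 : Matrix (Fin d) (Fin d) ℝ) i j : ℝ) : ℂ) * v j = v i
  simp [Matrix.one_apply, apply_ite Complex.ofReal]

theorem aestronglyMeasurable_euclidean {μ : Measure (Sp d)}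
    {f : Sp d → EuclideanSpace ℂ (Fin d)} (hf : ∀ i, AEStronglyMeasurable (fun x => f x i) μ) :
    AEStronglyMeasurable f μ := by
  have h : AEStronglyMeasurable (fun x i => f x i) μ :=
    (aemeasurable_pi_lambda _ fun i => (hf i).aemeasurable).aestronglyMeasurable
  exact (PiLp.continuous_toLp 2 fun _ : Fin d => ℂ).comp_aestronglyMeasurable h

variable (M : Medium d)

theorem Medium.exists_norm_matAct_le : ∃ C : ℝ, 0 ≤ C ∧
    ∀ᵐ x ∂(volume.restrict M.dom), ∀ v, ‖matAct (M.α x) v‖ ≤ C * ‖v‖ := by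
  choose A hA0 hA using fun i j => EnergySpace.ae_bound (M.memLp_α i j)
  refine ⟨∑ i, ∑ j, A i j, Finset.sum_nonneg fun i _ => Finset.sum_nonneg fun j _ => hA0 i j, ?_⟩
  have hA' : ∀ᵐ x ∂(volume.restrict M.dom), ∀ i j, |M.α x i j| ≤ A i j :=
    ae_all_iff.2 fun i => ae_all_iff.2 fun j => hA i j
  filter_upwards [hA'] with x hx v
  refine (norm_matAct_le _ _).trans (mul_le_mul_of_nonneg_right ?_ (norm_nonneg _))
  exact Finset.sum_le_sum fun i _ => Finset.sum_le_sum fun j _ => hx i j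

theorem Medium.memLp_matAct (v : L2Vec M.dom) :
    MemLp (fun x => matAct (M.α x) (v x)) 2 (volume.restrict M.dom) := by
  obtain ⟨C, hC, h⟩ := M.exists_norm_matAct_le
  refine (Lp.memLp v).of_le_mul (c := C) (aestronglyMeasurable_euclidean fun i => ?_) ?_
  · change AEStronglyMeasurable (fun x => ∑ j, (M.α x i j : ℂ) * v x j) _
    refine Finset.aestronglyMeasurable_fun_sum _ fun j _ => ?_
    exact (M.memLp_α i j).ofReal.1.mul (memLp_coord v j).1
  · filter_upwards [h] with x hx using hx _

/-- Multiplication by `α` in `L²(O, ℂ^d)`. -/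
def Medium.mulα : L2Vec M.dom →L[ℂ] L2Vec M.dom :=
  LinearMap.mkContinuousOfExistsBound
    { toFun := fun v => (M.memLp_matAct v).toLp
      map_add' := fun v w => by
        rw [← MemLp.toLp_add]
        refine MemLp.toLp_congr _ _ ?_
        filter_upwards [Lp.coeFn_add v w] with x hx
        rw [hx, Pi.add_apply, Pi.add_apply, matAct_add]
      map_smul' := fun c v => by
        rw [RingHom.id_apply, ← MemLp.toLp_const_smul]
        refine MemLp.toLp_congr _ _ ?_
        filter_upwards [Lp.coeFn_smul c v] with x hx
        rw [hx, Pi.smul_apply, Pi.smul_apply, matAct_smul] }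
    (by
      obtain ⟨C, hC, h⟩ := M.exists_norm_matAct_le
      refine ⟨C, fun v => Lp.norm_le_mul_norm_of_ae_le_mul ?_⟩
      filter_upwards [h, (M.memLp_matAct v).coeFn_toLp] with x hx e
      change ‖((M.memLp_matAct v).toLp : L2Vec M.dom) x‖ ≤ _
      rw [e]
      exact hx _)

theorem Medium.mulα_ae (v : L2Vec M.dom) :
    M.mulα v =ᵐ[volume.restrict M.dom] fun x => matAct (M.α x) (v x) :=
  (M.memLp_matAct v).coeFn_toLp

theorem Medium.memLp_mul (p : L2 M.dom) :
    MemLp (fun x => (M.β x : ℂ) * p x) 2 (volume.restrict M.dom) := by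
  obtain ⟨C, hC, h⟩ := EnergySpace.ae_bound M.memLp_β
  refine (Lp.memLp p).of_le_mul (c := C) (M.memLp_β.ofReal.1.mul (Lp.memLp p).1) ?_
  filter_upwards [h] with x hx
  rw [norm_mul, Complex.norm_real]
  exact mul_le_mul_of_nonneg_right hx (norm_nonneg _)

/-- Multiplication by `β` in `L²(O)`. -/
def Medium.mulβ : L2 M.dom →L[ℂ] L2 M.dom :=
  LinearMap.mkContinuousOfExistsBound
    { toFun := fun v => (M.memLp_mul v).toLp
      map_add' := fun v w => by
        rw [← MemLp.toLp_add]
        refine MemLp.toLp_congr _ _ ?_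
        filter_upwards [Lp.coeFn_add v w] with x hx
        rw [hx, Pi.add_apply, Pi.add_apply, mul_add]
      map_smul' := fun c v => by
        rw [RingHom.id_apply, ← MemLp.toLp_const_smul]
        refine MemLp.toLp_congr _ _ ?_
        filter_upwards [Lp.coeFn_smul c v] with x hx
        rw [hx, Pi.smul_apply, Pi.smul_apply, smul_eq_mul, smul_eq_mul]
        ring }
    (by
      obtain ⟨C, hC, h⟩ := EnergySpace.ae_bound M.memLp_β
      refine ⟨C, fun v => Lp.norm_le_mul_norm_of_ae_le_mul ?_⟩
      filter_upwards [h, (M.memLp_mul v).coeFn_toLp] with x hx e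
      change ‖((M.memLp_mul v).toLp : L2 M.dom) x‖ ≤ _
      rw [e, norm_mul, Complex.norm_real]
      exact mul_le_mul_of_nonneg_right hx (norm_nonneg _))

theorem Medium.mulβ_ae (p : L2 M.dom) :
    M.mulβ p =ᵐ[volume.restrict M.dom] fun x => (M.β x : ℂ) * p x :=
  (M.memLp_mul p).coeFn_toLp

open EnergySpace

variable {M}

theorem EnergySpace.inner_eq (Φ Ψ : EnergySpace M) :
    inner ℂ Φ Ψ = inner ℂ (vel Φ) (M.mulα (vel Ψ)) + inner ℂ (pre Φ) (M.mulβ (pre Ψ)) := by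
  rw [EnergySpace.inner_def, weightedInner, L2.inner_def, L2.inner_def]
  congr 1
  · refine integral_congr_ae ?_
    filter_upwards [M.mulα_ae (vel Ψ)] with x hx
    rw [hx]
  · refine integral_congr_ae ?_
    filter_upwards [M.mulβ_ae (pre Ψ)] with x hx
    rw [hx]
    simp only [RCLike.inner_apply]
    ring

variable (M) in
/-- The energy space as a topological product. -/
def EnergySpace.equiv : EnergySpace M ≃L[ℂ] L2Vec M.dom × L2 M.dom :=
  let e : EnergySpace M ≃ₗ[ℂ] (L2Vec M.dom × L2 M.dom) := LinearEquiv.refl ℂ _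
  have h : ∃ C : ℝ, ∀ x, ‖e.symm x‖ ≤ C * ‖x‖ := by
    obtain ⟨C, hC, hu⟩ := upper_bound M
    refine ⟨Real.sqrt (2 * C), fun x => ?_⟩
    have h := hu (e.symm x)
    rw [← norm_sq] at h
    have ha : ‖vel (e.symm x)‖ ≤ ‖x‖ := norm_fst_le x
    have hb : ‖pre (e.symm x)‖ ≤ ‖x‖ := norm_snd_le x
    refine (sq_le_sq₀ (norm_nonneg _) (by positivity)).1 ?_
    rw [mul_pow, Real.sq_sqrt (by positivity)]
    have ha2 := pow_le_pow_left₀ (norm_nonneg _) ha 2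
    have hb2 := pow_le_pow_left₀ (norm_nonneg _) hb 2
    nlinarith
  (e.symm.toContinuousLinearEquivOfContinuous
    (AddMonoidHomClass.continuous_of_bound e.symm h.choose h.choose_spec)).symm

/-- The element `{v, p}` of the energy space. -/
def EnergySpace.pair (v : L2Vec M.dom) (p : L2 M.dom) : EnergySpace M := (equiv M).symm (v, p)

@[simp] theorem EnergySpace.vel_pair (v : L2Vec M.dom) (p : L2 M.dom) : vel (pair v p) = v := rfl

@[simp] theorem EnergySpace.pre_pair (v : L2Vec M.dom) (p : L2 M.dom) : pre (pair v p) = p := rfl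

theorem EnergySpace.ext {Φ Ψ : EnergySpace M} (h1 : vel Φ = vel Ψ) (h2 : pre Φ = pre Ψ) : Φ = Ψ :=
  Prod.ext h1 h2

variable (M) in
/-- The component `v`, as a bounded operator. -/
def EnergySpace.velL : EnergySpace M →L[ℂ] L2Vec M.dom :=
  (ContinuousLinearMap.fst ℂ _ _).comp (equiv M : EnergySpace M →L[ℂ] L2Vec M.dom × L2 M.dom)

variable (M) in
/-- The component `p`, as a bounded operator. -/
def EnergySpace.preL : EnergySpace M →L[ℂ] L2 M.dom :=
  (ContinuousLinearMap.snd ℂ _ _).comp (equiv M : EnergySpace M →L[ℂ] L2Vec M.dom × L2 M.dom)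

variable (M) in
/-- The operator `{v, p} ↦ {s v, t p}`. -/
def EnergySpace.diag (s t : ℂ) : EnergySpace M →L[ℂ] EnergySpace M :=
  ((equiv M).symm : L2Vec M.dom × L2 M.dom →L[ℂ] EnergySpace M).comp ((s • velL M).prod (t • preL M))

@[simp] theorem EnergySpace.vel_diag (s t : ℂ) (Φ : EnergySpace M) :
    vel (diag M s t Φ) = s • vel Φ := rfl

@[simp] theorem EnergySpace.pre_diag (s t : ℂ) (Φ : EnergySpace M) :
    pre (diag M s t Φ) = t • pre Φ := rfl

/-- Hermitian symmetry of the energy product, restricted to elements of the form {v, 0}. -/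
theorem Medium.inner_mulα_left (v w : L2Vec M.dom) :
    inner ℂ (M.mulα v) w = inner ℂ v (M.mulα w) := by
  have h := inner_conj_symm (𝕜 := ℂ) (pair v 0 : EnergySpace M) (pair w 0)
  rw [EnergySpace.inner_eq, EnergySpace.inner_eq] at h
  simpa using h

theorem Medium.inner_mulβ_left (v w : L2 M.dom) :
    inner ℂ (M.mulβ v) w = inner ℂ v (M.mulβ w) := by
  have h := inner_conj_symm (𝕜 := ℂ) (pair 0 v : EnergySpace M) (pair 0 w)
  rw [EnergySpace.inner_eq, EnergySpace.inner_eq] at h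
  simpa using h

/-- Uniform positivity of α is coercivity of this multiplication operator. Every gradient can thus
be written αη with η in L², so the pair {η, p} carries an energy norm equivalent to the H¹ norm of
p. -/
theorem Medium.mulα_surjective : Function.Surjective M.mulα := by
  obtain ⟨c, hc, h⟩ := lower_bound M
  refine (bijective_of_coercive M.mulα hc fun v => ?_).2
  have := h (pair v 0)
  rw [← EnergySpace.inner_def, EnergySpace.inner_eq] at this
  simpa using this

/-- Membership in the graph of `𝒜*` without division by the material parameters. -/
theorem mem_maxGraph_iff {Ψ Θ : EnergySpace M} : (Ψ, Θ) ∈ maxGraph M ↔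
    HasWeakGrad M.dom (pre Ψ) (Complex.I • M.mulα (vel Θ)) ∧
      HasWeakDiv M.dom (vel Ψ) (Complex.I • M.mulβ (pre Θ)) := by
  obtain ⟨a, ha, hα⟩ := M.pos_α
  obtain ⟨b, hb, hβ⟩ := M.pos_β
  -- Positive definiteness leaves no kernel, so the matrix inverse in `maxGraph` is a genuine
  -- inverse almost everywhere and not the default value.
  have hinv : ∀ᵐ x ∂(volume.restrict M.dom), IsUnit (M.α x).det := by
    filter_upwards [hα] with x hx
    rw [isUnit_iff_ne_zero]
    intro h0
    obtain ⟨v, hv0, hv⟩ := Matrix.exists_mulVec_eq_zero_iff.2 h0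
    have h1 := hx v
    have h2 : ∑ i, ∑ j, v i * M.α x i j * v j = 0 := by
      refine Finset.sum_eq_zero fun i _ => ?_
      have h3 := congrFun hv i
      simp only [Matrix.mulVec, dotProduct, Pi.zero_apply] at h3
      simp_rw [mul_assoc, ← Finset.mul_sum, h3, mul_zero]
    rw [h2] at h1
    have h4 : ∑ i, v i ^ 2 ≤ 0 := by
      by_contra hcon
      exact absurd h1 (not_le.2 (mul_pos ha (not_le.1 hcon)))
    refine hv0 (funext fun i => ?_)
    have h5 := (Finset.sum_eq_zero_iff_of_nonneg fun i _ => sq_nonneg (v i)).1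
      (le_antisymm h4 (Finset.sum_nonneg fun i _ => sq_nonneg (v i))) i (Finset.mem_univ i)
    exact pow_eq_zero_iff (two_ne_zero) |>.1 h5
  have hI : Complex.I * (1 / Complex.I) = 1 := by simp
  have hI' : (1 / Complex.I) * Complex.I = 1 := by simp
  constructor
  · rintro ⟨G, D, h1, h2, h3, h4⟩
    have e1 : Complex.I • M.mulα (vel Θ) = G := by
      refine Lp.ext ?_
      filter_upwards [Lp.coeFn_smul Complex.I (M.mulα (vel Θ)), M.mulα_ae (vel Θ), h3, hinv]
        with x k1 k2 k3 k4
      rw [k1, Pi.smul_apply, k2, k3, matAct_smul, smul_smul, hI, one_smul, ← matAct_mul,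
        Matrix.mul_nonsing_inv _ k4, matAct_one]
    have e2 : Complex.I • M.mulβ (pre Θ) = D := by
      refine Lp.ext ?_
      filter_upwards [Lp.coeFn_smul Complex.I (M.mulβ (pre Θ)), M.mulβ_ae (pre Θ), h4, hβ]
        with x k1 k2 k3 k4
      have k5 : (M.β x : ℂ) ≠ 0 := by
        exact_mod_cast (hb.trans_le k4).ne'
      rw [k1, Pi.smul_apply, k2, k3, smul_eq_mul, Complex.ofReal_inv]
      field_simp
    rw [e1, e2]
    exact ⟨h1, h2⟩
  · rintro ⟨h1, h2⟩
    refine ⟨_, _, h1, h2, ?_, ?_⟩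
    · filter_upwards [Lp.coeFn_smul Complex.I (M.mulα (vel Θ)), M.mulα_ae (vel Θ), hinv]
        with x k1 k2 k4
      rw [k1, Pi.smul_apply, k2, matAct_smul, smul_smul, hI', one_smul, ← matAct_mul,
        Matrix.nonsing_inv_mul _ k4, matAct_one]
    · filter_upwards [Lp.coeFn_smul Complex.I (M.mulβ (pre Θ)), M.mulβ_ae (pre Θ), hβ]
        with x k1 k2 k4
      have k5 : (M.β x : ℂ) ≠ 0 := by
        exact_mod_cast (hb.trans_le k4).ne'
      rw [k1, Pi.smul_apply, k2, smul_eq_mul, Complex.ofReal_inv]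
      field_simp

end Media

end Acoustic

end

noncomputable section

namespace Acoustic

/-! ## Closedness of weak gradients and traces -/

section TraceGraph

open scoped ContDiff

variable {d : ℕ} {O : Set (Sp d)}

theorem memLp_complex {μ : Measure (Sp d)} {φ : Sp d → ℝ} (hφ : MemLp φ 2 μ) :
    MemLp (fun x => (φ x : ℂ)) 2 μ := hφ.ofReal

theorem integral_ofReal_mul_eq_inner {μ : Measure (Sp d)} {φ : Sp d → ℝ} (hφ : MemLp φ 2 μ)
    (p : Lp ℂ 2 μ) :
    ∫ x, (φ x : ℂ) * p x ∂μ = inner ℂ (memLp_complex hφ).toLp p := by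
  rw [L2.inner_def]
  refine integral_congr_ae ?_
  filter_upwards [(memLp_complex hφ).coeFn_toLp] with x hx
  rw [hx, RCLike.inner_apply, Complex.conj_ofReal, mul_comm]

theorem IsTestFunction.memLp {φ : Sp d → ℝ} (hφ : IsTestFunction O φ) :
    MemLp φ 2 (volume.restrict O) :=
  hφ.1.continuous.memLp_of_hasCompactSupport hφ.2.1

theorem IsTestFunction.memLp_partialD {φ : Sp d → ℝ} (hφ : IsTestFunction O φ) (i : Fin d) :
    MemLp (partialD i φ) 2 (volume.restrict O) := by
  have hc : Continuous (partialD i φ) :=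
    (hφ.1.continuous_fderiv (by simp)).clm_apply continuous_const
  have hs : HasCompactSupport (partialD i φ) := (hφ.2.1.fderiv (𝕜 := ℝ)).comp_left
    (g := fun L : Sp d →L[ℝ] ℝ => L (EuclideanSpace.single i 1)) rfl
  exact hc.memLp_of_hasCompactSupport hs

/-- The coordinate `v ↦ v i` on `L²(O, ℂ^d)`. -/
def coordL (i : Fin d) : L2Vec O →L[ℂ] L2 O :=
  (EuclideanSpace.proj (𝕜 := ℂ) i : EuclideanSpace ℂ (Fin d) →L[ℂ] ℂ).compLpL 2 _

theorem coordL_ae (i : Fin d) (v : L2Vec O) :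
    coordL i v =ᵐ[volume.restrict O] fun x => v x i :=
  ContinuousLinearMap.coeFn_compLpL _ _

/-- Each test function and each coordinate imposes an equation between continuous functionals. -/
theorem isClosed_hasWeakGrad : IsClosed {z : L2 O × L2Vec O | HasWeakGrad O z.1 z.2} := by
  have : {z : L2 O × L2Vec O | HasWeakGrad O z.1 z.2} =
      ⋂ (φ : Sp d → ℝ) (hφ : IsTestFunction O φ) (i : Fin d),
        {z | inner ℂ (memLp_complex (hφ.memLp_partialD i)).toLp z.1 =
          - inner ℂ (memLp_complex hφ.memLp).toLp (coordL i z.2)} := by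
    ext z
    simp only [Set.mem_ofPred_eq, Set.mem_iInter, HasWeakGrad]
    refine forall_congr' fun φ => forall_congr' fun hφ => forall_congr' fun i => ?_
    rw [← integral_ofReal_mul_eq_inner (hφ.memLp_partialD i), ← integral_ofReal_mul_eq_inner hφ.memLp]
    have : ∫ x in O, (φ x : ℂ) * z.2 x i = ∫ x in O, (φ x : ℂ) * coordL i z.2 x := by
      refine integral_congr_ae ?_
      filter_upwards [coordL_ae i z.2] with x hx
      rw [hx]
    rw [this]
  rw [this]
  refine isClosed_iInter fun φ => isClosed_iInter fun hφ => isClosed_iInter fun i => ?_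
  exact isClosed_eq ((innerSL ℂ _).continuous.comp continuous_fst)
    (((innerSL ℂ _).continuous.comp ((coordL i).continuous.comp continuous_snd)).neg)

theorem eLpNorm_sub_le_of_Lp {F : Type*} [NormedAddCommGroup F] {μ : Measure (Sp d)}
    {u : Sp d → F} (hu : AEStronglyMeasurable u μ) (p q : Lp F 2 μ) :
    eLpNorm (fun x => u x - q x) 2 μ ≤ eLpNorm (fun x => u x - p x) 2 μ + ‖p - q‖ₑ := by
  have h := eLpNorm_add_le (hu.sub (Lp.aestronglyMeasurable p))
    ((Lp.aestronglyMeasurable p).sub (Lp.aestronglyMeasurable q)) (p := 2) (by norm_num)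
  refine le_trans (le_of_eq ?_) (h.trans (add_le_add le_rfl (le_of_eq ?_)))
  · congr 1
    funext x
    simp
  · rw [Lp.enorm_def]
    exact eLpNorm_congr_ae (Lp.coeFn_sub p q).symm

theorem HasWeakGrad.unique (hO : IsOpen O) {p : L2 O} {G H : L2Vec O}
    (h : HasWeakGrad O p G) (k : HasWeakGrad O p H) : G = H := by
  have := h.add (k.smul (-1))
  rw [neg_one_smul, neg_one_smul, add_neg_cancel] at this
  rw [← sub_eq_zero, sub_eq_add_neg]
  exact this.eq_zero hO

theorem HasWeakDiv.unique (hO : IsOpen O) {v : L2Vec O} {D E : L2 O}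
    (h : HasWeakDiv O v D) (k : HasWeakDiv O v E) : D = E := by
  have := h.add (k.smul (-1))
  rw [neg_one_smul, neg_one_smul, add_neg_cancel] at this
  rw [← sub_eq_zero, sub_eq_add_neg]
  exact this.eq_zero hO

/-- The triples `(p, ∇p, γ₀ p)`. -/
def traceGraph (O : Set (Sp d)) : Submodule ℂ ((L2 O × L2Vec O) × L2Bdry O) where
  carrier := {z | HasWeakGrad O z.1.1 z.1.2 ∧ IsTrace O z.1.1 z.2}
  zero_mem' := ⟨HasWeakGrad.zero O, IsTrace.zero O⟩
  add_mem' h k := ⟨h.1.add k.1, h.2.add k.2⟩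
  smul_mem' c _ h := ⟨h.1.smul c, h.2.smul c⟩

/-- A diagonal argument: for the n-th member of a convergent sequence choose a smooth function
within 1/(n+1) in all three norms. Uniqueness of the weak gradient identifies the gradient in the
definition of the trace with the given one. -/
theorem isClosed_traceGraph (hO : IsOpen O) :
    IsClosed (traceGraph O : Set ((L2 O × L2Vec O) × L2Bdry O)) := by
  refine IsSeqClosed.isClosed fun z z₀ hz hz₀ => ?_
  have h1 : Tendsto (fun n => (z n).1) atTop (𝓝 z₀.1) := (continuous_fst.tendsto _).comp hz₀
  have hG : HasWeakGrad O z₀.1.1 z₀.1.2 :=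
    isClosed_hasWeakGrad.mem_of_tendsto h1 (Eventually.of_forall fun n => (hz n).1)
  refine ⟨hG, z₀.1.2, hG, ?_⟩
  have key : ∀ n : ℕ, ∃ u : Sp d → ℂ, ContDiff ℝ ∞ u ∧
      eLpNorm (fun x => u x - (z n).1.1 x) 2 (volume.restrict O) ≤ ((n : ℝ≥0∞) + 1)⁻¹ ∧
      eLpNorm (fun x => classicalGrad u x - (z n).1.2 x) 2 (volume.restrict O) ≤
        ((n : ℝ≥0∞) + 1)⁻¹ ∧
      eLpNorm (fun x => u x - (z n).2 x) 2 (surfaceMeasure O) ≤ ((n : ℝ≥0∞) + 1)⁻¹ := by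
    intro n
    obtain ⟨h, G, hG', u, hu, k1, k2, k3⟩ := hz n
    rw [hG'.unique hO h] at k2
    have hpos : (0 : ℝ≥0∞) < ((n : ℝ≥0∞) + 1)⁻¹ :=
      ENNReal.inv_pos.2 (ENNReal.add_ne_top.2 ⟨ENNReal.natCast_ne_top n, ENNReal.one_ne_top⟩)
    obtain ⟨m, e1, e2, e3⟩ := ((k1.eventually_le_const hpos).and
      ((k2.eventually_le_const hpos).and (k3.eventually_le_const hpos))).exists
    exact ⟨u m, hu m, e1, e2, e3⟩
  choose u hu k1 k2 k3 using key
  have hlim : Tendsto (fun n : ℕ => ((n : ℝ≥0∞) + 1)⁻¹) atTop (𝓝 0) := by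
    have := (tendsto_add_atTop_iff_nat 1).2 ENNReal.tendsto_inv_nat_nhds_zero
    simpa using this
  have hgen : ∀ {F : Type} [NormedAddCommGroup F] {μ : Measure (Sp d)} {w : ℕ → Sp d → F}
      (_ : ∀ n, AEStronglyMeasurable (w n) μ) {p : ℕ → Lp F 2 μ} {q : Lp F 2 μ}
      (_ : Tendsto p atTop (𝓝 q))
      (_ : ∀ n, eLpNorm (fun x => w n x - p n x) 2 μ ≤ ((n : ℝ≥0∞) + 1)⁻¹),
      Tendsto (fun n => eLpNorm (fun x => w n x - q x) 2 μ) atTop (𝓝 0) := by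
    intro F _ μ w hw p q hp hle
    have h2 : Tendsto (fun n => ‖p n - q‖ₑ) atTop (𝓝 0) := by
      have := (tendsto_iff_edist_tendsto_0.1 hp)
      simpa only [edist_eq_enorm_sub] using this
    have h3 := hlim.add h2
    rw [add_zero] at h3
    exact tendsto_of_tendsto_of_tendsto_of_le_of_le tendsto_const_nhds h3 (fun _ => bot_le)
      fun n => (eLpNorm_sub_le_of_Lp (hw n) (p n) q).trans (add_le_add (hle n) le_rfl)
  refine ⟨u, hu, hgen (fun n => (hu n).continuous.aestronglyMeasurable)
      ((continuous_fst.tendsto _).comp h1) k1,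
    hgen (fun n => (continuous_classicalGrad (hu n)).aestronglyMeasurable)
      ((continuous_snd.tendsto _).comp h1) k2,
    hgen (fun n => (hu n).continuous.aestronglyMeasurable)
      ((continuous_snd.tendsto _).comp hz₀) k3⟩

theorem eLpNorm_sub_eq_zero {F : Type*} [NormedAddCommGroup F] {μ : Measure (Sp d)}
    {u : Sp d → F} {p : Lp F 2 μ} (h : p =ᵐ[μ] u) : eLpNorm (fun x => u x - p x) 2 μ = 0 := by
  rw [← eLpNorm_zero (p := 2) (μ := μ) (ε := F)]
  refine eLpNorm_congr_ae ?_
  filter_upwards [h] with x hx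
  rw [hx]
  simp

/-- A smooth function has its classical gradient as weak gradient, and its restriction as trace. -/
theorem isTrace_of_contDiff {u : Sp d → ℂ} (hu : ContDiff ℝ ∞ u) {p : L2 O}
    {G : L2Vec O} {f : L2Bdry O} (hp : p =ᵐ[volume.restrict O] u)
    (hG : G =ᵐ[volume.restrict O] classicalGrad u) (hf : f =ᵐ[surfaceMeasure O] u) :
    HasWeakGrad O p G ∧ IsTrace O p f := by
  have h : HasWeakGrad O p G := by
    intro φ hφ i
    have hsub : Function.support φ ⊆ O := (subset_tsupport φ).trans hφ.2.2
    have hsub' : Function.support (partialD i φ) ⊆ O := by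
      refine Function.support_subset_iff'.2 fun x hx => ?_
      have : fderiv ℝ φ x = 0 := by
        by_contra hcon
        exact hx (hφ.2.2 (support_fderiv_subset ℝ (f := φ) (Function.mem_support.2 hcon)))
      simp [partialD, this]
    -- The support of φ lies in O, so both integrals extend to the whole space, where integration by
    -- parts has no boundary term.
    have e1 : ∫ x in O, ((partialD i φ x : ℝ) : ℂ) * p x =
        ∫ x, ((partialD i φ x : ℝ) : ℂ) * u x := by
      refine Eq.trans ?_ (setIntegral_eq_integral_of_forall_compl_eq_zero (s := O) ?_)
      · refine integral_congr_ae ?_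
        filter_upwards [hp] with x hx
        rw [hx]
      · intro x hx
        rw [Function.notMem_support.1 fun h => hx (hsub' h)]
        simp
    have e2 : ∫ x in O, (φ x : ℂ) * G x i = ∫ x, (φ x : ℂ) * partialD i u x := by
      refine Eq.trans ?_ (setIntegral_eq_integral_of_forall_compl_eq_zero (s := O) ?_)
      · have : ∀ᵐ x ∂(volume.restrict O), (φ x : ℂ) * G x i = (φ x : ℂ) * partialD i u x := by
          filter_upwards [hG] with x hx
          rw [hx]
          rfl
        exact integral_congr_ae this
      · intro x hx
        rw [Function.notMem_support.1 fun h => hx (hsub h)]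
        simp
    rw [e1, e2]
    have hdu : Differentiable ℝ u := hu.differentiable (by simp)
    have hdφ : Differentiable ℝ φ := hφ.1.differentiable (by simp)
    have hcp : Continuous (partialD i φ) :=
      (hφ.1.continuous_fderiv (by simp)).clm_apply continuous_const
    have hcu : Continuous (partialD i u) :=
      (hu.continuous_fderiv (by simp)).clm_apply continuous_const
    have hs : HasCompactSupport (partialD i φ) := (hφ.2.1.fderiv (𝕜 := ℝ)).comp_left
      (g := fun L : Sp d →L[ℝ] ℝ => L (EuclideanSpace.single i 1)) rfl
    have key := integral_bilinear_fderiv_right_eq_neg_left_of_integrable (μ := volume)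
      (B := ContinuousLinearMap.lsmul ℝ ℝ (E := ℂ)) (f := φ) (g := u)
      (v := EuclideanSpace.single i (1 : ℝ)) ?_ ?_ ?_ (fun x _ => hdφ x) (fun x _ => hdu x)
    · simp only [ContinuousLinearMap.lsmul_apply, Complex.real_smul] at key
      change ∫ x, (φ x : ℂ) * partialD i u x = - ∫ x, ((partialD i φ x : ℝ) : ℂ) * u x at key
      rw [key, neg_neg]
    · refine Continuous.integrable_of_hasCompactSupport ?_ ?_
      · exact hcp.smul hu.continuous
      · exact hs.smul_right
    · refine Continuous.integrable_of_hasCompactSupport ?_ ?_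
      · exact hφ.1.continuous.smul hcu
      · exact hφ.2.1.smul_right
    · refine Continuous.integrable_of_hasCompactSupport ?_ ?_
      · exact hφ.1.continuous.smul hu.continuous
      · exact hφ.2.1.smul_right
  refine ⟨h, G, h, fun _ => u, fun _ => hu, ?_, ?_, ?_⟩
  · simp only [eLpNorm_sub_eq_zero hp]; exact tendsto_const_nhds
  · simp only [eLpNorm_sub_eq_zero hG]; exact tendsto_const_nhds
  · simp only [eLpNorm_sub_eq_zero hf]; exact tendsto_const_nhds

/-- The trace of a test function vanishes. -/
theorem IsTestFunction.exists_trace_zero (hO : IsOpen O) {φ : Sp d → ℝ}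
    (hφ : IsTestFunction O φ) : ∃ (p : L2 O) (H : L2Vec O), HasWeakGrad O p H ∧ IsTrace O p 0 ∧
      p =ᵐ[volume.restrict O] (fun x => (φ x : ℂ)) ∧
      ∀ᵐ x ∂(volume.restrict O), ∀ i, H x i = ((partialD i φ x : ℝ) : ℂ) := by
  let u : Sp d → ℂ := fun x => (φ x : ℂ)
  have hu : ContDiff ℝ ∞ u := Complex.ofRealCLM.contDiff.comp hφ.1
  have hpd : ∀ i x, partialD i u x = ((partialD i φ x : ℝ) : ℂ) := fun i x => by
    have h1 : HasFDerivAt u (Complex.ofRealCLM.comp (fderiv ℝ φ x)) x :=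
      Complex.ofRealCLM.hasFDerivAt.comp x (hφ.1.differentiable (by simp) x).hasFDerivAt
    simp [partialD, h1.fderiv]
  have hcs : HasCompactSupport u := hφ.2.1.comp_left (g := fun r : ℝ => (r : ℂ)) rfl
  have hup : MemLp u 2 (volume.restrict O) := hu.continuous.memLp_of_hasCompactSupport hcs
  have hgs : HasCompactSupport (classicalGrad u) := by
    refine HasCompactSupport.intro hcs.isCompact fun x hx => ?_
    have : fderiv ℝ u x = 0 := by
      by_contra hcon
      exact hx (support_fderiv_subset ℝ hcon)
    ext i
    simp [classicalGrad, partialD, this]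
  have hG : MemLp (classicalGrad u) 2 (volume.restrict O) :=
    (continuous_classicalGrad hu).memLp_of_hasCompactSupport hgs
  have h0 : (0 : L2Bdry O) =ᵐ[surfaceMeasure O] u := by
    have hm : ∀ᵐ x ∂(surfaceMeasure O), x ∈ frontier O :=
      ae_restrict_mem isClosed_frontier.measurableSet
    filter_upwards [hm, Lp.coeFn_zero ℂ 2 (surfaceMeasure O)] with x hx h0
    rw [h0]
    have : φ x = 0 := by
      by_contra hcon
      have hxO : x ∈ O := hφ.2.2 (subset_tsupport φ hcon)
      exact (hO.frontier_eq ▸ hx).2 hxO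
    simp [u, this]
  have := isTrace_of_contDiff hu hup.coeFn_toLp hG.coeFn_toLp h0
  refine ⟨hup.toLp, hG.toLp, this.1, this.2, hup.coeFn_toLp, ?_⟩
  filter_upwards [hG.coeFn_toLp] with x hx i
  rw [hx]
  exact hpd i x

end TraceGraph

end Acoustic

end

noncomputable section

namespace Acoustic

/-! ## The boundary system of an acoustic medium -/

section AcousticSystem

open EnergySpace

variable {d : ℕ}

/-- The trace operator is bounded from `H¹(O)` to `H^{1/2}(∂O)`. -/
def TraceBounded (O : Set (Sp d)) : Prop :=
  ∃ C : ℝ, 0 ≤ C ∧ ∀ (p : L2 O) (G : L2Vec O) (g : HHalf O), HasWeakGrad O p G →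
    IsTrace O p (HHalf.fn g) → ‖g‖ ≤ C * (‖p‖ + ‖G‖)

/-- Elements of `H^{1/2}(∂O)` have bounded extensions to `H¹(O)`. -/
def TraceLifting (O : Set (Sp d)) : Prop :=
  ∃ C : ℝ, 0 ≤ C ∧ ∀ g : HHalf O, ∃ (p : L2 O) (G : L2Vec O), HasWeakGrad O p G ∧
    IsTrace O p (HHalf.fn g) ∧ ‖p‖ + ‖G‖ ≤ C * ‖g‖

variable {M : Medium d}

/-- The boundary relation of the acoustic operator: `Θ = 𝒜* Ψ`, `a = V⁻¹ γ₀ p`, `b = V^♮ γₙ v`. -/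
def acousticRelation (M : Medium d) (V : L2Bdry M.dom ≃L[ℂ] HHalf M.dom) (Ψ Θ : EnergySpace M)
    (a b : L2Bdry M.dom) : Prop :=
  (Ψ, Θ) ∈ maxGraph M ∧ IsTrace M.dom (pre Ψ) (HHalf.fn (V a)) ∧
    ∃ h, IsNormalTrace M.dom (vel Ψ) h ∧ natAdjoint (V : L2Bdry M.dom →L[ℂ] HHalf M.dom) h = b

variable {V : L2Bdry M.dom ≃L[ℂ] HHalf M.dom}

/-- The definition of the normal trace, read through V: the pairing ⟨γₙv, Vk⟩ becomes an inner
product with b = V^♮γₙv in L²(∂O). -/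
theorem acousticRelation.inner_eq {Ψ Θ : EnergySpace M} {a b : L2Bdry M.dom}
    (h : acousticRelation M V Ψ Θ a b) {p : L2 M.dom} {G : L2Vec M.dom} {k : L2Bdry M.dom}
    (hp : HasWeakGrad M.dom p G) (hk : IsTrace M.dom p (HHalf.fn (V k))) :
    inner ℂ k b = inner ℂ G (vel Ψ) + Complex.I * inner ℂ p (M.mulβ (pre Θ)) := by
  obtain ⟨h1, -, η, ⟨D, hD, hη⟩, rfl⟩ := h
  rw [inner_natAdjoint, ← inner_smul_right,
    (mem_maxGraph_iff.1 h1).2.unique M.isOpen_dom hD]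
  exact hη p G (V k) hp hk

/-- Pair the normal trace of each element with the pressure of the other; the symmetry of α and β
matches the volume terms. -/
theorem acousticRelation.green {Ψ₁ Θ₁ Ψ₂ Θ₂ : EnergySpace M} {a₁ b₁ a₂ b₂ : L2Bdry M.dom}
    (h₁ : acousticRelation M V Ψ₁ Θ₁ a₁ b₁) (h₂ : acousticRelation M V Ψ₂ Θ₂ a₂ b₂) :
    inner ℂ a₁ b₂ + inner ℂ b₁ a₂ = Complex.I * (inner ℂ Ψ₁ Θ₂ - inner ℂ Θ₁ Ψ₂) := by
  have e1 := h₂.inner_eq (mem_maxGraph_iff.1 h₁.1).1 h₁.2.1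
  have e2 := h₁.inner_eq (mem_maxGraph_iff.1 h₂.1).1 h₂.2.1
  rw [← inner_conj_symm b₁ a₂, e1, e2, map_add, map_mul, inner_conj_symm, inner_conj_symm,
    inner_smul_left, inner_smul_right, EnergySpace.inner_eq, EnergySpace.inner_eq,
    Medium.inner_mulα_left, Medium.inner_mulβ_left, Complex.conj_I]
  ring

@[simp] theorem HHalf.fn_zero {O : Set (Sp d)} : HHalf.fn (0 : HHalf O) = 0 := rfl

@[simp] theorem HHalf.fn_add {O : Set (Sp d)} (f g : HHalf O) :
    HHalf.fn (f + g) = HHalf.fn f + HHalf.fn g := rfl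

@[simp] theorem HHalf.fn_smul {O : Set (Sp d)} (c : ℂ) (f : HHalf O) :
    HHalf.fn (c • f) = c • HHalf.fn f := rfl

variable (M V) in
/-- The closed subspace of the pairs `({η, p}, a)` with `∇ p = α η` and `γ₀ p = V a`. -/
def formDomain : Submodule ℂ (WithLp 2 (EnergySpace M × L2Bdry M.dom)) where
  carrier := {w | HasWeakGrad M.dom (pre w.fst) (M.mulα (vel w.fst)) ∧
    IsTrace M.dom (pre w.fst) (HHalf.fn (V w.snd))}
  zero_mem' := by
    refine ⟨?_, ?_⟩
    · simpa using HasWeakGrad.zero M.dom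
    · simpa using IsTrace.zero M.dom
  add_mem' h k := by
    refine ⟨?_, ?_⟩
    · simpa using h.1.add k.1
    · simpa using h.2.add k.2
  smul_mem' c _ h := by
    refine ⟨?_, ?_⟩
    · simpa using h.1.smul c
    · simpa using h.2.smul c

theorem continuous_fn {O : Set (Sp d)} : Continuous (HHalf.fn : HHalf O → L2Bdry O) :=
  (WithLp.continuous_fst 2 _ _).comp continuous_subtype_val

theorem isClosed_formDomain :
    IsClosed (formDomain M V : Set (WithLp 2 (EnergySpace M × L2Bdry M.dom))) := by
  have hf : Continuous fun w : WithLp 2 (EnergySpace M × L2Bdry M.dom) => w.fst :=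
    WithLp.continuous_fst 2 _ _
  have hs : Continuous fun w : WithLp 2 (EnergySpace M × L2Bdry M.dom) => w.snd :=
    WithLp.continuous_snd 2 _ _
  have hc : Continuous fun w : WithLp 2 (EnergySpace M × L2Bdry M.dom) =>
      ((pre w.fst, M.mulα (vel w.fst)), HHalf.fn (V w.snd)) :=
    (((preL M).continuous.comp hf).prodMk
      (M.mulα.continuous.comp ((velL M).continuous.comp hf))).prodMk
      (continuous_fn.comp (V.continuous.comp hs))
  exact (isClosed_traceGraph M.isOpen_dom).preimage hc

theorem exists_mem_formDomain {p : L2 M.dom} {G : L2Vec M.dom} {k : L2Bdry M.dom}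
    (hp : HasWeakGrad M.dom p G) (hk : IsTrace M.dom p (HHalf.fn (V k))) :
    ∃ η, M.mulα η = G ∧ WithLp.toLp 2 (pair η p, k) ∈ formDomain M V := by
  obtain ⟨η, rfl⟩ := M.mulα_surjective G
  exact ⟨η, rfl, hp, hk⟩

/-- Test functions are themselves admissible p of zero trace, so a variational identity contains the
distributional equation. -/
theorem hasWeakDiv_of_inner {O : Set (Sp d)} {v : L2Vec O} {D : L2 O} (hO : IsOpen O)
    (h : ∀ (p : L2 O) (H : L2Vec O), HasWeakGrad O p H → IsTrace O p 0 →
      inner ℂ H v + inner ℂ p D = 0) : HasWeakDiv O v D := by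
  intro φ hφ
  obtain ⟨p, H, h1, h2, h3, h4⟩ := hφ.exists_trace_zero hO
  have h5 := h p H h1 h2
  rw [L2.inner_def, L2.inner_def, add_eq_zero_iff_eq_neg] at h5
  convert! h5 using 1
  · refine integral_congr_ae ?_
    filter_upwards [h4] with x hx
    rw [PiLp.inner_apply]
    refine Finset.sum_congr rfl fun i _ => ?_
    rw [hx, RCLike.inner_apply, Complex.conj_ofReal, mul_comm]
  · congr 1
    refine integral_congr_ae ?_
    filter_upwards [h3] with x hx
    rw [hx, RCLike.inner_apply, Complex.conj_ofReal, mul_comm]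

/-- The functional `k ↦ (b | V⁻¹ k)` on `H^{1/2}(∂O)`. -/
def dualFunctional (V : L2Bdry M.dom ≃L[ℂ] HHalf M.dom) (b : L2Bdry M.dom) : HMinusHalf M.dom :=
  ((starL ℂ : ℂ ≃L⋆[ℂ] ℂ) : ℂ →L⋆[ℂ] ℂ).comp
    ((innerSL ℂ b).comp (V.symm : HHalf M.dom →L[ℂ] L2Bdry M.dom))

theorem dualFunctional_apply (b : L2Bdry M.dom) (k : HHalf M.dom) :
    dualFunctional V b k = inner ℂ (V.symm k) b := by
  rw [← inner_conj_symm]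
  rfl

theorem natAdjoint_dualFunctional (b : L2Bdry M.dom) :
    natAdjoint (V : L2Bdry M.dom →L[ℂ] HHalf M.dom) (dualFunctional V b) = b :=
  ext_inner_left ℂ fun f => by
    rw [inner_natAdjoint, dualFunctional_apply]
    simp

theorem norm_sq_eq_diag (Φ : EnergySpace M) :
    ‖Φ‖ ^ 2 = ‖diag M 1 0 Φ‖ ^ 2 + ‖diag M 0 1 Φ‖ ^ 2 := by
  have h : ∀ Ψ : EnergySpace M, ‖Ψ‖ ^ 2 = (inner ℂ Ψ Ψ).re := fun Ψ =>
    (inner_self_eq_norm_sq (𝕜 := ℂ) Ψ).symm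
  simp [h, EnergySpace.inner_eq, -inner_self_eq_norm_sq_to_K]

/-- With η = α⁻¹∇p, the first component of the equation gives v = -(i/z)η - (1/z)f_v, which
eliminates v. The second component and b = a + c then form one variational problem for (η, p, a) on
`formDomain`. Its form has diagonal coefficients i/z, -iz and 1 on η, p and a, all of positive real
part when Im z > 0. -/
theorem acousticRelation_solvable (V : L2Bdry M.dom ≃L[ℂ] HHalf M.dom) (z : ℂ) (hz : 0 < z.im) :
    ∃ (S : L2Bdry M.dom × EnergySpace M →L[ℂ] EnergySpace M)
      (A : L2Bdry M.dom × EnergySpace M →L[ℂ] L2Bdry M.dom),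
      ∀ c f, acousticRelation M V (S (c, f)) (f + z • S (c, f)) (A (c, f)) (A (c, f) + c) := by
  have hz0 : z ≠ 0 := by
    rintro rfl; simp at hz
  let E := WithLp 2 (EnergySpace M × L2Bdry M.dom)
  let F : E →L[ℂ] EnergySpace M := WithLp.fstL 2 ℂ _ _
  let B : E →L[ℂ] L2Bdry M.dom := WithLp.sndL 2 ℂ _ _
  let mkE : EnergySpace M × L2Bdry M.dom →L[ℂ] E :=
    ((WithLp.prodContinuousLinearEquiv 2 ℂ (EnergySpace M) (L2Bdry M.dom)).symm :
      EnergySpace M × L2Bdry M.dom →L[ℂ] E)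
  let T : E →L[ℂ] E :=
    mkE.comp (((diag M (Complex.I / z) (-(Complex.I * z))).comp F).prod B)
  -- The data of the problem: -(1/z)f_v comes from eliminating v, i f_p from the divergence
  -- equation, -c from the boundary.
  let ℓ : L2Bdry M.dom × EnergySpace M →L[ℂ] E :=
    mkE.comp (((diag M (-(1 / z)) Complex.I).comp (ContinuousLinearMap.snd ℂ _ _)).prod
      (-(ContinuousLinearMap.fst ℂ _ _)))
  have hre1 : (Complex.I / z).re = z.im / ‖z‖ ^ 2 := by
    rw [Complex.div_re, Complex.sq_norm]; simp
  have hre2 : (-(Complex.I * z)).re = z.im := by simp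
  have hnz : 0 < ‖z‖ := norm_pos_iff.2 hz0
  set c₀ := min (min (z.im / ‖z‖ ^ 2) z.im) 1 with hc₀
  have hc₀p : 0 < c₀ := lt_min (lt_min (by positivity) hz) one_pos
  have hcoer : ∀ w, c₀ * ‖w‖ ^ 2 ≤ (inner ℂ w (T w)).re := fun w => by
    have h1 : inner ℂ w (T w) = (Complex.I / z) * inner ℂ (diag M 1 0 w.fst) (diag M 1 0 w.fst) +
        (-(Complex.I * z)) * inner ℂ (diag M 0 1 w.fst) (diag M 0 1 w.fst) +
        inner ℂ w.snd w.snd := by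
      have : inner ℂ w (T w) = inner ℂ w.fst (diag M (Complex.I / z) (-(Complex.I * z)) w.fst) +
        inner ℂ w.snd w.snd := WithLp.prod_inner_apply _ _
      rw [this]
      simp [EnergySpace.inner_eq, inner_smul_right, -inner_self_eq_norm_sq_to_K]
    have h2 : ‖w‖ ^ 2 = ‖diag M 1 0 w.fst‖ ^ 2 + ‖diag M 0 1 w.fst‖ ^ 2 + ‖w.snd‖ ^ 2 := by
      rw [WithLp.prod_norm_sq_eq_of_L2, norm_sq_eq_diag]
    rw [h1, h2]
    simp only [inner_self_eq_norm_sq_to_K, Complex.add_re]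
    have h3 : ∀ (s : ℂ) (r : ℝ), (s * (RCLike.ofReal r : ℂ) ^ 2).re = s.re * r ^ 2 := fun s r => by
      change (s * (r : ℂ) ^ 2).re = _
      rw [← Complex.ofReal_pow, Complex.re_mul_ofReal]
    have h4 : ∀ r : ℝ, ((RCLike.ofReal r : ℂ) ^ 2).re = r ^ 2 := fun r => by
      have := h3 1 r
      simpa using this
    rw [h3, h3, h4, hre1, hre2]
    have k1 : c₀ ≤ z.im / ‖z‖ ^ 2 := (min_le_left _ _).trans (min_le_left _ _)
    have k2 : c₀ ≤ z.im := (min_le_left _ _).trans (min_le_right _ _)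
    have k3 : c₀ ≤ 1 := min_le_right _ _
    nlinarith [mul_le_mul_of_nonneg_right k1 (sq_nonneg ‖diag M 1 0 w.fst‖),
      mul_le_mul_of_nonneg_right k2 (sq_nonneg ‖diag M 0 1 w.fst‖),
      mul_le_mul_of_nonneg_right k3 (sq_nonneg ‖w.snd‖)]
  obtain ⟨L, hL⟩ := exists_solution_of_coercive (formDomain M V) isClosed_formDomain T hc₀p hcoer
  -- Recovers v from η and f; the pressure is kept.
  let S : L2Bdry M.dom × EnergySpace M →L[ℂ] EnergySpace M :=
    (diag M (-(Complex.I / z)) 1).comp (F.comp (L.comp ℓ)) -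
      (diag M (1 / z) 0).comp (ContinuousLinearMap.snd ℂ _ _)
  refine ⟨S, B.comp (L.comp ℓ), fun c f => ?_⟩
  obtain ⟨hW, hvar⟩ := hL (ℓ (c, f))
  set w := L (ℓ (c, f)) with hw
  have hvel : vel (S (c, f)) = -(Complex.I / z) • vel w.fst - (1 / z) • vel f := rfl
  have hpre : pre (S (c, f)) = pre w.fst := by
    change (1 : ℂ) • pre w.fst - (0 : ℂ) • pre f = _
    simp
  have hΘv : Complex.I • M.mulα (vel (f + z • S (c, f))) = M.mulα (vel w.fst) := by
    rw [← map_smul]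
    congr 1
    rw [map_add, map_smul, hvel, smul_sub, smul_smul, smul_smul, mul_one_div_cancel hz0, one_smul,
      add_sub_cancel, smul_smul]
    have : Complex.I * (z * -(Complex.I / z)) = 1 := by
      field_simp
      simp
    rw [this, one_smul]
  -- The variational equation rewritten as Green's identity. Test functions with k = 0 yield the
  -- divergence equation, and general k then identify b = a + c as the normal trace datum.
  have hkey : ∀ (q : L2 M.dom) (H : L2Vec M.dom) (k : L2Bdry M.dom), HasWeakGrad M.dom q H →
      IsTrace M.dom q (HHalf.fn (V k)) →
      inner ℂ H (vel (S (c, f))) + inner ℂ q (Complex.I • M.mulβ (pre (f + z • S (c, f)))) =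
        inner ℂ k (w.snd + c) := fun q H k hq hk => by
    obtain ⟨η, rfl, hmem⟩ := exists_mem_formDomain (V := V) hq hk
    have h1 := hvar _ hmem
    have h2 : inner ℂ (WithLp.toLp 2 (pair η q, k) : E) (T w) =
        inner ℂ (pair η q) (diag M (Complex.I / z) (-(Complex.I * z)) w.fst) + inner ℂ k w.snd :=
      WithLp.prod_inner_apply _ _
    have h3 : inner ℂ (WithLp.toLp 2 (pair η q, k) : E) (ℓ (c, f)) =
        inner ℂ (pair η q) (diag M (-(1 / z)) Complex.I f) + inner ℂ k (-c) :=
      WithLp.prod_inner_apply _ _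
    rw [h2, h3] at h1
    simp only [EnergySpace.inner_eq, vel_pair, pre_pair, vel_diag, pre_diag, map_smul,
      inner_smul_right, inner_neg_right] at h1
    rw [Medium.inner_mulα_left, hvel, map_add, map_smul, hpre]
    simp only [map_sub, map_add, map_smul, inner_sub_right, inner_add_right, inner_smul_right]
    linear_combination -h1
  have hdiv : HasWeakDiv M.dom (vel (S (c, f)))
      (Complex.I • M.mulβ (pre (f + z • S (c, f)))) := by
    refine hasWeakDiv_of_inner M.isOpen_dom fun q H hq h0 => ?_
    have := hkey q H 0 hq (by
      rw [map_zero]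
      exact h0)
    rwa [inner_zero_left] at this
  refine ⟨mem_maxGraph_iff.2 ⟨?_, hdiv⟩, ?_, dualFunctional V (w.snd + c), ⟨_, hdiv, ?_⟩,
    natAdjoint_dualFunctional _⟩
  · rw [hΘv, hpre]
    exact hW.1
  · rw [hpre]
    exact hW.2
  · intro p G g hp hg
    rw [dualFunctional_apply]
    exact (hkey p G (V.symm g) hp (by rwa [V.apply_symm_apply])).symm

/-- The graph norm controls p in H¹ and v in H(div). The trace theorem then bounds a, and duality
with a lifting bounds b. -/
theorem acousticRelation_bound (V : L2Bdry M.dom ≃L[ℂ] HHalf M.dom) (h₁ : TraceBounded M.dom)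
    (h₂ : TraceLifting M.dom) : ∃ C : ℝ, ∀ {Ψ Θ : EnergySpace M} {a b : L2Bdry M.dom},
      acousticRelation M V Ψ Θ a b → ‖a‖ + ‖b‖ ≤ C * (‖Ψ‖ + ‖Θ‖) := by
  obtain ⟨C₁, hC₁, h₁⟩ := h₁
  obtain ⟨C₂, hC₂, h₂⟩ := h₂
  let W : HHalf M.dom →L[ℂ] L2Bdry M.dom := V.symm
  let V' : L2Bdry M.dom →L[ℂ] HHalf M.dom := V
  let α' : EnergySpace M →L[ℂ] L2Vec M.dom := M.mulα.comp (velL M)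
  let β' : EnergySpace M →L[ℂ] L2 M.dom := M.mulβ.comp (preL M)
  refine ⟨‖W‖ * (C₁ * (‖preL M‖ + ‖α'‖)) + C₂ * ‖V'‖ * (‖velL M‖ + ‖β'‖), ?_⟩
  intro Ψ Θ a b h
  have hm := mem_maxGraph_iff.1 h.1
  have hΨ := norm_nonneg Ψ
  have hΘ := norm_nonneg Θ
  have ha : ‖a‖ ≤ ‖W‖ * (C₁ * (‖preL M‖ + ‖α'‖)) * (‖Ψ‖ + ‖Θ‖) := by
    calc ‖a‖ = ‖W (V a)‖ := by simp [W]
      _ ≤ ‖W‖ * ‖V a‖ := W.le_opNorm _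
      _ ≤ ‖W‖ * (C₁ * (‖pre Ψ‖ + ‖Complex.I • M.mulα (vel Θ)‖)) :=
        mul_le_mul_of_nonneg_left (h₁ _ _ _ hm.1 h.2.1) W.opNorm_nonneg
      _ ≤ ‖W‖ * (C₁ * ((‖preL M‖ + ‖α'‖) * (‖Ψ‖ + ‖Θ‖))) := by
        refine mul_le_mul_of_nonneg_left (mul_le_mul_of_nonneg_left ?_ hC₁) W.opNorm_nonneg
        rw [norm_smul, Complex.norm_I, one_mul]
        have k1 : ‖pre Ψ‖ ≤ ‖preL M‖ * ‖Ψ‖ := (preL M).le_opNorm Ψ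
        have k2 : ‖M.mulα (vel Θ)‖ ≤ ‖α'‖ * ‖Θ‖ := α'.le_opNorm Θ
        nlinarith [mul_nonneg (norm_nonneg (preL M)) hΘ, mul_nonneg (norm_nonneg α') hΨ]
      _ = _ := by ring
  have hb : ‖b‖ ≤ C₂ * ‖V'‖ * (‖velL M‖ + ‖β'‖) * (‖Ψ‖ + ‖Θ‖) := by
    -- Green's identity with a lifting of Vb computes ‖b‖²; since the lifting is bounded by ‖b‖, one
    -- factor cancels.
    obtain ⟨p, G, hp, hG, hle⟩ := h₂ (V b)
    have h3 := h.inner_eq hp hG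
    have hbb : ‖b‖ * ‖b‖ = ‖inner ℂ b b‖ := by
      rw [inner_self_eq_norm_sq_to_K, norm_pow, RCLike.norm_ofReal, abs_norm, sq]
    have h4 : ‖b‖ * ‖b‖ ≤ (‖p‖ + ‖G‖) * ((‖velL M‖ + ‖β'‖) * (‖Ψ‖ + ‖Θ‖)) := by
      calc ‖b‖ * ‖b‖ = ‖inner ℂ b b‖ := hbb
        _ ≤ ‖G‖ * ‖vel Ψ‖ + ‖p‖ * ‖M.mulβ (pre Θ)‖ := by
          rw [h3]
          refine (norm_add_le _ _).trans (add_le_add (norm_inner_le_norm _ _) ?_)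
          rw [norm_mul, Complex.norm_I, one_mul]
          exact norm_inner_le_norm _ _
        _ ≤ (‖p‖ + ‖G‖) * (‖vel Ψ‖ + ‖M.mulβ (pre Θ)‖) := by
          nlinarith [mul_nonneg (norm_nonneg p) (norm_nonneg (vel Ψ)),
            mul_nonneg (norm_nonneg G) (norm_nonneg (M.mulβ (pre Θ)))]
        _ ≤ _ := by
          refine mul_le_mul_of_nonneg_left ?_ (by positivity)
          have k1 : ‖vel Ψ‖ ≤ ‖velL M‖ * ‖Ψ‖ := (velL M).le_opNorm Ψ
          have k2 : ‖M.mulβ (pre Θ)‖ ≤ ‖β'‖ * ‖Θ‖ := β'.le_opNorm Θ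
          nlinarith [mul_nonneg (norm_nonneg (velL M)) hΘ, mul_nonneg (norm_nonneg β') hΨ]
    have h5 : ‖p‖ + ‖G‖ ≤ C₂ * ‖V'‖ * ‖b‖ := by
      refine hle.trans ?_
      rw [mul_assoc]
      exact mul_le_mul_of_nonneg_left (V'.le_opNorm b) hC₂
    rcases eq_or_ne b 0 with rfl | hb0
    · rw [norm_zero]; positivity
    have hbp : 0 < ‖b‖ := norm_pos_iff.2 hb0
    refine le_of_mul_le_mul_right ?_ hbp
    refine h4.trans ((mul_le_mul_of_nonneg_right h5 (by positivity)).trans (le_of_eq ?_))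
    ring
  rw [add_mul]
  exact add_le_add ha hb

/-- Time reversal: replacing v by -v anticommutes with `𝒜*`, because `𝒜*` exchanges the two
components. -/
theorem acousticRelation.flip {Ψ Θ : EnergySpace M} {a b : L2Bdry M.dom}
    (h : acousticRelation M V Ψ Θ a b) :
    acousticRelation M V (diag M (-1) 1 Ψ) (-(diag M (-1) 1 Θ)) a (-b) := by
  obtain ⟨h1, h2, η, h3, rfl⟩ := h
  have hm := mem_maxGraph_iff.1 h1
  refine ⟨mem_maxGraph_iff.2 ⟨?_, ?_⟩, ?_, (-1 : ℂ) • η, ?_, ?_⟩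
  · simpa using hm.1
  · simpa using hm.2.smul (-1)
  · simpa using h2
  · simpa using h3.smul (-1)
  · rw [natAdjoint_smul, neg_one_smul]

theorem boundarySystem_acoustic (V : L2Bdry M.dom ≃L[ℂ] HHalf M.dom) (h₁ : TraceBounded M.dom)
    (h₂ : TraceLifting M.dom) :
    BoundarySystem (acousticRelation M V) (diag M (-1) 1) where
  green := acousticRelation.green
  solvable := acousticRelation_solvable V
  bound := acousticRelation_bound V h₁ h₂
  flip := acousticRelation.flip
  flip_flip Ψ := EnergySpace.ext (by simp) (by simp)

/-- Rests on (K + 1)a + (K - 1)b = K(a + b) - (b - a), and on the bijectivity of V, by which every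
H^{1/2} trace is Va for a unique a. -/
theorem isRestriction_acousticOperator (V : L2Bdry M.dom ≃L[ℂ] HHalf M.dom)
    (K : L2Bdry M.dom →L[ℂ] L2Bdry M.dom) :
    IsRestriction (acousticRelation M V) K (acousticOperator M V K) := by
  have hfun : ∀ (x : EnergySpace M × EnergySpace M) (_ : x ∈ maxGraph M) (_ : x.fst = 0),
      x.snd = 0 := fun z hz h0 => maxGraph_functional M z hz h0
  have hbc : ∀ a b : L2Bdry M.dom, (K + 1) a + (K - 1) b = 0 ↔ K (a + b) = b - a := fun a b => by
    rw [← sub_eq_zero (a := K (a + b))]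
    have : (K + 1) a + (K - 1) b = K (a + b) - (b - a) := by
      simp [sub_eq_add_neg]
      abel
    rw [this]
  intro Ψ Θ
  constructor
  · rintro ⟨⟨⟨g, h, h1, h2, h3⟩, hd⟩, rfl⟩
    have hg := Submodule.mem_graph_toLinearPMap hfun ⟨Ψ, hd⟩
    refine ⟨V.symm g, natAdjoint V h, ⟨?_, ?_, h, h2, rfl⟩, (hbc _ _).1 h3⟩
    · convert! hg using 2
    · rwa [V.apply_symm_apply]
  · rintro ⟨a, b, ⟨h1, h2, h, h3, rfl⟩, h4⟩
    have hd : Ψ ∈ (maxOperator M).domain := ⟨(Ψ, Θ), h1, rfl⟩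
    have hb : Ψ ∈ boundaryCondition M V K :=
      ⟨V a, h, h2, h3, by rw [V.symm_apply_apply]; exact (hbc _ _).2 h4⟩
    refine ⟨⟨hb, hd⟩, ?_⟩
    have e1 : acousticOperator M V K ⟨Ψ, ⟨hb, hd⟩⟩ = maxOperator M ⟨Ψ, hd⟩ :=
      LinearPMap.domRestrict_apply rfl
    rw [e1]
    have hg := Submodule.mem_graph_toLinearPMap hfun ⟨Ψ, hd⟩
    have := maxGraph_functional M _ ((maxGraph M).sub_mem hg h1) (sub_self _)
    exact sub_eq_zero.1 this

end AcousticSystem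

end Acoustic

end

noncomputable section

namespace Acoustic

/-! ## The geometry of Lipschitz boundaries -/

section Geometry

open Metric

variable {d : ℕ}

/-- The circular cone with axis `ν` and aperture `s`. -/
def cone (ν : Sp d) (s : ℝ) : Set (Sp d) :=
  {h | ‖h - (inner ℝ ν h : ℝ) • ν‖ ≤ s * inner ℝ ν h}

theorem isClosed_cone (ν : Sp d) (s : ℝ) : IsClosed (cone ν s) := by
  refine isClosed_le ?_ ?_ <;> fun_prop

theorem smul_mem_cone {ν : Sp d} {s : ℝ} {h : Sp d} (hh : h ∈ cone ν s) {t : ℝ} (ht : 0 ≤ t) :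
    t • h ∈ cone ν s := by
  change ‖t • h - (inner ℝ ν (t • h) : ℝ) • ν‖ ≤ s * inner ℝ ν (t • h)
  rw [inner_smul_right, mul_smul, ← smul_sub, norm_smul, Real.norm_of_nonneg ht]
  have := mul_le_mul_of_nonneg_left (show ‖h - (inner ℝ ν h : ℝ) • ν‖ ≤ s * inner ℝ ν h from hh) ht
  linarith

theorem inner_nonneg_of_mem_cone {ν : Sp d} {s : ℝ} (hs : 0 < s) {h : Sp d} (hh : h ∈ cone ν s) :
    0 ≤ (inner ℝ ν h : ℝ) :=
  nonneg_of_mul_nonneg_right ((norm_nonneg _).trans hh) hs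

theorem norm_le_of_mem_cone {ν : Sp d} (hν : ‖ν‖ = 1) {s : ℝ} {h : Sp d}
    (hs : 0 < s) (hs1 : s ≤ 1) (hh : h ∈ cone ν s) : ‖h‖ ≤ 2 * inner ℝ ν h := by
  have h0 := inner_nonneg_of_mem_cone hs hh
  have h1 : ‖h‖ ≤ ‖h - (inner ℝ ν h : ℝ) • ν‖ + ‖(inner ℝ ν h : ℝ) • ν‖ := by
    simpa using norm_add_le (h - (inner ℝ ν h : ℝ) • ν) ((inner ℝ ν h : ℝ) • ν)
  rw [norm_smul, hν, mul_one, Real.norm_of_nonneg h0] at h1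
  have h2 : ‖h - (inner ℝ ν h : ℝ) • ν‖ ≤ s * inner ℝ ν h := hh
  nlinarith

theorem inner_le_norm_of_unit {ν : Sp d} (hν : ‖ν‖ = 1) (h : Sp d) :
    |(inner ℝ ν h : ℝ)| ≤ ‖h‖ := by
  simpa [hν] using abs_real_inner_le_norm ν h

/-- The orthogonal projection onto the hyperplane `ν^⊥`. -/
abbrev projPerp (ν : Sp d) : Sp d →L[ℝ] ((Submodule.span ℝ {ν})ᗮ : Submodule ℝ (Sp d)) :=
  ((Submodule.span ℝ {ν})ᗮ).orthogonalProjectionOnto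

theorem coe_projPerp {ν : Sp d} (hν : ‖ν‖ = 1) (x : Sp d) :
    (projPerp ν x : Sp d) = x - (inner ℝ ν x : ℝ) • ν := by
  rw [← Submodule.starProjection_unit_singleton ℝ hν x, ← Submodule.starProjection_orthogonal_val]
  rfl

theorem norm_projPerp {ν : Sp d} (hν : ‖ν‖ = 1) (x : Sp d) :
    ‖projPerp ν x‖ = ‖x - (inner ℝ ν x : ℝ) • ν‖ := by
  rw [← coe_projPerp hν]; rfl

theorem norm_projPerp_le (ν : Sp d) (x : Sp d) : ‖projPerp ν x‖ ≤ ‖x‖ :=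
  Submodule.norm_orthogonalProjectionOnto_apply_le _ x

theorem hausdorff_image_le {X Y : Type*} [EMetricSpace X] [MeasurableSpace X] [BorelSpace X]
    [EMetricSpace Y] [MeasurableSpace Y] [BorelSpace Y] {f : X → Y} {K : NNReal}
    (hf : LipschitzWith K f) (n : ℕ) (s : Set X) :
    (Measure.euclideanHausdorffMeasure n : Measure Y) (f '' s) ≤
      (K : ℝ≥0∞) ^ n * (Measure.euclideanHausdorffMeasure n : Measure X) s := by
  rw [Measure.euclideanHausdorffMeasure_def, Measure.euclideanHausdorffMeasure_def,
    Measure.smul_apply, Measure.smul_apply, ENNReal.smul_def, ENNReal.smul_def, smul_eq_mul,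
    smul_eq_mul, mul_left_comm]
  have := hf.hausdorffMeasure_image_le (d := n) (by positivity) s
  rw [ENNReal.rpow_natCast] at this
  exact mul_le_mul_right this _

theorem hausdorff_perp_eq_volume {ν : Sp d} (hν : ‖ν‖ = 1) (hd : 1 ≤ d) :
    (Measure.euclideanHausdorffMeasure (d - 1) :
      Measure ((Submodule.span ℝ {ν})ᗮ : Submodule ℝ (Sp d))) = volume := by
  have hf : Module.finrank ℝ ((Submodule.span ℝ {ν})ᗮ : Submodule ℝ (Sp d)) = d - 1 :=
    Submodule.finrank_orthogonal_span_singleton (_i := ⟨by simp; omega⟩) (by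
      rintro rfl; simp at hν)
  rw [← InnerProductSpace.euclideanHausdorffMeasure_eq_volume, hf]

theorem volume_closedBall_perp {ν : Sp d} (hν : ‖ν‖ = 1) (hd : 1 ≤ d)
    (x : ((Submodule.span ℝ {ν})ᗮ : Submodule ℝ (Sp d))) {t : ℝ} (ht : 0 ≤ t) :
    volume (closedBall x t) = ENNReal.ofReal (t ^ (d - 1)) *
      volume (ball (0 : ((Submodule.span ℝ {ν})ᗮ : Submodule ℝ (Sp d))) 1) := by
  have hf : Module.finrank ℝ ((Submodule.span ℝ {ν})ᗮ : Submodule ℝ (Sp d)) = d - 1 :=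
    Submodule.finrank_orthogonal_span_singleton (_i := ⟨by simp; omega⟩) (by
      rintro rfl; simp at hν)
  rw [Measure.addHaar_closedBall _ _ ht, hf]

/-- A piece `S` of the boundary of `O` with a uniform interior cone condition and the upper
regularity of the surface measure. -/
structure IsRegularPatch (O S : Set (Sp d)) (ν : Sp d) (s ρ κ : ℝ) (C : ℝ≥0∞) : Prop where
  norm_eq : ‖ν‖ = 1
  s_pos : 0 < s
  s_le : s ≤ 1
  ρ_pos : 0 < ρ
  κ_pos : 0 < κ
  C_ne_top : C ≠ ∞
  sub_mem : ∀ x ∈ S, ∀ h ∈ cone ν s, h ≠ 0 → ‖h‖ < ρ → x - h ∈ O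
  le_norm : ∀ x ∈ S, ∀ y ∈ S, ∀ h ∈ cone ν s, ‖h‖ < ρ → κ * ‖h‖ ≤ ‖y - (x - h)‖
  measure_le : ∀ x t, 0 ≤ t →
    surfaceMeasure O (S ∩ closedBall x t) ≤ C * ENNReal.ofReal (t ^ (d - 1))

/-- The graph map `w ↦ w + φ(w) ν`. -/
def graphMap (ν : Sp d) (φ : ((Submodule.span ℝ {ν})ᗮ : Submodule ℝ (Sp d)) → ℝ)
    (w : ((Submodule.span ℝ {ν})ᗮ : Submodule ℝ (Sp d))) : Sp d := (w : Sp d) + φ w • ν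

section Chart

variable {ν : Sp d} {φ : ((Submodule.span ℝ {ν})ᗮ : Submodule ℝ (Sp d)) → ℝ} {L : NNReal}

theorem lipschitz_graphMap (hν : ‖ν‖ = 1) (hφ : LipschitzWith L φ) :
    LipschitzWith (1 + L) (graphMap ν φ) := by
  refine LipschitzWith.of_dist_le_mul fun w w' => ?_
  have h1 := hφ.dist_le_mul w w'
  have h2 : graphMap ν φ w - graphMap ν φ w' = ((w - w' : _) : Sp d) + (φ w - φ w') • ν := by
    simp only [graphMap, Submodule.coe_sub, sub_smul]; abel
  rw [dist_eq_norm, h2, NNReal.coe_add, NNReal.coe_one, add_mul, one_mul]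
  refine (norm_add_le _ _).trans (add_le_add ?_ ?_)
  · rw [dist_eq_norm]; rfl
  · rw [norm_smul, hν, mul_one]
    exact h1

theorem inner_coe_perp (w : ((Submodule.span ℝ {ν})ᗮ : Submodule ℝ (Sp d))) :
    (inner ℝ ν (w : Sp d) : ℝ) = 0 :=
  Submodule.mem_orthogonal_singleton_iff_inner_right.1 w.2

theorem inner_graphMap (hν : ‖ν‖ = 1) (w : ((Submodule.span ℝ {ν})ᗮ : Submodule ℝ (Sp d))) :
    (inner ℝ ν (graphMap ν φ w) : ℝ) = φ w := by
  rw [graphMap, inner_add_right, inner_coe_perp, inner_smul_right, real_inner_self_eq_norm_sq, hν]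
  ring

theorem projPerp_graphMap (hν : ‖ν‖ = 1)
    (w : ((Submodule.span ℝ {ν})ᗮ : Submodule ℝ (Sp d))) :
    projPerp ν (graphMap ν φ w) = w := by
  refine Subtype.ext ?_
  rw [coe_projPerp hν, inner_graphMap hν, graphMap, add_sub_cancel_right]

theorem graphMap_projPerp (hν : ‖ν‖ = 1) {x : Sp d} (hx : (inner ℝ ν x : ℝ) = φ (projPerp ν x)) :
    graphMap ν φ (projPerp ν x) = x := by
  rw [graphMap, coe_projPerp hν, ← hx, sub_add_cancel]

variable {O : Set (Sp d)} {x₀ : Sp d} {r : ℝ}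

/-- A point strictly above the graph has a neighbourhood free of O, and one strictly below belongs
to the open set O. -/
theorem inner_eq_of_mem_frontier (hO : IsOpen O) (hφ : LipschitzWith L φ)
    (h : ∀ x ∈ ball x₀ r, x ∈ O ↔ (inner ℝ ν x : ℝ) < φ (projPerp ν x))
    {y : Sp d} (hy : y ∈ frontier O) (hyr : y ∈ ball x₀ r) :
    (inner ℝ ν y : ℝ) = φ (projPerp ν y) := by
  rw [hO.frontier_eq] at hy
  refine le_antisymm ?_ (not_lt.1 fun hlt => hy.2 ((h y hyr).2 hlt))
  by_contra hcon
  have hopen : IsOpen {x | φ (projPerp ν x) < (inner ℝ ν x : ℝ)} :=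
    isOpen_lt (hφ.continuous.comp (projPerp ν).continuous) (by fun_prop)
  obtain ⟨z, ⟨hz1, hz2⟩, hz3⟩ := mem_closure_iff.1 hy.1 _ (hopen.inter isOpen_ball)
    ⟨not_le.1 hcon, hyr⟩
  exact absurd ((h z hz2).1 hz3) (not_lt.2 (le_of_lt hz1))

/-- Descending from the graph in direction -ν enters O at once. -/
theorem mem_frontier_of_inner_eq (hO : IsOpen O) (hν : ‖ν‖ = 1)
    (h : ∀ x ∈ ball x₀ r, x ∈ O ↔ (inner ℝ ν x : ℝ) < φ (projPerp ν x))
    {y : Sp d} (hyr : y ∈ ball x₀ r) (hy : (inner ℝ ν y : ℝ) = φ (projPerp ν y)) :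
    y ∈ frontier O := by
  rw [hO.frontier_eq]
  refine ⟨?_, fun hyO => ((h y hyr).1 hyO).ne hy⟩
  have hcont : Continuous fun t : ℝ => y - t • ν := by fun_prop
  have hlim : Tendsto (fun t : ℝ => y - t • ν) (𝓝[>] 0) (𝓝 y) := by
    have := hcont.tendsto 0
    simp only [zero_smul, sub_zero] at this
    exact this.mono_left nhdsWithin_le_nhds
  refine mem_closure_of_tendsto hlim ?_
  filter_upwards [hlim.eventually (isOpen_ball.mem_nhds hyr), self_mem_nhdsWithin] with t ht ht0
  refine (h _ ht).2 ?_
  have e1 : (inner ℝ ν (y - t • ν) : ℝ) = inner ℝ ν y - t := by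
    rw [inner_sub_right, inner_smul_right, real_inner_self_eq_norm_sq, hν]; ring
  have e2 : projPerp ν (y - t • ν) = projPerp ν y := by
    refine Subtype.ext ?_
    rw [coe_projPerp hν, coe_projPerp hν, e1, sub_smul]; abel
  rw [e1, e2, ← hy]
  have : (0 : ℝ) < t := ht0
  linarith

/-- A cone narrow compared with the Lipschitz constant descends faster than the graph can. The
measure bound holds since the patch is the image of its projection under the (1 + L)-Lipschitz graph
map. -/
theorem exists_regularPatch_of_chart (hd : 1 ≤ d) (hO : IsOpen O) (hν : ‖ν‖ = 1)
    (hφ : LipschitzWith L φ) (hr : 0 < r)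
    (h : ∀ x ∈ ball x₀ r, x ∈ O ↔ (inner ℝ ν x : ℝ) < φ (projPerp ν x)) :
    ∃ s κ C, IsRegularPatch O (frontier O ∩ ball x₀ (r / 2)) ν s (r / 2) κ C := by
  have hL : (0 : ℝ) ≤ L := L.2
  -- Chosen so that L s ≤ 1/2: the graph moves by at most half of the axial component of h.
  set s : ℝ := 1 / (2 * (1 + L)) with hs
  have hsp : 0 < s := by positivity
  have hLs : L * s ≤ 1 / 2 := by
    rw [hs, mul_one_div, div_le_iff₀ (by positivity)]; linarith
  have hs1 : s ≤ 1 := by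
    rw [hs, div_le_iff₀ (by positivity)]; linarith
  have hsub : ball x₀ (r / 2) ⊆ ball x₀ r := ball_subset_ball (by linarith)
  have hlip : ∀ w w', |φ w - φ w'| ≤ L * ‖w - w'‖ := fun w w' => by
    simpa [dist_eq_norm, Real.dist_eq] using hφ.dist_le_mul w w'
  have hht : ∀ x ∈ frontier O ∩ ball x₀ (r / 2), ∀ k ∈ cone ν s,
      (inner ℝ ν (x - k) : ℝ) ≤ φ (projPerp ν (x - k)) - inner ℝ ν k / 2 := fun x hx k hk => by
    have h1 := inner_eq_of_mem_frontier hO hφ h hx.1 (hsub hx.2)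
    have h2 := hlip (projPerp ν x) (projPerp ν (x - k))
    rw [← map_sub, sub_sub_cancel, norm_projPerp hν] at h2
    have h3 : ‖k - (inner ℝ ν k : ℝ) • ν‖ ≤ s * inner ℝ ν k := hk
    have h4 := (le_abs_self _).trans h2
    have h5 := inner_nonneg_of_mem_cone hsp hk
    rw [inner_sub_right, h1]
    have h6 : L * ‖k - (inner ℝ ν k : ℝ) • ν‖ ≤ 1 / 2 * inner ℝ ν k :=
      (mul_le_mul_of_nonneg_left h3 hL).trans (by
        rw [← mul_assoc]
        exact mul_le_mul_of_nonneg_right hLs h5)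
    linarith
  -- The depth of x - h below the graph is at least half of ⟨ν, h⟩, hence at least ‖h‖/4, and the
  -- signed height over the graph is (1 + L)-Lipschitz; this gives κ.
  refine ⟨s, 1 / (4 * (1 + L)), ((1 + L : NNReal) : ℝ≥0∞) ^ (d - 1) *
    volume (ball (0 : ((Submodule.span ℝ {ν})ᗮ : Submodule ℝ (Sp d))) 1), hν, hsp, hs1, by linarith,
    by positivity, ?_, ?_, ?_, ?_⟩
  · exact ENNReal.mul_ne_top (ENNReal.pow_ne_top ENNReal.coe_ne_top) measure_ball_lt_top.ne
  · intro x hx k hk hk0 hkr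
    have hmem : x - k ∈ ball x₀ r := by
      have h1 := mem_ball_iff_norm.1 hx.2
      rw [mem_ball_iff_norm]
      calc ‖x - k - x₀‖ = ‖(x - x₀) - k‖ := by congr 1; abel
        _ ≤ ‖x - x₀‖ + ‖k‖ := norm_sub_le _ _
        _ < r := by linarith
    refine (h _ hmem).2 ?_
    have h1 := hht x hx k hk
    have h2 := norm_le_of_mem_cone hν hsp hs1 hk
    have h3 := norm_pos_iff.2 hk0
    linarith
  · intro x hx y hy k hk hkr
    have h1 := hht x hx k hk
    have h2 := norm_le_of_mem_cone hν hsp hs1 hk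
    have h3 := inner_eq_of_mem_frontier hO hφ h hy.1 (hsub hy.2)
    have h4 := (abs_le.1 (hlip (projPerp ν y) (projPerp ν (x - k)))).1
    rw [← map_sub] at h4
    have h5 := norm_projPerp_le ν (y - (x - k))
    have h6 := (le_abs_self _).trans (inner_le_norm_of_unit hν (y - (x - k)))
    rw [inner_sub_right, h3] at h6
    rw [div_mul_eq_mul_div, one_mul, div_le_iff₀ (by positivity)]
    nlinarith [mul_le_mul_of_nonneg_left h5 hL]
  · intro x t ht
    set S := frontier O ∩ ball x₀ (r / 2) ∩ closedBall x t with hS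
    have h1 : S = graphMap ν φ '' (projPerp ν '' S) := by
      rw [Set.image_image]
      refine (Set.image_congr fun y hy => ?_).trans (Set.image_id S) |>.symm
      exact graphMap_projPerp hν (inner_eq_of_mem_frontier hO hφ h hy.1.1 (hsub hy.1.2))
    have h2 : projPerp ν '' S ⊆ closedBall (projPerp ν x) t := by
      rintro _ ⟨y, hy, rfl⟩
      rw [mem_closedBall_iff_norm, ← map_sub]
      exact (norm_projPerp_le ν _).trans (mem_closedBall_iff_norm.1 hy.2)
    calc surfaceMeasure O S ≤ Measure.euclideanHausdorffMeasure (d - 1) S :=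
          Measure.restrict_apply_le _ _
      _ ≤ ((1 + L : NNReal) : ℝ≥0∞) ^ (d - 1) *
          Measure.euclideanHausdorffMeasure (d - 1) (projPerp ν '' S) := by
        conv_lhs => rw [h1]
        exact hausdorff_image_le (lipschitz_graphMap hν hφ) _ _
      _ ≤ ((1 + L : NNReal) : ℝ≥0∞) ^ (d - 1) * volume (closedBall (projPerp ν x) t) := by
        rw [hausdorff_perp_eq_volume hν hd]
        exact mul_le_mul_right (measure_mono h2) _
      _ = _ := by
        rw [volume_closedBall_perp hν hd _ ht]
        ring

/-- The projection to the hyperplane does not increase Hausdorff measure, and the projection of the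
boundary in a ball of radius t covers a disc of radius t/(1 + L). -/
theorem exists_lower_of_chart (hd : 1 ≤ d) (hO : IsOpen O) (hν : ‖ν‖ = 1)
    (hφ : LipschitzWith L φ)
    (h : ∀ x ∈ ball x₀ r, x ∈ O ↔ (inner ℝ ν x : ℝ) < φ (projPerp ν x)) :
    ∃ c : ℝ, 0 < c ∧ ∀ y ∈ frontier O ∩ ball x₀ (r / 2), ∀ t, 0 < t → t ≤ r / 2 →
      ENNReal.ofReal (c * t ^ (d - 1)) ≤ surfaceMeasure O (closedBall y t) := by
  have hL : (0 : ℝ) ≤ L := L.2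
  set B := ball (0 : ((Submodule.span ℝ {ν})ᗮ : Submodule ℝ (Sp d))) 1
  have hB0 : 0 < (volume B).toReal :=
    ENNReal.toReal_pos (measure_ball_pos _ _ one_pos).ne' measure_ball_lt_top.ne
  refine ⟨(1 / (1 + L)) ^ (d - 1) * (volume B).toReal, by positivity, fun y hy t ht htr => ?_⟩
  set t' : ℝ := t / (1 + L) with ht'
  have ht'0 : 0 ≤ t' := by positivity
  have hyg := inner_eq_of_mem_frontier hO hφ h hy.1
    (ball_subset_ball (by linarith) hy.2)
  have hsub : closedBall (projPerp ν y) t' ⊆ projPerp ν '' (frontier O ∩ closedBall y t) := by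
    intro w hw
    have h1 : dist (graphMap ν φ w) y ≤ t := by
      have := (lipschitz_graphMap hν hφ).dist_le_mul w (projPerp ν y)
      rw [graphMap_projPerp hν hyg] at this
      refine this.trans ?_
      have h2 := mem_closedBall.1 hw
      rw [ht', le_div_iff₀ (by positivity)] at h2
      simpa [mul_comm] using h2
    refine ⟨graphMap ν φ w, ⟨mem_frontier_of_inner_eq hO hν h ?_ ?_, h1⟩, projPerp_graphMap hν w⟩
    · have h3 := mem_ball.1 hy.2
      rw [mem_ball]
      linarith [dist_triangle (graphMap ν φ w) y x₀]
    · rw [inner_graphMap hν, projPerp_graphMap hν]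
  have h1 : volume (closedBall (projPerp ν y) t') ≤ surfaceMeasure O (closedBall y t) := by
    rw [← hausdorff_perp_eq_volume hν hd, surfaceMeasure,
      Measure.restrict_apply isClosed_closedBall.measurableSet, Set.inter_comm]
    refine (measure_mono hsub).trans ?_
    have := hausdorff_image_le (K := 1)
      (((Submodule.span ℝ {ν})ᗮ).lipschitzWith_orthogonalProjectionOnto) (d - 1)
      (frontier O ∩ closedBall y t)
    simpa using this
  refine le_trans (le_of_eq ?_) h1
  have hB : volume B = ENNReal.ofReal (volume B).toReal :=
    (ENNReal.ofReal_toReal measure_ball_lt_top.ne).symm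
  rw [volume_closedBall_perp hν hd _ ht'0]
  change _ = _ * volume B
  conv_rhs => rw [hB]
  rw [← ENNReal.ofReal_mul (by positivity), ht']
  congr 1
  rw [div_pow, div_pow, one_pow]
  ring

end Chart

variable {O : Set (Sp d)}

theorem isCompact_frontier_of_isBounded (hb : Bornology.IsBounded O) : IsCompact (frontier O) :=
  isCompact_of_isClosed_isBounded isClosed_frontier
    (hb.closure.subset frontier_subset_closure)

/-- The boundary of a bounded Lipschitz domain is covered by finitely many regular patches. -/
theorem exists_finite_regularPatches (hd : 1 ≤ d) (hO : IsOpen O) (hb : Bornology.IsBounded O)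
    (hL : HasLipschitzBoundary O) : ∃ (t : Finset (Sp d)) (ρ : Sp d → ℝ),
      (∀ x₀ ∈ t, 0 < ρ x₀ ∧ ∃ ν s κ C, IsRegularPatch O (frontier O ∩ ball x₀ (ρ x₀)) ν s (ρ x₀) κ C)
        ∧ frontier O ⊆ ⋃ x₀ ∈ t, ball x₀ (ρ x₀ / 2) := by
  have h : ∀ x₀, ∃ ρ : ℝ, 0 < ρ ∧ (x₀ ∈ frontier O →
      ∃ ν s κ C, IsRegularPatch O (frontier O ∩ ball x₀ ρ) ν s ρ κ C) := fun x₀ => by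
    by_cases hx : x₀ ∈ frontier O
    · obtain ⟨ν, φ, L, r, hν, hφ, hr, hc⟩ := hL x₀ hx
      obtain ⟨s, κ, C, hp⟩ := exists_regularPatch_of_chart hd hO hν hφ hr hc
      exact ⟨r / 2, by linarith, fun _ => ⟨ν, s, κ, C, hp⟩⟩
    · exact ⟨1, one_pos, fun h => absurd h hx⟩
  choose ρ hρ h using h
  -- Balls of half radius already cover, so two sufficiently close boundary points always lie in one
  -- common patch.
  obtain ⟨t, ht, hcov⟩ := (isCompact_frontier_of_isBounded hb).elim_nhds_subcover
    (fun x => ball x (ρ x / 2)) fun x _ => ball_mem_nhds x (by linarith [hρ x])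
  exact ⟨t, ρ, fun x hx => ⟨hρ x, h x (ht x hx)⟩, hcov⟩

theorem surfaceMeasure_compl_frontier : surfaceMeasure O (frontier O)ᶜ = 0 := by
  rw [surfaceMeasure, Measure.restrict_apply isClosed_frontier.measurableSet.compl]
  simp

theorem surfaceMeasure_lt_top (hd : 1 ≤ d) (hO : IsOpen O) (hb : Bornology.IsBounded O)
    (hL : HasLipschitzBoundary O) : surfaceMeasure O Set.univ < ∞ := by
  obtain ⟨t, ρ, h, hcov⟩ := exists_finite_regularPatches hd hO hb hL
  have h1 : surfaceMeasure O Set.univ ≤ surfaceMeasure O (frontier O) := by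
    rw [← Set.union_compl_self (frontier O)]
    refine (measure_union_le _ _).trans ?_
    rw [surfaceMeasure_compl_frontier, add_zero]
  refine h1.trans_lt ?_
  have h2 : frontier O ⊆ ⋃ x₀ ∈ t, frontier O ∩ ball x₀ (ρ x₀) ∩ closedBall x₀ (ρ x₀) := by
    intro x hx
    obtain ⟨x₀, hx₀, hxb⟩ := Set.mem_iUnion₂.1 (hcov hx)
    have h3 : x ∈ ball x₀ (ρ x₀) := ball_subset_ball (by linarith [(h x₀ hx₀).1]) hxb
    exact Set.mem_iUnion₂.2 ⟨x₀, hx₀, ⟨hx, h3⟩, ball_subset_closedBall h3⟩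
  refine (measure_mono h2).trans_lt ((measure_biUnion_finset_le _ _).trans_lt ?_)
  refine ENNReal.sum_lt_top.2 fun x₀ hx₀ => ?_
  obtain ⟨hρ, ν, s, κ, C, hp⟩ := h x₀ hx₀
  exact (hp.measure_le x₀ (ρ x₀) hρ.le).trans_lt
    (ENNReal.mul_lt_top hp.C_ne_top.lt_top ENNReal.ofReal_lt_top)

/-- The lower regularity of the surface measure. -/
theorem exists_lower_regularity (hd : 1 ≤ d) (hO : IsOpen O) (hb : Bornology.IsBounded O)
    (hL : HasLipschitzBoundary O) (R : ℝ) : ∃ c : ℝ, 0 < c ∧ ∀ y ∈ frontier O, ∀ t, 0 < t →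
      t ≤ R → ENNReal.ofReal (c * t ^ (d - 1)) ≤ surfaceMeasure O (closedBall y t) := by
  have h : ∀ x₀, ∃ ρ c : ℝ, 0 < ρ ∧ 0 < c ∧ (x₀ ∈ frontier O →
      ∀ y ∈ frontier O ∩ ball x₀ ρ, ∀ t, 0 < t → t ≤ ρ →
        ENNReal.ofReal (c * t ^ (d - 1)) ≤ surfaceMeasure O (closedBall y t)) := fun x₀ => by
    by_cases hx : x₀ ∈ frontier O
    · obtain ⟨ν, φ, L, r, hν, hφ, hr, hc⟩ := hL x₀ hx
      obtain ⟨c, hc0, hp⟩ := exists_lower_of_chart hd hO hν hφ hc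
      exact ⟨r / 2, c, by linarith, hc0, fun _ => hp⟩
    · exact ⟨1, 1, one_pos, one_pos, fun h => absurd h hx⟩
  choose ρ c hρ hc h using h
  obtain ⟨T, hT, hcov⟩ := (isCompact_frontier_of_isBounded hb).elim_nhds_subcover
    (fun x => ball x (ρ x)) fun x _ => ball_mem_nhds x (hρ x)
  rcases T.eq_empty_or_nonempty with rfl | hne
  · refine ⟨1, one_pos, fun y hy => ?_⟩
    have := hcov hy
    simp at this
  have hR1 : 0 < max R 1 := lt_max_of_lt_right one_pos
  -- on each patch, radii above `ρ` are handled by shrinking the ball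
  let b : Sp d → ℝ := fun x => c x * (min 1 (ρ x / max R 1)) ^ (d - 1)
  have hbp : ∀ x, 0 < b x := fun x =>
    mul_pos (hc x) (pow_pos (lt_min one_pos (div_pos (hρ x) hR1)) _)
  obtain ⟨x₁, hx₁, hmin⟩ := T.exists_min_image b hne
  refine ⟨b x₁, hbp x₁, fun y hy t ht htR => ?_⟩
  obtain ⟨x, hx, hyx⟩ := Set.mem_iUnion₂.1 (hcov hy)
  set m := min 1 (ρ x / max R 1) with hm
  have hm0 : 0 < m := lt_min one_pos (div_pos (hρ x) hR1)
  have h1 : t * m ≤ ρ x := by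
    have h2 : m ≤ ρ x / max R 1 := min_le_right _ _
    rw [le_div_iff₀ hR1] at h2
    have h3 : t ≤ max R 1 := htR.trans (le_max_left _ _)
    nlinarith
  have h2 : t * m ≤ t := mul_le_of_le_one_right ht.le (min_le_left _ _)
  refine le_trans (ENNReal.ofReal_le_ofReal ?_) ((h x (hT x hx) y ⟨hy, hyx⟩ (t * m)
    (mul_pos ht hm0) h1).trans (measure_mono (closedBall_subset_closedBall h2)))
  calc b x₁ * t ^ (d - 1) ≤ b x * t ^ (d - 1) :=
        mul_le_mul_of_nonneg_right (hmin x hx) (by positivity)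
    _ = c x * (t * m) ^ (d - 1) := by
        change c x * m ^ (d - 1) * _ = _
        rw [mul_pow]; ring

end Geometry

end Acoustic

end

noncomputable section

namespace Acoustic

/-! ## Boundedness of the trace operator -/

theorem sq_lintegral_mul_le {X : Type*} [MeasurableSpace X] {μ : Measure X} {f g : X → ℝ≥0∞}
    (hf : AEMeasurable f μ) (hg : AEMeasurable g μ) :
    (∫⁻ x, f x * g x ∂μ) ^ 2 ≤ (∫⁻ x, f x ^ 2 ∂μ) * ∫⁻ x, g x ^ 2 ∂μ := by
  have h := ENNReal.lintegral_mul_le_Lp_mul_Lq μ Real.HolderConjugate.two_two hf hg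
  have h2 := pow_le_pow_left₀ (zero_le) h 2
  have e : ∀ a : ℝ≥0∞, (a ^ (1 / 2 : ℝ)) ^ 2 = a := fun a => by
    rw [← ENNReal.rpow_natCast, ← ENNReal.rpow_mul]; norm_num
  rw [mul_pow, e, e] at h2
  simpa using h2

theorem sq_lintegral_le {X : Type*} [MeasurableSpace X] {μ : Measure X} {f : X → ℝ≥0∞}
    (hf : AEMeasurable f μ) : (∫⁻ x, f x ∂μ) ^ 2 ≤ μ Set.univ * ∫⁻ x, f x ^ 2 ∂μ := by
  simpa using sq_lintegral_mul_le (f := fun _ => 1) aemeasurable_const hf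

theorem enorm_add_sq_le {F : Type*} [NormedAddCommGroup F] (a b : F) :
    ‖a + b‖ₑ ^ 2 ≤ 2 * (‖a‖ₑ ^ 2 + ‖b‖ₑ ^ 2) := by
  have h : ‖a + b‖ ^ 2 ≤ 2 * (‖a‖ ^ 2 + ‖b‖ ^ 2) := by
    nlinarith [norm_add_le a b, norm_nonneg (a + b), sq_nonneg (‖a‖ - ‖b‖)]
  have := ENNReal.ofReal_le_ofReal h
  rw [ENNReal.ofReal_mul (by norm_num), ENNReal.ofReal_add (by positivity) (by positivity),
    ENNReal.ofReal_pow (norm_nonneg _), ENNReal.ofReal_pow (norm_nonneg _),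
    ENNReal.ofReal_pow (norm_nonneg _)] at this
  simpa [ofReal_norm] using this

/-! ### Differences of smooth functions along segments -/

section SmoothFunctions

open scoped ContDiff

variable {d : ℕ} {u : Sp d → ℂ}

theorem norm_fderiv_le_classicalGrad (u : Sp d → ℂ) (x v : Sp d) :
    ‖fderiv ℝ u x v‖ ≤ ‖classicalGrad u x‖ * ‖v‖ := by
  have hv : v = ∑ i, v i • EuclideanSpace.single i (1 : ℝ) := by
    ext j; simp [Finset.sum_apply, Pi.single_apply]
  let w : EuclideanSpace ℂ (Fin d) := WithLp.toLp 2 fun i => (v i : ℂ)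
  have hw : ‖w‖ = ‖v‖ := by
    simp [w, EuclideanSpace.norm_eq]
  have h : fderiv ℝ u x v = inner ℂ w (classicalGrad u x) := by
    conv_lhs => rw [hv]
    rw [map_sum, PiLp.inner_apply]
    refine Finset.sum_congr rfl fun i _ => ?_
    simp [w, classicalGrad, partialD, mul_comm]
  rw [h, ← hw, mul_comm]
  exact norm_inner_le_norm _ _

/-- The segment is run through as x - t²h. With linear speed the later scaling argument would leave
the divergent integral of 1/t; the quadratic speed supplies the weight 4t² that compensates. -/
theorem enorm_sub_sq_le_lintegral (hu : ContDiff ℝ ∞ u) (x h : Sp d) :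
    ‖u x - u (x - h)‖ₑ ^ 2 ≤ ∫⁻ t in Set.Ioc (0 : ℝ) 1,
      ENNReal.ofReal (4 * t ^ 2) * ‖h‖ₑ ^ 2 * ‖classicalGrad u (x - t ^ 2 • h)‖ₑ ^ 2 := by
  let f' : ℝ → ℂ := fun t => fderiv ℝ u (x - t ^ 2 • h) (-((2 * t) • h))
  have hf' : ∀ t : ℝ, HasDerivAt (fun t : ℝ => u (x - t ^ 2 • h)) (f' t) t := fun t => by
    have h1 : HasDerivAt (fun t : ℝ => x - t ^ 2 • h) (-((2 * t) • h)) t := by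
      simpa using ((hasDerivAt_pow 2 t).smul_const h).const_sub x
    exact ((hu.differentiable (by simp)) _).hasFDerivAt.comp_hasDerivAt t h1
  have hc : Continuous f' :=
    ((hu.continuous_fderiv (by simp)).comp (by fun_prop)).clm_apply (by fun_prop)
  have hi := intervalIntegral.integral_eq_sub_of_hasDerivAt (a := 0) (b := 1)
    (fun t _ => hf' t) (hc.intervalIntegrable _ _)
  rw [intervalIntegral.integral_of_le zero_le_one] at hi
  have h1 : ‖u x - u (x - h)‖ₑ ≤ ∫⁻ t in Set.Ioc (0 : ℝ) 1, ‖f' t‖ₑ := by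
    rw [← enorm_neg]
    refine le_trans (le_of_eq ?_) (enorm_integral_le_lintegral_enorm f')
    rw [hi]; simp
  refine (pow_le_pow_left₀ zero_le h1 2).trans ((sq_lintegral_le hc.enorm.aemeasurable).trans ?_)
  rw [Measure.restrict_apply MeasurableSet.univ]
  simp only [Set.univ_inter, Real.volume_Ioc, sub_zero, ENNReal.ofReal_one, one_mul]
  refine lintegral_mono fun t => ?_
  have h2 := norm_fderiv_le_classicalGrad u (x - t ^ 2 • h) (-((2 * t) • h))
  rw [norm_neg, norm_smul] at h2
  have h3 : ‖f' t‖ ^ 2 ≤ 4 * t ^ 2 * ‖h‖ ^ 2 * ‖classicalGrad u (x - t ^ 2 • h)‖ ^ 2 := by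
    refine (pow_le_pow_left₀ (norm_nonneg _) h2 2).trans (le_of_eq ?_)
    rw [mul_pow, mul_pow, Real.norm_eq_abs, sq_abs]; ring
  have h4 := ENNReal.ofReal_le_ofReal h3
  rwa [ENNReal.ofReal_mul (by positivity), ENNReal.ofReal_mul (by positivity),
    ENNReal.ofReal_pow (norm_nonneg _), ENNReal.ofReal_pow (norm_nonneg _),
    ENNReal.ofReal_pow (norm_nonneg _), ofReal_norm, ofReal_norm, ofReal_norm] at h4

end SmoothFunctions

/-! ### A Hardy-type inequality on interior cones -/

section Cone

open Metric

variable {d : ℕ}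

/-- The truncated cone without its vertex. -/
def truncCone (ν : Sp d) (s ρ : ℝ) : Set (Sp d) := (cone ν s ∩ ball 0 ρ) \ {0}

theorem measurableSet_truncCone (ν : Sp d) (s ρ : ℝ) : MeasurableSet (truncCone ν s ρ) :=
  ((isClosed_cone ν s).measurableSet.inter isOpen_ball.measurableSet).diff
    (measurableSet_singleton 0)

theorem mem_truncCone {ν : Sp d} {s ρ : ℝ} {h : Sp d} :
    h ∈ truncCone ν s ρ ↔ h ∈ cone ν s ∧ ‖h‖ < ρ ∧ h ≠ 0 := by
  simp [truncCone, and_assoc]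

theorem smul_mem_truncCone {ν : Sp d} {s ρ a : ℝ} {h : Sp d} (ha : 0 < a) (ha1 : a ≤ 1)
    (hh : h ∈ truncCone ν s ρ) : a • h ∈ truncCone ν s ρ := by
  rw [mem_truncCone] at hh ⊢
  refine ⟨smul_mem_cone hh.1 ha.le, ?_, smul_ne_zero ha.ne' hh.2.2⟩
  rw [norm_smul, Real.norm_of_nonneg ha.le]
  exact (mul_le_of_le_one_left (norm_nonneg _) ha1).trans_lt hh.2.1

theorem lintegral_comp_smul_eq {a : ℝ} (ha : 0 < a) {H : Sp d → ℝ≥0∞} (hH : Measurable H) :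
    ∫⁻ h, H (a • h) = ENNReal.ofReal ((a ^ d)⁻¹) * ∫⁻ h, H h := by
  have h1 : ∫⁻ h, H (a • h) = ∫⁻ y, H y ∂(Measure.map (a • ·) (volume : Measure (Sp d))) :=
    (lintegral_map hH (measurable_const_smul a)).symm
  rw [h1, Measure.map_addHaar_smul _ ha.ne', lintegral_smul_measure, finrank_euclideanSpace,
    Fintype.card_fin, abs_of_pos (by positivity), smul_eq_mul]

/-- Truncated cones are mapped into themselves by contractions towards the vertex. The Jacobian
a^{-d} and the factor a^{d-1} of the weight leave a⁻¹. -/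
theorem setLIntegral_truncCone_smul_le (hd : 1 ≤ d) (ν : Sp d) (s ρ : ℝ) {a : ℝ} (ha : 0 < a)
    (ha1 : a ≤ 1) {F : Sp d → ℝ≥0∞} (hF : Measurable F) :
    ∫⁻ h in truncCone ν s ρ, F (a • h) * (‖h‖ₑ ^ (d - 1))⁻¹ ≤
      ENNReal.ofReal a⁻¹ * ∫⁻ h in truncCone ν s ρ, F h * (‖h‖ₑ ^ (d - 1))⁻¹ := by
  have hm := measurableSet_truncCone ν s ρ
  let H := (truncCone ν s ρ).indicator fun h => F h * (‖h‖ₑ ^ (d - 1))⁻¹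
  have hH : Measurable H := (hF.mul (by fun_prop)).indicator hm
  have h1 : ∀ h, (truncCone ν s ρ).indicator (fun h => F (a • h) * (‖h‖ₑ ^ (d - 1))⁻¹) h ≤
      ENNReal.ofReal (a ^ (d - 1)) * H (a • h) := fun h => by
    by_cases hh : h ∈ truncCone ν s ρ
    · rw [Set.indicator_of_mem hh]
      simp only [H]
      rw [Set.indicator_of_mem (smul_mem_truncCone ha ha1 hh), enorm_smul, mul_pow,
        ENNReal.mul_inv (by simp [ha.ne']) (by simp), mul_left_comm, ← mul_assoc (ENNReal.ofReal _),
        Real.enorm_of_nonneg ha.le, ← ENNReal.ofReal_pow ha.le,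
        ENNReal.mul_inv_cancel (by simpa using pow_pos ha _) ENNReal.ofReal_ne_top, one_mul]
    · rw [Set.indicator_of_notMem hh]; exact zero_le
  rw [← lintegral_indicator hm, ← lintegral_indicator hm]
  refine (lintegral_mono h1).trans ?_
  rw [lintegral_const_mul (f := fun h => H (a • h)) _ (hH.comp (measurable_const_smul a)),
    lintegral_comp_smul_eq ha hH,
    ← mul_assoc, ← ENNReal.ofReal_mul (by positivity)]
  refine le_of_eq ?_
  congr 2
  obtain ⟨n, rfl⟩ := Nat.exists_eq_add_of_le' hd
  rw [Nat.add_sub_cancel]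
  field_simp
  ring

/-- The energy of the differences of `u` along the cones with vertices in the support of `μ`. -/
def coneEnergy (μ : Measure (Sp d)) (Γ : Set (Sp d)) (u : Sp d → ℂ) : ℝ≥0∞ :=
  ∫⁻ x, ∫⁻ h in Γ, ‖u x - u (x - h)‖ₑ ^ 2 * (‖h‖ₑ ^ (d + 1))⁻¹ ∂volume ∂μ

open scoped ContDiff

/-- Scaling by a = t² costs t⁻², which meets the weight 4t²; the t-integral over (0, 1] is therefore
4. -/
theorem coneEnergy_le_lintegral_grad (hd : 1 ≤ d) (μ : Measure (Sp d)) (ν : Sp d) (s ρ : ℝ)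
    {u : Sp d → ℂ} (hu : ContDiff ℝ ∞ u) : coneEnergy μ (truncCone ν s ρ) u ≤
      ∫⁻ x, 4 * ∫⁻ h in truncCone ν s ρ,
        ‖classicalGrad u (x - h)‖ₑ ^ 2 * (‖h‖ₑ ^ (d - 1))⁻¹ ∂volume ∂μ := by
  refine lintegral_mono fun x => ?_
  have hq : Continuous (classicalGrad u) := continuous_classicalGrad hu
  set Γ := truncCone ν s ρ
  set q : Sp d → ℝ≥0∞ := fun z => ‖classicalGrad u z‖ₑ ^ 2 with hqdef
  have hqm : Measurable q := by fun_prop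
  have h1 : ∀ h ∈ Γ, ‖u x - u (x - h)‖ₑ ^ 2 * (‖h‖ₑ ^ (d + 1))⁻¹ ≤
      ∫⁻ t in Set.Ioc (0 : ℝ) 1,
        ENNReal.ofReal (4 * t ^ 2) * (q (x - t ^ 2 • h) * (‖h‖ₑ ^ (d - 1))⁻¹) := by
    intro h hh
    have h0 : ‖h‖ₑ ≠ 0 := by simpa using (mem_truncCone.1 hh).2.2
    refine (mul_le_mul_left (enorm_sub_sq_le_lintegral hu x h) _).trans (le_of_eq ?_)
    rw [← lintegral_mul_const' _ _ (ENNReal.inv_ne_top.2 (pow_ne_zero _ h0))]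
    refine lintegral_congr fun t => ?_
    have h2 : ‖h‖ₑ ^ 2 * (‖h‖ₑ ^ (d + 1))⁻¹ = (‖h‖ₑ ^ (d - 1))⁻¹ := by
      rw [show d + 1 = 2 + (d - 1) by omega, pow_add, ENNReal.mul_inv (by simp) (by simp),
        ← mul_assoc, ENNReal.mul_inv_cancel (pow_ne_zero _ h0) (by simp), one_mul]
    rw [← h2]; simp only [hqdef]; ring
  refine (setLIntegral_mono' (measurableSet_truncCone ν s ρ) h1).trans ?_
  rw [lintegral_lintegral_swap (by fun_prop)]
  have h2 : ∀ t ∈ Set.Ioc (0 : ℝ) 1, ∫⁻ h in Γ,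
      ENNReal.ofReal (4 * t ^ 2) * (q (x - t ^ 2 • h) * (‖h‖ₑ ^ (d - 1))⁻¹) ≤
      4 * ∫⁻ h in Γ, q (x - h) * (‖h‖ₑ ^ (d - 1))⁻¹ := by
    intro t ht
    have ht0 : 0 < t ^ 2 := pow_pos ht.1 2
    rw [lintegral_const_mul' _ _ ENNReal.ofReal_ne_top]
    refine (mul_le_mul_right (setLIntegral_truncCone_smul_le hd ν s ρ ht0
      (pow_le_one₀ ht.1.le ht.2) (F := fun h => q (x - h)) (by fun_prop)) _).trans (le_of_eq ?_)
    rw [← mul_assoc, ← ENNReal.ofReal_mul (by positivity), mul_assoc, mul_inv_cancel₀ ht0.ne', mul_one,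
      ENNReal.ofReal_ofNat]
  refine (setLIntegral_mono' measurableSet_Ioc h2).trans ?_
  rw [setLIntegral_const, Real.volume_Ioc, sub_zero, ENNReal.ofReal_one, mul_one]

variable {O S : Set (Sp d)} {ν : Sp d} {s ρ κ : ℝ} {C : ℝ≥0∞}

/-- All vertices whose cone contains z have comparable distance to z: if R is one such distance,
every other lies between κR and R/κ. So only one scale contributes, with mass at most C(R/κ)^{d-1}
and weight at most (κR)^{-(d-1)}, and no logarithm appears. -/
theorem IsRegularPatch.lintegral_inv_le (hp : IsRegularPatch O S ν s ρ κ C) (z : Sp d) :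
    ∫⁻ x in S, (truncCone ν s ρ).indicator (fun h => (‖h‖ₑ ^ (d - 1))⁻¹) (x - z)
      ∂(surfaceMeasure O) ≤ C * ENNReal.ofReal ((κ⁻¹ ^ 2) ^ (d - 1)) := by
  set Γ := truncCone ν s ρ
  have hκ := hp.κ_pos
  by_cases hA : ∃ x₀ ∈ S, x₀ - z ∈ Γ
  swap
  · push Not at hA
    refine (setLIntegral_mono (g := 0) measurable_const fun x hx => ?_).trans ?_
    · rw [Set.indicator_of_notMem (hA x hx)]; rfl
    · simp
  obtain ⟨x₀, hx₀, hz₀⟩ := hA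
  obtain ⟨hc₀, hρ₀, h0⟩ := mem_truncCone.1 hz₀
  set R := ‖x₀ - z‖
  have hR : 0 < R := norm_pos_iff.2 h0
  have key : ∀ x ∈ S, x - z ∈ Γ → κ * ‖x - z‖ ≤ R ∧ κ * R ≤ ‖x - z‖ := fun x hx hxz => by
    obtain ⟨hc, hρ, h1⟩ := mem_truncCone.1 hxz
    have e1 := hp.le_norm x hx x₀ hx₀ (x - z) hc hρ
    have e2 := hp.le_norm x₀ hx₀ x hx (x₀ - z) hc₀ hρ₀
    rw [sub_sub_cancel] at e1 e2
    exact ⟨e1, e2⟩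
  have hle : ∀ x ∈ S, Γ.indicator (fun h => (‖h‖ₑ ^ (d - 1))⁻¹) (x - z) ≤
      (closedBall z (R / κ)).indicator
        (fun _ => ENNReal.ofReal (((κ * R)⁻¹) ^ (d - 1))) x := fun x hx => by
    by_cases hxz : x - z ∈ Γ
    · obtain ⟨e1, e2⟩ := key x hx hxz
      have hmem : x ∈ closedBall z (R / κ) := by
        rw [mem_closedBall, dist_eq_norm, le_div_iff₀ hκ, mul_comm]; exact e1
      rw [Set.indicator_of_mem hxz, Set.indicator_of_mem hmem, inv_pow,
        ENNReal.ofReal_inv_of_pos (by positivity), ENNReal.ofReal_pow (by positivity)]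
      refine ENNReal.inv_le_inv.2 (pow_le_pow_left₀ zero_le ?_ _)
      rw [← ofReal_norm]
      exact ENNReal.ofReal_le_ofReal e2
    · rw [Set.indicator_of_notMem hxz]; exact zero_le
  refine (setLIntegral_mono (measurable_const.indicator isClosed_closedBall.measurableSet)
    hle).trans ?_
  rw [lintegral_indicator_const isClosed_closedBall.measurableSet,
    Measure.restrict_apply isClosed_closedBall.measurableSet, Set.inter_comm]
  refine (mul_le_mul_right (hp.measure_le z (R / κ) (by positivity)) _).trans (le_of_eq ?_)
  rw [mul_left_comm, ← ENNReal.ofReal_mul (by positivity), ← mul_pow]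
  congr 3
  field_simp

theorem IsRegularPatch.mem_of_sub_mem (hp : IsRegularPatch O S ν s ρ κ C) {x z : Sp d}
    (hx : x ∈ S) (h : x - z ∈ truncCone ν s ρ) : z ∈ O := by
  obtain ⟨h1, h2, h3⟩ := mem_truncCone.1 h
  simpa using hp.sub_mem x hx _ h1 h3 h2

theorem setLIntegral_comp_sub_eq (ν : Sp d) (s ρ : ℝ) (x : Sp d) (F G : Sp d → ℝ≥0∞) :
    ∫⁻ h in truncCone ν s ρ, F (x - h) * G h =
      ∫⁻ z, F z * (truncCone ν s ρ).indicator G (x - z) := by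
  rw [← lintegral_indicator (measurableSet_truncCone ν s ρ),
    ← lintegral_sub_left_eq_self (fun z => F z * (truncCone ν s ρ).indicator G (x - z)) x]
  refine lintegral_congr fun h => ?_
  rw [sub_sub_cancel]
  by_cases hh : h ∈ truncCone ν s ρ <;> simp [hh]

/-- Integration over the cones with vertices in a patch. -/
theorem IsRegularPatch.lintegral_cone_le (hp : IsRegularPatch O S ν s ρ κ C)
    [SFinite ((surfaceMeasure O).restrict S)] (hO : MeasurableSet O)
    {q : Sp d → ℝ≥0∞} (hq : Measurable q) {G : Sp d → ℝ≥0∞} (hG : Measurable G) {K : ℝ≥0∞}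
    (hK : ∀ z, ∫⁻ x in S, (truncCone ν s ρ).indicator G (x - z) ∂(surfaceMeasure O) ≤ K) :
    ∫⁻ x in S, ∫⁻ h in truncCone ν s ρ, q (x - h) * G h ∂volume ∂(surfaceMeasure O) ≤
      K * ∫⁻ z in O, q z := by
  set Γ := truncCone ν s ρ
  have hGm : Measurable (Γ.indicator G) := hG.indicator (measurableSet_truncCone ν s ρ)
  simp_rw [Γ, setLIntegral_comp_sub_eq]
  rw [lintegral_lintegral_swap (by
    refine Measurable.aemeasurable ?_
    exact (hq.comp measurable_snd).mul (hGm.comp (measurable_fst.sub measurable_snd))),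
    ← lintegral_indicator hO, ← lintegral_const_mul _ (hq.indicator hO)]
  refine lintegral_mono fun z => ?_
  dsimp only
  have hGz : Measurable fun x => Γ.indicator G (x - z) := hGm.comp (measurable_id.sub_const z)
  by_cases hz : z ∈ O
  · rw [lintegral_const_mul _ hGz, Set.indicator_of_mem hz, mul_comm]
    exact mul_le_mul_left (hK z) _
  · refine (setLIntegral_mono (g := 0) measurable_const fun x hx => ?_).trans (by simp)
    rw [Set.indicator_of_notMem fun h => hz (hp.mem_of_sub_mem hx h)]
    simp

/-- After Fubini each interior point z is weighted by the integral over the vertices seeing it,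
which is uniformly bounded. -/
theorem IsRegularPatch.coneEnergy_le (hd : 1 ≤ d) (hp : IsRegularPatch O S ν s ρ κ C)
    [SFinite ((surfaceMeasure O).restrict S)] (hO : MeasurableSet O)
    {u : Sp d → ℂ} (hu : ContDiff ℝ ∞ u) :
    coneEnergy ((surfaceMeasure O).restrict S) (truncCone ν s ρ) u ≤
      4 * (C * ENNReal.ofReal ((κ⁻¹ ^ 2) ^ (d - 1))) *
        ∫⁻ z in O, ‖classicalGrad u z‖ₑ ^ 2 := by
  have hq : Continuous (classicalGrad u) := continuous_classicalGrad hu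
  refine (coneEnergy_le_lintegral_grad hd _ ν s ρ hu).trans ?_
  rw [lintegral_const_mul' _ _ (by simp), mul_assoc]
  exact mul_le_mul_right (hp.lintegral_cone_le hO
    (q := fun z => ‖classicalGrad u z‖ₑ ^ 2) (by fun_prop) (by fun_prop) hp.lintegral_inv_le) _

end Cone

end Acoustic

end

noncomputable section

namespace Acoustic

/-! ### Trace norms on a patch, bounded by the cone energy -/

section PatchTrace

open Metric

variable {d : ℕ} {O S : Set (Sp d)} {ν : Sp d} {s ρ κ : ℝ} {C : ℝ≥0∞}

/-- At height (2 + 4/s)r a perturbation below 2r leaves axial component at least (4/s)r and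
transversal part at most 4r. The radius 2r rather than r leaves room to shift a ball of radius r by
a vector of length r. -/
theorem mem_cone_of_norm_sub_lt (hν : ‖ν‖ = 1) (hs : 0 < s) (hs1 : s ≤ 1) {r : ℝ} (hr : 0 < r)
    {h : Sp d} (hh : ‖h - ((2 + 4 / s) * r) • ν‖ < 2 * r) :
    h ∈ cone ν s ∧ r ≤ ‖h‖ ∧ ‖h‖ ≤ (4 + 4 / s) * r := by
  set l := (2 + 4 / s) * r with hl
  set e := h - l • ν with he
  have h1 : h = l • ν + e := by rw [he]; abel
  have h2 : (inner ℝ ν h : ℝ) = l + inner ℝ ν e := by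
    rw [h1, inner_add_right, inner_smul_right, real_inner_self_eq_norm_sq, hν]; ring
  have h3 := inner_le_norm_of_unit hν e
  have h4 := abs_le.1 h3
  have h5 : 4 / s * r ≤ inner ℝ ν h := by
    rw [h2, hl]; nlinarith
  have h6 : 4 ≤ 4 / s := by rw [le_div_iff₀ hs]; linarith
  have hl0 : 0 ≤ l := by positivity
  refine ⟨?_, ?_, ?_⟩
  · change ‖h - (inner ℝ ν h : ℝ) • ν‖ ≤ s * inner ℝ ν h
    have h7 : h - (inner ℝ ν h : ℝ) • ν = e - (inner ℝ ν e : ℝ) • ν := by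
      rw [h2, h1, add_smul]; abel
    rw [h7]
    have h8 := norm_sub_le e ((inner ℝ ν e : ℝ) • ν)
    rw [norm_smul, hν, mul_one, Real.norm_eq_abs] at h8
    have h9 : s * (4 / s * r) ≤ s * inner ℝ ν h := mul_le_mul_of_nonneg_left h5 hs.le
    have h10 : s * (4 / s * r) = 4 * r := by field_simp
    linarith
  · have h7 := (le_abs_self _).trans (inner_le_norm_of_unit hν h)
    nlinarith
  · have h7 := norm_add_le (l • ν) e
    rw [norm_smul, hν, mul_one, Real.norm_of_nonneg hl0, ← h1] at h7
    rw [hl] at h7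
    nlinarith

theorem IsRegularPatch.volume_truncCone_pos (hp : IsRegularPatch O S ν s ρ κ C) :
    0 < volume (truncCone ν s ρ) := by
  have hs := hp.s_pos
  set r := ρ / (2 * (4 + 4 / s)) with hr
  have hr0 : 0 < r := by have := hp.ρ_pos; positivity
  refine (measure_ball_pos volume (((2 + 4 / s) * r) • ν) hr0).trans_le (measure_mono fun h hh => ?_)
  rw [mem_ball, dist_eq_norm] at hh
  obtain ⟨h1, h2, h3⟩ := mem_cone_of_norm_sub_lt hp.norm_eq hs hp.s_le hr0 (hh.trans (by linarith))
  refine mem_truncCone.2 ⟨h1, h3.trans_lt ?_, norm_pos_iff.1 (hr0.trans_le h2)⟩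
  have : (4 + 4 / s) * r = ρ / 2 := by rw [hr]; field_simp
  rw [this]; linarith [hp.ρ_pos]

theorem volume_truncCone_lt_top (ν : Sp d) (s ρ : ℝ) : volume (truncCone ν s ρ) < ∞ :=
  (measure_mono fun _ h => h.1.2).trans_lt measure_ball_lt_top

/-- Compare u(x) with u(x - h) and average over h in the cone. As ‖h‖ < ρ, the factor (ρ/‖h‖)^{d+1}
≥ 1 may be inserted to produce the cone energy. -/
theorem IsRegularPatch.lintegral_sq_le (hp : IsRegularPatch O S ν s ρ κ C)
    [SFinite ((surfaceMeasure O).restrict S)] (hO : MeasurableSet O)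
    {u : Sp d → ℂ} (hu : Continuous u) :
    volume (truncCone ν s ρ) * ∫⁻ x in S, ‖u x‖ₑ ^ 2 ∂(surfaceMeasure O) ≤
      2 * (ENNReal.ofReal ρ ^ (d + 1) *
        coneEnergy ((surfaceMeasure O).restrict S) (truncCone ν s ρ) u +
        surfaceMeasure O S * ∫⁻ z in O, ‖u z‖ₑ ^ 2) := by
  have hm := measurableSet_truncCone ν s ρ
  have hum := hu.measurable
  have hvol := (volume_truncCone_lt_top ν s ρ).ne
  set Γ := truncCone ν s ρ
  have hρ : ENNReal.ofReal ρ ^ (d + 1) ≠ ∞ := ENNReal.pow_ne_top ENNReal.ofReal_ne_top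
  have h1 : ∀ x, volume Γ * ‖u x‖ₑ ^ 2 ≤ 2 * (ENNReal.ofReal ρ ^ (d + 1) *
      (∫⁻ h in Γ, ‖u x - u (x - h)‖ₑ ^ 2 * (‖h‖ₑ ^ (d + 1))⁻¹) +
      ∫⁻ h in Γ, ‖u (x - h)‖ₑ ^ 2) := fun x => by
    rw [← lintegral_const_mul' _ _ hρ, ← lintegral_add_right _ (by fun_prop),
      ← lintegral_const_mul' _ _ (by simp), mul_comm, ← setLIntegral_const]
    refine setLIntegral_mono' hm fun h hh => ?_
    have h2 := enorm_add_sq_le (u x - u (x - h)) (u (x - h))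
    rw [sub_add_cancel] at h2
    refine h2.trans (mul_le_mul_right (add_le_add_left ?_ _) _)
    obtain ⟨-, hlt, h0⟩ := mem_truncCone.1 hh
    have h3 : (1 : ℝ≥0∞) ≤ ENNReal.ofReal ρ ^ (d + 1) * (‖h‖ₑ ^ (d + 1))⁻¹ := by
      rw [← div_eq_mul_inv, ENNReal.le_div_iff_mul_le (by simp [h0]) (by simp), one_mul,
        ← ofReal_norm]
      exact pow_le_pow_left₀ zero_le (ENNReal.ofReal_le_ofReal hlt.le) _
    calc _ = ‖u x - u (x - h)‖ₑ ^ 2 * 1 := (mul_one _).symm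
      _ ≤ ‖u x - u (x - h)‖ₑ ^ 2 * (ENNReal.ofReal ρ ^ (d + 1) * (‖h‖ₑ ^ (d + 1))⁻¹) :=
        mul_le_mul_right h3 _
      _ = _ := by ring
  rw [← lintegral_const_mul' _ _ hvol]
  refine (lintegral_mono h1).trans ?_
  rw [lintegral_const_mul' _ _ (by simp)]
  refine mul_le_mul_right ?_ _
  have hint : Measurable fun x => ∫⁻ h in Γ, ‖u (x - h)‖ₑ ^ 2 :=
    Measurable.lintegral_prod_right' (f := fun p : Sp d × Sp d => ‖u (p.1 - p.2)‖ₑ ^ 2)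
      (by fun_prop)
  rw [lintegral_add_right _ hint, lintegral_const_mul' _ _ hρ]
  refine add_le_add_right ?_ _
  have := hp.lintegral_cone_le hO (q := fun z => ‖u z‖ₑ ^ 2) (by fun_prop) (G := fun _ => 1)
    measurable_const (K := surfaceMeasure O S) fun z => ?_
  · simpa using this
  · refine (lintegral_mono (g := fun _ => 1) fun x => ?_).trans (by simp)
    exact Set.indicator_le_self' (fun _ _ => zero_le) _

/-- The weight `|x - y|^{-2d}` on the triples with `|x - y| ≤ |h| ≤ l |x - y|`. -/
def pairWeight (l : ℝ) (x y h : Sp d) : ℝ≥0∞ :=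
  if ‖x - y‖ ≤ ‖h‖ ∧ ‖h‖ ≤ l * ‖x - y‖ then (‖x - y‖ₑ ^ (2 * d))⁻¹ else 0

@[fun_prop]
theorem measurable_pairWeight (l : ℝ) :
    Measurable fun p : (Sp d × Sp d) × Sp d => pairWeight l p.1.1 p.1.2 p.2 := by
  unfold pairWeight
  refine Measurable.ite ?_ (by fun_prop) measurable_const
  exact (measurableSet_le (f := fun p : (Sp d × Sp d) × Sp d => ‖p.1.1 - p.1.2‖)
    (g := fun p => ‖p.2‖) (by fun_prop) (by fun_prop)).inter
    (measurableSet_le (f := fun p : (Sp d × Sp d) × Sp d => ‖p.2‖)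
    (g := fun p => l * ‖p.1.1 - p.1.2‖) (by fun_prop) (by fun_prop))

/-- Both u(x) and u(y) are compared with values of u on one ball of radius r = |x - y| lying in the
cones of x and of y. Its volume is proportional to r^d, so averaging with weight r^{-2d} leaves
r^{-d}. -/
theorem IsRegularPatch.enorm_sub_sq_le (hp : IsRegularPatch O S ν s ρ κ C) {u : Sp d → ℂ}
    (hu : Continuous u) {x y : Sp d} (hxy : x ≠ y) (hr : (4 + 4 / s) * ‖x - y‖ < ρ) :
    volume (ball (0 : Sp d) 1) * (‖u x - u y‖ₑ ^ 2 * (‖x - y‖ₑ ^ d)⁻¹) ≤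
      2 * ((∫⁻ h in truncCone ν s ρ,
          pairWeight (4 + 4 / s) x y h * ‖u x - u (x - h)‖ₑ ^ 2) +
        ∫⁻ h in truncCone ν s ρ, pairWeight (4 + 4 / s) y x h * ‖u y - u (y - h)‖ₑ ^ 2) := by
  have hm := measurableSet_truncCone ν s ρ
  set Γ := truncCone ν s ρ
  set l := 4 + 4 / s
  set r := ‖x - y‖ with hrdef
  have hr0 : 0 < r := norm_pos_iff.2 (sub_ne_zero.2 hxy)
  have hre : ‖x - y‖ₑ ≠ 0 := by simpa [sub_eq_zero] using hxy
  set a := ((2 + 4 / s) * r) • ν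
  set A := ball a r
  have hmem : ∀ h : Sp d, ‖h - a‖ < 2 * r → h ∈ Γ ∧ r ≤ ‖h‖ ∧ ‖h‖ ≤ l * r := fun h hh => by
    obtain ⟨h1, h2, h3⟩ := mem_cone_of_norm_sub_lt hp.norm_eq hp.s_pos hp.s_le hr0 hh
    exact ⟨mem_truncCone.2 ⟨h1, h3.trans_lt hr, norm_pos_iff.1 (hr0.trans_le h2)⟩, h2, h3⟩
  have hvol : volume (ball (0 : Sp d) 1) * ‖x - y‖ₑ ^ d = volume A := by
    rw [Measure.addHaar_ball_of_pos _ _ hr0, finrank_euclideanSpace, Fintype.card_fin, mul_comm,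
      ENNReal.ofReal_pow hr0.le, hrdef, ofReal_norm]
  have hW : ∀ (v w : Sp d), ‖v - w‖ = r → ∀ h : Sp d, ‖h - a‖ < 2 * r →
      Γ.indicator (fun h => pairWeight l v w h * ‖u v - u (v - h)‖ₑ ^ 2) h =
        (‖x - y‖ₑ ^ (2 * d))⁻¹ * ‖u v - u (v - h)‖ₑ ^ 2 := fun v w hvw h hh => by
    obtain ⟨h1, h2, h3⟩ := hmem h hh
    rw [Set.indicator_of_mem h1, pairWeight, if_pos ⟨by rwa [hvw], by rwa [hvw]⟩,
      ← ofReal_norm (v - w), hvw, hrdef, ofReal_norm]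
  have h1 : (‖x - y‖ₑ ^ (2 * d))⁻¹ * (volume A * ‖u x - u y‖ₑ ^ 2) ≤
      2 * ((∫⁻ h in A, (‖x - y‖ₑ ^ (2 * d))⁻¹ * ‖u x - u (x - h)‖ₑ ^ 2) +
        ∫⁻ h in A, (‖x - y‖ₑ ^ (2 * d))⁻¹ * ‖u y - u (x - h)‖ₑ ^ 2) := by
    rw [← lintegral_add_right _ (by have := hu.measurable; fun_prop),
      ← lintegral_const_mul' _ _ (by simp), mul_comm (volume A), ← setLIntegral_const, ← lintegral_const_mul' _ _
      (ENNReal.inv_ne_top.2 (pow_ne_zero _ hre))]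
    refine lintegral_mono fun h => ?_
    have h2 := enorm_add_sq_le (u x - u (x - h)) (u (x - h) - u y)
    rw [sub_add_sub_cancel, ← enorm_neg (u (x - h) - u y), neg_sub] at h2
    refine (mul_le_mul_right h2 _).trans (le_of_eq ?_)
    ring
  have hl : volume (ball (0 : Sp d) 1) * (‖u x - u y‖ₑ ^ 2 * (‖x - y‖ₑ ^ d)⁻¹) =
      (‖x - y‖ₑ ^ (2 * d))⁻¹ * (volume A * ‖u x - u y‖ₑ ^ 2) := by
    have h2 : (‖x - y‖ₑ ^ (2 * d))⁻¹ * ‖x - y‖ₑ ^ d = (‖x - y‖ₑ ^ d)⁻¹ := by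
      rw [two_mul, pow_add, ENNReal.mul_inv (by simp) (by simp), mul_assoc,
        ENNReal.inv_mul_cancel (pow_ne_zero _ hre) (by simp), mul_one]
    rw [← hvol, ← h2]; ring
  rw [hl]
  refine h1.trans (mul_le_mul_right (add_le_add ?_ ?_) _)
  · rw [← lintegral_indicator hm, ← lintegral_indicator measurableSet_ball]
    refine lintegral_mono fun h => ?_
    by_cases hh : h ∈ A
    · rw [Set.indicator_of_mem hh, hW x y rfl h
        ((mem_ball_iff_norm.1 hh).trans (by linarith))]
    · rw [Set.indicator_of_notMem hh]; exact zero_le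
  -- The common point x - h is y - (h + y - x) when seen from y, so the variable is translated by y
  -- - x.
  · rw [← lintegral_indicator hm, ← lintegral_indicator measurableSet_ball,
      ← lintegral_add_right_eq_self (Γ.indicator _) (y - x)]
    refine lintegral_mono fun h => ?_
    by_cases hh : h ∈ A
    · have h2 : ‖h + (y - x) - a‖ < 2 * r := by
        have h3 := norm_add_le (h - a) (y - x)
        rw [norm_sub_rev y x, show h - a + (y - x) = h + (y - x) - a by abel] at h3
        have := mem_ball_iff_norm.1 hh
        linarith
      rw [Set.indicator_of_mem hh, hW y x (norm_sub_rev y x) _ h2,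
        show y - (h + (y - x)) = x - h by abel]
    · rw [Set.indicator_of_notMem hh]; exact zero_le

/-- The weight is at most (l/‖h‖)^{2d} and lives on a ball of radius ‖h‖, of surface measure at most
C‖h‖^{d-1}; the exponents add up to -(d + 1), the exponent of the cone energy. -/
theorem IsRegularPatch.lintegral_pairWeight_le (hd : 1 ≤ d) (hp : IsRegularPatch O S ν s ρ κ C)
    {l : ℝ} (hl : 0 < l) (x : Sp d) {h : Sp d} (hh : h ≠ 0) :
    ∫⁻ y in S, pairWeight l x y h ∂(surfaceMeasure O) ≤
      C * ENNReal.ofReal (l ^ (2 * d)) * (‖h‖ₑ ^ (d + 1))⁻¹ := by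
  have hh0 : 0 < ‖h‖ := norm_pos_iff.2 hh
  have h1 : ∀ y, pairWeight l x y h ≤ (closedBall x ‖h‖).indicator
      (fun _ => ENNReal.ofReal ((‖h‖ / l) ^ (2 * d))⁻¹) y := fun y => by
    rw [pairWeight]
    split_ifs with hc
    · have hmem : y ∈ closedBall x ‖h‖ := by rw [mem_closedBall', dist_eq_norm]; exact hc.1
      rw [Set.indicator_of_mem hmem, ENNReal.ofReal_inv_of_pos (by positivity),
        ENNReal.ofReal_pow (by positivity), ENNReal.inv_le_inv, ← ofReal_norm]
      refine pow_le_pow_left₀ zero_le (ENNReal.ofReal_le_ofReal ?_) _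
      rw [div_le_iff₀ hl, mul_comm]; exact hc.2
    · exact zero_le
  refine (lintegral_mono h1).trans ?_
  rw [lintegral_indicator_const isClosed_closedBall.measurableSet,
    Measure.restrict_apply isClosed_closedBall.measurableSet, Set.inter_comm]
  refine (mul_le_mul_right (hp.measure_le x ‖h‖ hh0.le) _).trans (le_of_eq ?_)
  rw [← ofReal_norm h, ← ENNReal.ofReal_pow hh0.le, ← ENNReal.ofReal_inv_of_pos (by positivity),
    mul_left_comm, mul_assoc, ← ENNReal.ofReal_mul (by positivity),
    ← ENNReal.ofReal_mul (by positivity)]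
  congr 2
  obtain ⟨n, rfl⟩ := Nat.exists_eq_add_of_le' hd
  rw [Nat.add_sub_cancel, div_pow, inv_div, div_mul_eq_mul_div, div_eq_mul_inv, mul_assoc]
  congr 1
  field_simp
  ring

theorem IsRegularPatch.lintegral_pair_le (hd : 1 ≤ d) (hp : IsRegularPatch O S ν s ρ κ C)
    [SFinite ((surfaceMeasure O).restrict S)] {u : Sp d → ℂ} (hu : Continuous u) :
    volume (ball (0 : Sp d) 1) * ∫⁻ x in S, ∫⁻ y in S,
      (if (4 + 4 / s) * ‖x - y‖ < ρ then ‖u x - u y‖ₑ ^ 2 * (‖x - y‖ₑ ^ d)⁻¹ else 0)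
        ∂(surfaceMeasure O) ∂(surfaceMeasure O) ≤
      4 * (C * ENNReal.ofReal ((4 + 4 / s) ^ (2 * d))) *
        coneEnergy ((surfaceMeasure O).restrict S) (truncCone ν s ρ) u := by
  have hm := measurableSet_truncCone ν s ρ
  set Γ := truncCone ν s ρ
  have hl : 0 < 4 + 4 / s := by have := hp.s_pos; positivity
  set l := 4 + 4 / s
  set μ := (surfaceMeasure O).restrict S
  have hb : volume (ball (0 : Sp d) 1) ≠ ∞ := measure_ball_lt_top.ne
  have hum := hu.measurable
  set T : Sp d → Sp d → ℝ≥0∞ := fun x y =>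
    ∫⁻ h in Γ, pairWeight l x y h * ‖u x - u (x - h)‖ₑ ^ 2 with hT
  have hTm : Measurable fun p : Sp d × Sp d => T p.1 p.2 := by
    refine Measurable.lintegral_prod_right'
      (f := fun p : (Sp d × Sp d) × Sp d => pairWeight l p.1.1 p.1.2 p.2 *
        ‖u p.1.1 - u (p.1.1 - p.2)‖ₑ ^ 2) ?_
    exact (measurable_pairWeight l).mul (by fun_prop)
  have h1 : ∀ x y, volume (ball (0 : Sp d) 1) *
      (if l * ‖x - y‖ < ρ then ‖u x - u y‖ₑ ^ 2 * (‖x - y‖ₑ ^ d)⁻¹ else 0) ≤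
      2 * (T x y + T y x) := fun x y => by
    split_ifs with h
    · rcases eq_or_ne x y with rfl | hxy
      · simp
      · exact hp.enorm_sub_sq_le hu hxy h
    · simp
  rw [← lintegral_const_mul' _ _ hb]
  simp_rw [← lintegral_const_mul' _ _ hb]
  refine (lintegral_mono fun x => lintegral_mono fun y => h1 x y).trans ?_
  simp_rw [lintegral_const_mul' _ _ (show (2 : ℝ≥0∞) ≠ ∞ by simp)]
  have h2 : ∀ x, ∫⁻ y, T x y + T y x ∂μ = (∫⁻ y, T x y ∂μ) + ∫⁻ y, T y x ∂μ := fun x =>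
    lintegral_add_left (hTm.comp measurable_prodMk_left) _
  simp_rw [h2]
  -- The two halves agree after exchanging x and y, which gives the factor 4.
  rw [lintegral_add_left hTm.lintegral_prod_right',
    lintegral_lintegral_swap (f := fun x y => T y x) (hTm.comp measurable_swap).aemeasurable,
    ← two_mul, ← mul_assoc, show (2 : ℝ≥0∞) * 2 = 4 by norm_num, mul_assoc]
  refine mul_le_mul_right ?_ _
  have hC : C * ENNReal.ofReal (l ^ (2 * d)) ≠ ∞ :=
    ENNReal.mul_ne_top hp.C_ne_top ENNReal.ofReal_ne_top
  rw [coneEnergy, ← lintegral_const_mul' _ _ hC]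
  refine lintegral_mono fun x => ?_
  dsimp only
  rw [← lintegral_const_mul' _ _ hC, hT, lintegral_lintegral_swap (by
    refine Measurable.aemeasurable ?_
    exact ((measurable_pairWeight l).comp (f := fun p : Sp d × Sp d => ((x, p.1), p.2))
      (by fun_prop)).mul (by fun_prop))]
  refine setLIntegral_mono' hm fun h hh => ?_
  rw [lintegral_mul_const (f := fun y => pairWeight l x y h) _
    ((measurable_pairWeight l).comp (f := fun y : Sp d => ((x, y), h)) (by fun_prop))]
  refine (mul_le_mul_left (hp.lintegral_pairWeight_le hd hl x (mem_truncCone.1 hh).2.2)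
    _).trans (le_of_eq ?_)
  ring

end PatchTrace

end Acoustic

end

noncomputable section

namespace Acoustic

/-! ### From patches to the whole boundary, and from smooth functions to H¹ -/

section TraceBound

open Metric
open scoped ContDiff

variable {d : ℕ}

theorem sq_eLpNorm_two {X F : Type*} [MeasurableSpace X] [NormedAddCommGroup F] (μ : Measure X)
    (f : X → F) : eLpNorm f 2 μ ^ 2 = ∫⁻ x, ‖f x‖ₑ ^ 2 ∂μ := by
  have := eLpNorm_nnreal_pow_eq_lintegral (μ := μ) (f := f) (p := 2) two_ne_zero
  simpa using this

/-- The difference quotient `(f(x) - f(y)) / |x - y|^(d/2)`. -/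
def diffQuot (f : Sp d → ℂ) (q : Sp d × Sp d) : ℂ :=
  (f q.1 - f q.2) / ((‖q.1 - q.2‖ ^ ((d : ℝ) / 2) : ℝ) : ℂ)

theorem enorm_sq_diffQuot (f : Sp d → ℂ) (q : Sp d × Sp d) :
    ‖diffQuot f q‖ₑ ^ 2 = ‖f q.1 - f q.2‖ₑ ^ 2 * (‖q.1 - q.2‖ₑ ^ d)⁻¹ := by
  rcases eq_or_ne q.1 q.2 with h | h
  · simp [diffQuot, h]
  have h0 : 0 < ‖q.1 - q.2‖ := norm_pos_iff.2 (sub_ne_zero.2 h)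
  have h1 : ‖diffQuot f q‖ ^ 2 = ‖f q.1 - f q.2‖ ^ 2 * (‖q.1 - q.2‖ ^ d)⁻¹ := by
    rw [diffQuot, norm_div, Complex.norm_real, Real.norm_of_nonneg (by positivity), div_pow,
      ← Real.rpow_natCast (_ ^ _) 2, ← Real.rpow_mul h0.le, div_eq_mul_inv]
    congr 2
    rw [Nat.cast_ofNat, div_mul_cancel₀ _ (by norm_num), Real.rpow_natCast]
  rw [← ofReal_norm, ← ENNReal.ofReal_pow (norm_nonneg _), h1,
    ENNReal.ofReal_mul (by positivity), ENNReal.ofReal_inv_of_pos (by positivity),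
    ENNReal.ofReal_pow (norm_nonneg _), ENNReal.ofReal_pow (norm_nonneg _), ofReal_norm,
    ofReal_norm]

theorem measurable_diffQuot {f : Sp d → ℂ} (hf : Measurable f) : Measurable (diffQuot f) := by
  unfold diffQuot
  fun_prop

/-- The squared norm of a function in `H¹(O)`. -/
def sobolevEnergy (O : Set (Sp d)) (u : Sp d → ℂ) : ℝ≥0∞ :=
  (∫⁻ z in O, ‖u z‖ₑ ^ 2) + ∫⁻ z in O, ‖classicalGrad u z‖ₑ ^ 2

variable {O : Set (Sp d)}

theorem IsRegularPatch.exists_bound {S : Set (Sp d)} {ν : Sp d} {s ρ κ : ℝ} {C : ℝ≥0∞} (hd : 1 ≤ d)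
    (hp : IsRegularPatch O S ν s ρ κ C) [IsFiniteMeasure (surfaceMeasure O)]
    (hO : MeasurableSet O) : ∃ K : ℝ≥0∞, K ≠ ⊤ ∧ ∀ u : Sp d → ℂ, ContDiff ℝ ∞ u →
      (∫⁻ x in S, ‖u x‖ₑ ^ 2 ∂(surfaceMeasure O)) ≤ K * sobolevEnergy O u ∧
      (∫⁻ q in S ×ˢ S, (if (4 + 4 / s) * ‖q.1 - q.2‖ < ρ then ‖diffQuot u q‖ₑ ^ 2 else 0)
        ∂((surfaceMeasure O).prod (surfaceMeasure O))) ≤ K * sobolevEnergy O u := by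
  set Γ := truncCone ν s ρ
  set v := volume Γ
  set b := volume (ball (0 : Sp d) 1)
  set K₁ := 4 * (C * ENNReal.ofReal ((κ⁻¹ ^ 2) ^ (d - 1)))
  set K₂ := v⁻¹ * (2 * (ENNReal.ofReal ρ ^ (d + 1) * K₁ + surfaceMeasure O S))
  set K₃ := b⁻¹ * (4 * (C * ENNReal.ofReal ((4 + 4 / s) ^ (2 * d))) * K₁)
  have hv0 : v ≠ 0 := hp.volume_truncCone_pos.ne'
  have hv1 : v ≠ ⊤ := (volume_truncCone_lt_top ν s ρ).ne
  have hb0 : b ≠ 0 := (measure_ball_pos _ _ one_pos).ne'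
  have hb1 : b ≠ ⊤ := measure_ball_lt_top.ne
  have hK₁ : K₁ ≠ ⊤ := ENNReal.mul_ne_top (by simp)
    (ENNReal.mul_ne_top hp.C_ne_top ENNReal.ofReal_ne_top)
  have hK₂ : K₂ ≠ ⊤ := by
    refine ENNReal.mul_ne_top (ENNReal.inv_ne_top.2 hv0) (ENNReal.mul_ne_top (by simp) ?_)
    exact ENNReal.add_ne_top.2
      ⟨ENNReal.mul_ne_top (ENNReal.pow_ne_top ENNReal.ofReal_ne_top) hK₁, measure_ne_top _ _⟩
  have hK₃ : K₃ ≠ ⊤ := by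
    refine ENNReal.mul_ne_top (ENNReal.inv_ne_top.2 hb0) (ENNReal.mul_ne_top ?_ hK₁)
    exact ENNReal.mul_ne_top (by simp) (ENNReal.mul_ne_top hp.C_ne_top ENNReal.ofReal_ne_top)
  refine ⟨K₂ + K₃, ENNReal.add_ne_top.2 ⟨hK₂, hK₃⟩, fun u hu => ?_⟩
  have hE : coneEnergy ((surfaceMeasure O).restrict S) Γ u ≤ K₁ * sobolevEnergy O u :=
    (hp.coneEnergy_le hd hO hu).trans (mul_le_mul_right le_add_self _)
  constructor
  · refine le_trans ?_ (mul_le_mul_left (le_self_add : K₂ ≤ K₂ + K₃) _)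
    have h := hp.lintegral_sq_le hO hu.continuous
    rw [ENNReal.mul_le_iff_le_inv hv0 hv1] at h
    refine h.trans ?_
    rw [mul_assoc v⁻¹]
    refine mul_le_mul_right ?_ _
    rw [mul_assoc, add_mul, mul_assoc]
    exact mul_le_mul_right (add_le_add (mul_le_mul_right hE _)
      (mul_le_mul_right le_self_add _)) _
  · refine le_trans ?_ (mul_le_mul_left (le_add_self : K₃ ≤ K₂ + K₃) _)
    have hum := measurable_diffQuot hu.continuous.measurable
    have h := hp.lintegral_pair_le hd hu.continuous
    rw [ENNReal.mul_le_iff_le_inv hb0 hb1] at h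
    rw [← Measure.prod_restrict, lintegral_prod _ (Measurable.aemeasurable (Measurable.ite
      (measurableSet_lt (f := fun q : Sp d × Sp d => (4 + 4 / s) * ‖q.1 - q.2‖)
        (g := fun _ => ρ) (by fun_prop) measurable_const) (by fun_prop) measurable_const))]
    simp_rw [enorm_sq_diffQuot]
    refine h.trans ?_
    rw [mul_assoc b⁻¹]
    refine mul_le_mul_right ?_ _
    rw [mul_assoc _ K₁]
    exact mul_le_mul_right hE _

/-- The trace estimate for smooth functions. -/
theorem exists_bound_of_contDiff (hd : 1 ≤ d) (hO : IsOpen O) (hb : Bornology.IsBounded O)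
    (hL : HasLipschitzBoundary O) [IsFiniteMeasure (surfaceMeasure O)] :
    ∃ K : ℝ≥0∞, K ≠ ⊤ ∧ ∀ u : Sp d → ℂ, ContDiff ℝ ∞ u →
      (∫⁻ x, ‖u x‖ₑ ^ 2 ∂(surfaceMeasure O)) ≤ K * sobolevEnergy O u ∧
      (∫⁻ q, ‖diffQuot u q‖ₑ ^ 2 ∂((surfaceMeasure O).prod (surfaceMeasure O))) ≤
        K * sobolevEnergy O u := by
  obtain ⟨t, ρ, hρ, hcov⟩ := exists_finite_regularPatches hd hO hb hL
  set σ := surfaceMeasure O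
  let S : Sp d → Set (Sp d) := fun x₀ => frontier O ∩ ball x₀ (ρ x₀)
  have hSm : ∀ x₀, MeasurableSet (S x₀) := fun x₀ =>
    isClosed_frontier.measurableSet.inter measurableSet_ball
  have hp : ∀ x₀ : t, ∃ (l : ℝ) (K : ℝ≥0∞), 8 ≤ l ∧ K ≠ ⊤ ∧ ∀ u : Sp d → ℂ, ContDiff ℝ ∞ u →
      (∫⁻ x in S x₀, ‖u x‖ₑ ^ 2 ∂σ) ≤ K * sobolevEnergy O u ∧
      (∫⁻ q in S x₀ ×ˢ S x₀, (if l * ‖q.1 - q.2‖ < ρ x₀ then ‖diffQuot u q‖ₑ ^ 2 else 0)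
        ∂(σ.prod σ)) ≤ K * sobolevEnergy O u := fun x₀ => by
    obtain ⟨-, ν, s, κ, C, hp⟩ := hρ x₀ x₀.2
    obtain ⟨K, hK, h⟩ := hp.exists_bound hd hO.measurableSet
    refine ⟨4 + 4 / s, K, ?_, hK, h⟩
    have : 4 ≤ 4 / s := by
      rw [le_div_iff₀ hp.s_pos]; linarith [hp.s_le]
    linarith
  choose l K hl hK hu using hp
  -- Points closer than δ lie in one patch and satisfy its local condition; the bound l ≥ 8 makes δ
  -- smaller than the room ρ/2 left by the covering.
  obtain ⟨δ, hδ, hδt⟩ : ∃ δ : ℝ, 0 < δ ∧ ∀ x₀ : t, δ ≤ ρ x₀ / l x₀ := by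
    rcases isEmpty_or_nonempty t with h | h
    · exact ⟨1, one_pos, fun x => h.elim x⟩
    · obtain ⟨x₁, hx₁⟩ := Finite.exists_min fun x₀ : t => ρ x₀ / l x₀
      exact ⟨_, div_pos (hρ x₁ x₁.2).1 (by linarith [hl x₁]), hx₁⟩
  have hfr : ∀ᵐ x ∂σ, x ∈ frontier O := surfaceMeasure_compl_frontier
  set K₁ := ∑ x₀, K x₀
  have hK₁ : K₁ ≠ ⊤ := ENNReal.sum_ne_top.2 fun x₀ _ => hK x₀
  set D := 2 * ENNReal.ofReal (δ ^ d)⁻¹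
  have hD : D ≠ ⊤ := ENNReal.mul_ne_top (by simp) ENNReal.ofReal_ne_top
  refine ⟨K₁ + (K₁ + D * (2 * (σ Set.univ * K₁))), ?_, fun u huc => ?_⟩
  · refine ENNReal.add_ne_top.2 ⟨hK₁, ENNReal.add_ne_top.2 ⟨hK₁, ENNReal.mul_ne_top hD ?_⟩⟩
    exact ENNReal.mul_ne_top (by simp) (ENNReal.mul_ne_top (measure_ne_top _ _) hK₁)
  have hum := huc.continuous.measurable
  have hdm := measurable_diffQuot hum
  have h1 : (∫⁻ x, ‖u x‖ₑ ^ 2 ∂σ) ≤ K₁ * sobolevEnergy O u := by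
    calc (∫⁻ x, ‖u x‖ₑ ^ 2 ∂σ)
        ≤ ∫⁻ x, ∑ x₀ : t, (S x₀).indicator (fun x => ‖u x‖ₑ ^ 2) x ∂σ := by
          refine lintegral_mono_ae (hfr.mono fun x hx => ?_)
          obtain ⟨x₀, hx₀, hxb⟩ := Set.mem_iUnion₂.1 (hcov hx)
          have hxS : x ∈ S x₀ := ⟨hx, ball_subset_ball (by linarith [(hρ x₀ hx₀).1]) hxb⟩
          refine le_trans (le_of_eq ?_) (Finset.single_le_sum
            (f := fun x₀ : t => (S x₀).indicator (fun x => ‖u x‖ₑ ^ 2) x) (fun _ _ => zero_le)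
            (Finset.mem_univ ⟨x₀, hx₀⟩))
          rw [Set.indicator_of_mem hxS]
      _ = ∑ x₀ : t, ∫⁻ x in S x₀, ‖u x‖ₑ ^ 2 ∂σ := by
          rw [lintegral_finsetSum (f := fun (x₀ : t) => (S x₀).indicator fun x => ‖u x‖ₑ ^ 2) _
            fun x₀ _ => Measurable.indicator (by fun_prop) (hSm x₀)]
          exact Finset.sum_congr rfl fun x₀ _ => lintegral_indicator (hSm x₀) _
      _ ≤ ∑ x₀ : t, K x₀ * sobolevEnergy O u := Finset.sum_le_sum fun x₀ _ => (hu x₀ u huc).1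
      _ = _ := by rw [Finset.sum_mul]
  refine ⟨h1.trans (mul_le_mul_left le_self_add _), ?_⟩
  refine le_trans ?_ (mul_le_mul_left le_add_self _)
  have hfr2 : ∀ᵐ q ∂σ.prod σ, q.1 ∈ frontier O ∧ q.2 ∈ frontier O :=
    (Measure.quasiMeasurePreserving_fst.ae hfr).and (Measure.quasiMeasurePreserving_snd.ae hfr)
  let F : t → Sp d × Sp d → ℝ≥0∞ := fun x₀ q =>
    if l x₀ * ‖q.1 - q.2‖ < ρ x₀ then ‖diffQuot u q‖ₑ ^ 2 else 0
  have hFm : ∀ x₀, Measurable (F x₀) := fun x₀ => Measurable.ite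
    (measurableSet_lt (f := fun q : Sp d × Sp d => l x₀ * ‖q.1 - q.2‖) (g := fun _ => ρ x₀)
      (by fun_prop) measurable_const) (by fun_prop) measurable_const
  have hpt : ∀ᵐ q ∂σ.prod σ, ‖diffQuot u q‖ₑ ^ 2 ≤
      (∑ x₀ : t, (S x₀ ×ˢ S x₀).indicator (F x₀) q) + D * (‖u q.1‖ₑ ^ 2 + ‖u q.2‖ₑ ^ 2) := by
    filter_upwards [hfr2] with q hq
    by_cases hlt : ‖q.1 - q.2‖ < δ
    · refine le_trans ?_ le_self_add
      obtain ⟨x₀, hx₀, hxb⟩ := Set.mem_iUnion₂.1 (hcov hq.1)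
      have hl0 := hl ⟨x₀, hx₀⟩
      have hρ0 := (hρ x₀ hx₀).1
      have h3 : l ⟨x₀, hx₀⟩ * ‖q.1 - q.2‖ < ρ x₀ := by
        have := hlt.trans_le (hδt ⟨x₀, hx₀⟩)
        rwa [lt_div_iff₀ (by linarith), mul_comm] at this
      have h4 : ‖q.1 - q.2‖ < ρ x₀ / 2 := by
        nlinarith [norm_nonneg (q.1 - q.2)]
      have hq1 : q.1 ∈ S x₀ := ⟨hq.1, ball_subset_ball (by linarith) hxb⟩
      have hq2 : q.2 ∈ S x₀ := by
        refine ⟨hq.2, ?_⟩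
        rw [mem_ball]
        have h5 := dist_triangle q.2 q.1 x₀
        have h6 := mem_ball.1 hxb
        rw [dist_comm q.2 q.1, dist_eq_norm q.1 q.2] at h5
        linarith
      refine le_trans (le_of_eq ?_) (Finset.single_le_sum
        (f := fun x₀ : t => (S x₀ ×ˢ S x₀).indicator (F x₀) q) (fun _ _ => zero_le)
        (Finset.mem_univ ⟨x₀, hx₀⟩))
      rw [Set.indicator_of_mem (Set.mk_mem_prod hq1 hq2)]
      exact (if_pos h3).symm
    -- Far pairs: the kernel is at most δ^{-d}, and the L² part of the estimate suffices because the
    -- boundary has finite measure.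
    · refine le_trans ?_ le_add_self
      rw [enorm_sq_diffQuot]
      have h3 := enorm_add_sq_le (u q.1) (-u q.2)
      rw [← sub_eq_add_neg, enorm_neg] at h3
      have h4 : (‖q.1 - q.2‖ₑ ^ d)⁻¹ ≤ ENNReal.ofReal (δ ^ d)⁻¹ := by
        rw [ENNReal.ofReal_inv_of_pos (by positivity), ENNReal.inv_le_inv,
          ENNReal.ofReal_pow hδ.le, ← ofReal_norm]
        exact pow_le_pow_left₀ zero_le (ENNReal.ofReal_le_ofReal (not_lt.1 hlt)) _
      exact (mul_le_mul' h3 h4).trans (le_of_eq (by ring))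
  refine (lintegral_mono_ae hpt).trans ?_
  rw [lintegral_add_left (Finset.measurable_sum _ fun x₀ _ =>
      (hFm x₀).indicator ((hSm x₀).prod (hSm x₀))), lintegral_finsetSum _ fun x₀ _ =>
      (hFm x₀).indicator ((hSm x₀).prod (hSm x₀)), lintegral_const_mul' _ _ hD,
    lintegral_add_left (by fun_prop), add_mul]
  refine add_le_add ?_ ?_
  · rw [Finset.sum_mul]
    refine Finset.sum_le_sum fun x₀ _ => ?_
    rw [lintegral_indicator ((hSm x₀).prod (hSm x₀))]
    exact (hu x₀ u huc).2
  · rw [mul_assoc, mul_assoc 2, mul_assoc]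
    refine mul_le_mul_right ?_ _
    have e1 : ∫⁻ q, ‖u q.1‖ₑ ^ 2 ∂(σ.prod σ) = σ Set.univ * ∫⁻ x, ‖u x‖ₑ ^ 2 ∂σ := by
      rw [lintegral_prod _ (by fun_prop)]
      simp_rw [lintegral_const]
      rw [lintegral_mul_const _ (by fun_prop), mul_comm]
    have e2 : ∫⁻ q, ‖u q.2‖ₑ ^ 2 ∂(σ.prod σ) = σ Set.univ * ∫⁻ x, ‖u x‖ₑ ^ 2 ∂σ := by
      rw [lintegral_prod _ (by fun_prop)]
      dsimp only
      rw [lintegral_const, mul_comm]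
    rw [e1, e2, ← two_mul, mul_assoc (ENNReal.ofReal _), mul_assoc 2, mul_assoc (σ Set.univ)]
    exact mul_le_mul_right (mul_le_mul_right (mul_le_mul_right h1 _) _) _

theorem eLpNorm_le_of_Lp {F : Type*} [NormedAddCommGroup F] {μ : Measure (Sp d)}
    {u : Sp d → F} (hu : AEStronglyMeasurable u μ) (p : Lp F 2 μ) :
    eLpNorm u 2 μ ≤ eLpNorm (fun x => u x - p x) 2 μ + ‖p‖ₑ := by
  have h := eLpNorm_add_le (hu.sub (Lp.aestronglyMeasurable p)) (Lp.aestronglyMeasurable p)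
    (p := 2) (by norm_num)
  rw [sub_add_cancel] at h
  rw [Lp.enorm_def]
  exact h

theorem enorm_le_of_Lp {F : Type*} [NormedAddCommGroup F] {μ : Measure (Sp d)}
    {u : Sp d → F} (hu : AEStronglyMeasurable u μ) (p : Lp F 2 μ) :
    ‖p‖ₑ ≤ eLpNorm (fun x => u x - p x) 2 μ + eLpNorm u 2 μ := by
  have h := eLpNorm_sub_le hu (hu.sub (Lp.aestronglyMeasurable p)) (p := 2) (by norm_num)
  rw [sub_sub_cancel, add_comm] at h
  rw [Lp.enorm_def]
  exact h

theorem HHalf.norm_le (g : HHalf O) {a : ℝ} (h₁ : ‖g.1.fst‖ ≤ a) (h₂ : ‖g.1.snd‖ ≤ a) :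
    ‖g‖ ≤ 2 * a := by
  have h : ‖g‖ ^ 2 = ‖g.1.fst‖ ^ 2 + ‖g.1.snd‖ ^ 2 := WithLp.prod_norm_sq_eq_of_L2 g.1
  have := norm_nonneg g.1.fst
  have := norm_nonneg g.1.snd
  nlinarith [norm_nonneg g]

/-- The trace theorem. -/
theorem traceBounded (hd : 1 ≤ d) (hO : IsOpen O) (hb : Bornology.IsBounded O)
    (hL : HasLipschitzBoundary O) [IsFiniteMeasure (surfaceMeasure O)] : TraceBounded O := by
  obtain ⟨K, hK, hbound⟩ := exists_bound_of_contDiff hd hO hb hL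
  set σ := surfaceMeasure O
  set m := (volume : Measure (Sp d)).restrict O
  have hK1 : K + 1 ≠ ⊤ := ENNReal.add_ne_top.2 ⟨hK, by simp⟩
  -- K ≤ (K + 1)² avoids taking a square root of the constant.
  have hroot : ∀ {u : Sp d → ℂ} {a : ℝ≥0∞}, a ^ 2 ≤ K * sobolevEnergy O u →
      a ≤ (K + 1) * (eLpNorm u 2 m + eLpNorm (classicalGrad u) 2 m) := by
    intro u a h
    rw [sobolevEnergy, ← sq_eLpNorm_two, ← sq_eLpNorm_two] at h
    refine (ENNReal.pow_le_pow_left_iff two_ne_zero).1 (h.trans ?_)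
    rw [mul_pow]
    refine mul_le_mul' ?_ ?_
    · calc K ≤ (K + 1) * 1 := by rw [mul_one]; exact le_self_add
        _ ≤ (K + 1) * (K + 1) := mul_le_mul_right le_add_self _
        _ = _ := (sq _).symm
    · rw [add_sq]
      exact add_le_add_left le_self_add _
  refine ⟨2 * (K + 1).toReal, by positivity, fun p G g hpG htr => ?_⟩
  obtain ⟨G', hG', u, hu, hup, huG, hug⟩ := htr
  rw [← HasWeakGrad.unique hO hpG hG'] at huG
  have hlim : Tendsto (fun n => (K + 1) * ((eLpNorm (fun x => u n x - p x) 2 m + ‖p‖ₑ) +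
      (eLpNorm (fun x => classicalGrad (u n) x - G x) 2 m + ‖G‖ₑ))) atTop
      (𝓝 ((K + 1) * (‖p‖ₑ + ‖G‖ₑ))) := by
    have := ENNReal.Tendsto.const_mul ((hup.add_const ‖p‖ₑ).add (huG.add_const ‖G‖ₑ))
      (a := K + 1) (Or.inr hK1)
    simpa using this
  have hle : ∀ (n : ℕ) {a : ℝ≥0∞}, a ^ 2 ≤ K * sobolevEnergy O (u n) →
      a ≤ (K + 1) * ((eLpNorm (fun x => u n x - p x) 2 m + ‖p‖ₑ) +
        (eLpNorm (fun x => classicalGrad (u n) x - G x) 2 m + ‖G‖ₑ)) := fun n a ha => by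
    refine (hroot ha).trans (mul_le_mul_right (add_le_add ?_ ?_) _)
    · exact eLpNorm_le_of_Lp (hu n).continuous.aestronglyMeasurable p
    · exact eLpNorm_le_of_Lp (continuous_classicalGrad (hu n)).aestronglyMeasurable G
  have hreal : ∀ {X : Type _} [MeasurableSpace X] {μ : Measure X} (f : Lp ℂ 2 μ),
      ‖f‖ₑ ≤ (K + 1) * (‖p‖ₑ + ‖G‖ₑ) → ‖f‖ ≤ (K + 1).toReal * (‖p‖ + ‖G‖) := by
    intro X _ μ f hf
    have h := ENNReal.toReal_mono (ENNReal.mul_ne_top hK1 (by simp)) hf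
    rwa [ENNReal.toReal_mul, ENNReal.toReal_add (a := ‖p‖ₑ) (by simp) (by simp), toReal_enorm,
      toReal_enorm, toReal_enorm] at h
  rw [mul_assoc]
  refine HHalf.norm_le g (hreal _ ?_) (hreal _ ?_)
  · have h2 := hug.add hlim
    rw [zero_add] at h2
    refine ge_of_tendsto' h2 fun n => ?_
    refine (enorm_le_of_Lp (hu n).continuous.aestronglyMeasurable g.1.fst).trans
      (add_le_add le_rfl (hle n ?_))
    rw [sq_eLpNorm_two]
    exact (hbound (u n) (hu n)).1
  · obtain ⟨f, hf, hF⟩ := g.2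
    obtain ⟨ns, hns, hae⟩ := (tendstoInMeasure_of_tendsto_eLpNorm two_ne_zero
      (fun n => (hu n).continuous.aestronglyMeasurable) (Lp.aestronglyMeasurable g.1.fst)
      hug).exists_seq_tendsto_ae
    have hae' : ∀ᵐ x ∂σ, Tendsto (fun k => u (ns k) x) atTop (𝓝 (f x)) := by
      filter_upwards [hae, hf] with x hx hfx
      rwa [← hfx]
    have hlimq : ∀ᵐ q ∂σ.prod σ,
        Tendsto (fun k => diffQuot (u (ns k)) q) atTop (𝓝 (g.1.snd q)) := by
      filter_upwards [Measure.quasiMeasurePreserving_fst.ae hae',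
        Measure.quasiMeasurePreserving_snd.ae hae', hF] with q h1 h2 h3
      rw [h3]
      exact (h1.sub h2).div_const _
    -- The difference quotients converge only almost everywhere along a subsequence; Fatou's lemma
    -- carries the bound over to the seminorm of the limit.
    have hfat := Lp.eLpNorm_lim_le_liminf_eLpNorm (p := 2) (fun k =>
      (measurable_diffQuot (hu (ns k)).continuous.measurable).aestronglyMeasurable) _ hlimq
    rw [Lp.enorm_def]
    refine hfat.trans ?_
    rw [← (hlim.comp hns.tendsto_atTop).liminf_eq]
    refine liminf_le_liminf (Eventually.of_forall fun k => hle (ns k) ?_)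
    rw [sq_eLpNorm_two]
    exact (hbound _ (hu _)).2

end TraceBound

end Acoustic

end

noncomputable section

namespace Acoustic

/-! ## A bounded right inverse of the trace operator -/

section Kernel

open Metric
open scoped ContDiff Convolution

variable {d : ℕ}

/-- The regularized distance `(|z|² + ε²)^(1/2)`. -/
def regNorm (ε : ℝ) (z : Sp d) : ℝ := √(‖z‖ ^ 2 + ε ^ 2)

theorem sq_regNorm (ε : ℝ) (z : Sp d) : regNorm ε z ^ 2 = ‖z‖ ^ 2 + ε ^ 2 :=
  Real.sq_sqrt (by positivity)

theorem regNorm_pos {ε : ℝ} (hε : 0 < ε) (z : Sp d) : 0 < regNorm ε z :=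
  Real.sqrt_pos.2 (by positivity)

theorem norm_le_regNorm (ε : ℝ) (z : Sp d) : ‖z‖ ≤ regNorm ε z :=
  Real.le_sqrt_of_sq_le (by nlinarith [sq_nonneg ε])

theorem le_regNorm (ε : ℝ) (z : Sp d) : ε ≤ regNorm ε z :=
  Real.le_sqrt_of_sq_le (by nlinarith [sq_nonneg ‖z‖])

/-- The kernel `(|z|² + ε²)^{-d}`. -/
def kern (ε : ℝ) (z : Sp d) : ℝ := ((‖z‖ ^ 2 + ε ^ 2) ^ d)⁻¹

theorem kern_eq (ε : ℝ) (z : Sp d) : kern ε z = (regNorm ε z ^ (2 * d))⁻¹ := by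
  rw [kern, pow_mul, sq_regNorm]

theorem kern_pos {ε : ℝ} (hε : 0 < ε) (z : Sp d) : 0 < kern ε z := by
  unfold kern; positivity

theorem kern_le {ε : ℝ} (hε : 0 < ε) (z : Sp d) : kern ε z ≤ ((ε ^ 2) ^ d)⁻¹ := by
  unfold kern
  gcongr
  nlinarith [sq_nonneg ‖z‖]

theorem contDiff_kern {ε : ℝ} (hε : 0 < ε) : ContDiff ℝ ∞ (kern ε : Sp d → ℝ) := by
  unfold kern
  exact (((contDiff_norm_sq ℝ).add contDiff_const).pow d).inv fun z => by positivity

/-- The logarithmic derivative of the kernel is at most 2d over the regularized distance, so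
differentiating an average costs a factor 1/ρ. -/
theorem abs_fderiv_kern_le {ε ρ : ℝ} (hε : 0 < ε) (hρ : 0 < ρ) {z : Sp d} (hz : ρ ≤ regNorm ε z)
    (v : Sp d) : |fderiv ℝ (kern ε) z v| ≤ 2 * d / ρ * ‖v‖ * kern ε z := by
  set Q := ‖z‖ ^ 2 + ε ^ 2 with hQ
  have hQ0 : 0 < Q := by positivity
  have h1 : HasFDerivAt (fun z : Sp d => ‖z‖ ^ 2 + ε ^ 2) (2 • innerSL ℝ z) z :=
    (hasStrictFDerivAt_norm_sq z).hasFDerivAt.add_const _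
  have h2 : HasFDerivAt (kern ε) (-((d * Q ^ (d - 1)) / (Q ^ d) ^ 2) • (2 • innerSL ℝ z)) z := by
    have h3 := (((hasDerivAt_pow d Q).inv (pow_ne_zero d hQ0.ne'))).comp_hasFDerivAt z h1
    rw [neg_div] at h3
    exact h3
  rw [h2.fderiv]
  have h4 : (-((d * Q ^ (d - 1)) / (Q ^ d) ^ 2) • (2 • innerSL ℝ z)) v =
      -((d * Q ^ (d - 1)) / (Q ^ d) ^ 2) * (2 * inner ℝ z v) := by
    simp
  rw [h4, abs_mul, abs_neg, abs_of_nonneg (by positivity), abs_mul, abs_two]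
  have h5 : d * Q ^ (d - 1) / (Q ^ d) ^ 2 = d / Q * kern ε z := by
    rw [kern, ← hQ]
    rcases Nat.eq_zero_or_pos d with h0 | h0
    · simp [h0]
    · obtain ⟨n, rfl⟩ := Nat.exists_eq_add_of_le' h0
      rw [Nat.add_sub_cancel]
      field_simp
      exact (pow_succ Q n).symm
  have h6 : ‖z‖ / Q ≤ 1 / ρ := by
    rw [div_le_div_iff₀ hQ0 hρ, one_mul, hQ, ← sq_regNorm, sq]
    exact mul_le_mul (norm_le_regNorm ε z) hz hρ.le (regNorm_pos hε z).le
  have hk := (kern_pos hε z).le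
  rw [h5]
  calc d / Q * kern ε z * (2 * |inner ℝ z v|) ≤ d / Q * kern ε z * (2 * (‖z‖ * ‖v‖)) := by
        gcongr; exact abs_real_inner_le_norm z v
    _ = 2 * d * ‖v‖ * kern ε z * (‖z‖ / Q) := by ring
    _ ≤ 2 * d * ‖v‖ * kern ε z * (1 / ρ) := by gcongr
    _ = _ := by ring

theorem exists_cutoff (R : ℝ) (hR : 0 < R) : ∃ χ : Sp d → ℝ, ContDiff ℝ ∞ χ ∧ HasCompactSupport χ ∧
    (∀ x, 0 ≤ χ x ∧ χ x ≤ 1) ∧ (∀ x, ‖x‖ ≤ R → χ x = 1) ∧ ∀ x, 2 * R ≤ ‖x‖ → χ x = 0 := by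
  let χ : ContDiffBump (0 : Sp d) := ⟨R, 2 * R, hR, by linarith⟩
  refine ⟨χ, χ.contDiff, χ.hasCompactSupport, fun x => ⟨χ.nonneg, χ.le_one⟩, fun x hx => ?_,
    fun x hx => ?_⟩
  · exact χ.one_of_mem_closedBall (by simpa using hx)
  · exact χ.zero_of_le_dist (by simpa using hx)

theorem contDiff_integral_comp_sub {F : Type*} [NormedAddCommGroup F] [NormedSpace ℝ F]
    {μ : Measure (Sp d)} {K : Sp d → ℝ} (hK : ContDiff ℝ ∞ K) (hc : HasCompactSupport K)
    {f : Sp d → F} (hf : Integrable f μ) : ContDiff ℝ ∞ fun x => ∫ y, K (x - y) • f y ∂μ :=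
  hc.contDiff_convolution_right (μ := μ) ((ContinuousLinearMap.lsmul ℝ ℝ).flip : F →L[ℝ] ℝ →L[ℝ] F)
    hf.locallyIntegrable hK

theorem hasFDerivAt_integral_comp_sub {F : Type*} [NormedAddCommGroup F] [NormedSpace ℝ F]
    {μ : Measure (Sp d)} {K : Sp d → ℝ} (hK : ContDiff ℝ ∞ K)
    (hc : HasCompactSupport K) {f : Sp d → F} (hf : Integrable f μ) (x : Sp d) :
    Integrable (fun y => (fderiv ℝ K (x - y)).smulRight (f y)) μ ∧
    HasFDerivAt (fun x => ∫ y, K (x - y) • f y ∂μ)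
      (∫ y, (fderiv ℝ K (x - y)).smulRight (f y) ∂μ) x := by
  have hK' : Continuous (fderiv ℝ K) := hK.continuous_fderiv (by simp)
  obtain ⟨C, hC⟩ := (hc.fderiv (𝕜 := ℝ)).exists_bound_of_continuous hK'
  obtain ⟨C₀, hC₀⟩ := hc.exists_bound_of_continuous hK.continuous
  have hm : AEStronglyMeasurable (fun y => (fderiv ℝ K (x - y)).smulRight (f y)) μ := by
    have h1 : Continuous fun p : (Sp d →L[ℝ] ℝ) × F => p.1.smulRight p.2 := by fun_prop
    exact h1.comp_aestronglyMeasurable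
      (AEStronglyMeasurable.prodMk (by fun_prop) hf.aestronglyMeasurable)
  have hb : ∀ x y, ‖(fderiv ℝ K (x - y)).smulRight (f y)‖ ≤ C * ‖f y‖ := fun x y => by
    rw [ContinuousLinearMap.norm_smulRight_apply]
    exact mul_le_mul_of_nonneg_right (hC _) (norm_nonneg _)
  refine ⟨(hf.norm.const_mul C).mono' hm (Eventually.of_forall (hb x)), ?_⟩
  refine hasFDerivAt_integral_of_dominated_of_fderiv_le (bound := fun y => C * ‖f y‖)
    (F' := fun x y => (fderiv ℝ K (x - y)).smulRight (f y)) univ_mem ?_ ?_ hm ?_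
    (hf.norm.const_mul C) ?_
  · exact Eventually.of_forall fun x => (AEStronglyMeasurable.smul (by
      have := hK.continuous; fun_prop) hf.aestronglyMeasurable)
  · refine (hf.norm.const_mul C₀).mono' (AEStronglyMeasurable.smul (by
      have := hK.continuous; fun_prop) hf.aestronglyMeasurable) (Eventually.of_forall fun y => ?_)
    rw [norm_smul]
    exact mul_le_mul_of_nonneg_right (hC₀ _) (norm_nonneg _)
  · exact Eventually.of_forall fun y x _ => hb x y
  · refine Eventually.of_forall fun y x _ => ?_
    have h2 : HasFDerivAt (fun x => K (x - y)) (fderiv ℝ K (x - y)) x := by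
      have := ((hK.differentiable (by simp)) (x - y)).hasFDerivAt.comp x
        ((hasFDerivAt_id x).sub_const y)
      rwa [ContinuousLinearMap.comp_id] at this
    exact h2.smul_const (f y)

/-- The total mass of the kernel centered at `x`. -/
def kernMass (μ : Measure (Sp d)) (ε : ℝ) (x : Sp d) : ℝ := ∫ y, kern ε (x - y) ∂μ

/-- The probability measure with density proportional to the kernel centered at `x`. -/
def kernAvg (μ : Measure (Sp d)) (ε : ℝ) (x : Sp d) : Measure (Sp d) :=
  μ.withDensity fun y => ENNReal.ofReal (kern ε (x - y) / kernMass μ ε x)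

variable {μ : Measure (Sp d)} {ε : ℝ}

theorem continuous_kern (hε : 0 < ε) : Continuous (kern ε : Sp d → ℝ) := (contDiff_kern hε).continuous

theorem integrable_kern_smul {F : Type*} [NormedAddCommGroup F] [NormedSpace ℝ F] (hε : 0 < ε)
    (x : Sp d) {f : Sp d → F} (hf : Integrable f μ) :
    Integrable (fun y => kern ε (x - y) • f y) μ := by
  have := continuous_kern (d := d) hε
  refine (hf.norm.const_mul ((ε ^ 2) ^ d)⁻¹).mono' (AEStronglyMeasurable.smul (by fun_prop)
    hf.aestronglyMeasurable) (Eventually.of_forall fun y => ?_)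
  rw [norm_smul, Real.norm_of_nonneg (kern_pos hε _).le]
  exact mul_le_mul_of_nonneg_right (kern_le hε _) (norm_nonneg _)

theorem measurable_kernDensity (hε : 0 < ε) (x : Sp d) :
    Measurable fun y => ENNReal.ofReal (kern ε (x - y) / kernMass μ ε x) := by
  have := (continuous_kern (d := d) hε).measurable
  fun_prop

theorem lintegral_kernAvg (hε : 0 < ε) (x : Sp d) {g : Sp d → ℝ≥0∞} (hg : AEMeasurable g μ) :
    ∫⁻ y, g y ∂(kernAvg μ ε x) =
      ∫⁻ y, ENNReal.ofReal (kern ε (x - y) / kernMass μ ε x) * g y ∂μ :=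
  lintegral_withDensity_eq_lintegral_mul₀ (measurable_kernDensity hε x).aemeasurable hg

variable [IsFiniteMeasure μ]

theorem integrable_kern (hε : 0 < ε) (x : Sp d) : Integrable (fun y => kern ε (x - y)) μ := by
  simpa using integrable_kern_smul hε x (integrable_const (1 : ℝ) (μ := μ))

theorem kernMass_pos [NeZero μ] (hε : 0 < ε) (x : Sp d) : 0 < kernMass μ ε x := by
  refine (integral_pos_iff_support_of_nonneg (fun y => (kern_pos hε _).le)
    (integrable_kern hε x)).2 ?_
  have : Function.support (fun y => kern ε (x - y)) = Set.univ :=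
    Set.eq_univ_of_forall fun y => (kern_pos hε _).ne'
  rw [this]
  exact pos_iff_ne_zero.2 (Measure.measure_univ_ne_zero.2 (NeZero.ne μ))

theorem isProbabilityMeasure_kernAvg [NeZero μ] (hε : 0 < ε) (x : Sp d) :
    IsProbabilityMeasure (kernAvg μ ε x) := by
  have hN := kernMass_pos (μ := μ) hε x
  constructor
  rw [kernAvg, withDensity_apply _ MeasurableSet.univ, setLIntegral_univ,
    ← ofReal_integral_eq_lintegral_ofReal ((integrable_kern hε x).div_const _)
    (Eventually.of_forall fun y => div_nonneg (kern_pos hε _).le hN.le), integral_div]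
  change ENNReal.ofReal (kernMass μ ε x / _) = 1
  rw [div_self hN.ne', ENNReal.ofReal_one]

variable {F : Type*} [NormedAddCommGroup F] [NormedSpace ℝ F]

theorem integral_kernAvg [NeZero μ] (hε : 0 < ε) (x : Sp d) (f : Sp d → F) :
    ∫ y, f y ∂(kernAvg μ ε x) = (kernMass μ ε x)⁻¹ • ∫ y, kern ε (x - y) • f y ∂μ := by
  have hN := kernMass_pos (μ := μ) hε x
  rw [kernAvg, integral_withDensity_eq_integral_toReal_smul (measurable_kernDensity hε x)
    (Eventually.of_forall fun y => ENNReal.ofReal_lt_top), ← integral_smul]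
  refine integral_congr_ae (Eventually.of_forall fun y => ?_)
  dsimp only
  rw [ENNReal.toReal_ofReal (div_nonneg (kern_pos hε _).le hN.le), smul_smul, div_eq_inv_mul]

theorem integrable_kernAvg [NeZero μ] (hε : 0 < ε) (x : Sp d) {f : Sp d → F}
    (hf : Integrable f μ) : Integrable f (kernAvg μ ε x) := by
  have hN := kernMass_pos (μ := μ) hε x
  rw [kernAvg, integrable_withDensity_iff_integrable_smul' (measurable_kernDensity hε x)
    (Eventually.of_forall fun y => ENNReal.ofReal_lt_top)]
  refine ((integrable_kern_smul hε x hf).smul (kernMass μ ε x)⁻¹).congr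
    (Eventually.of_forall fun y => ?_)
  dsimp only [Pi.smul_apply]
  rw [ENNReal.toReal_ofReal (div_nonneg (kern_pos hε _).le hN.le), smul_smul, div_eq_inv_mul]

/-- The averages of `f` with respect to the kernel extend smoothly to the whole space. -/
theorem exists_smooth_average [NeZero μ] (hε : 0 < ε) {R : ℝ} (hR : 0 < R)
    (hμ : ∀ᵐ y ∂μ, ‖y‖ ≤ R) {f : Sp d → ℂ} (hf : Integrable f μ) :
    ∃ u : Sp d → ℂ, ContDiff ℝ ∞ u ∧ ∀ x, ‖x‖ ≤ R → u x = ∫ y, f y ∂(kernAvg μ ε x) ∧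
      ∀ ρ : ℝ, 0 < ρ → (∀ᵐ y ∂μ, ρ ≤ regNorm ε (x - y)) → ∀ v : Sp d,
        ‖fderiv ℝ u x v‖ₑ ≤ ENNReal.ofReal (2 * d / ρ * ‖v‖) *
          ∫⁻ y, ‖f y - u x‖ₑ ∂(kernAvg μ ε x) := by
  -- χ makes the kernel compactly supported without changing it at x - y for ‖x‖ < 4R and ‖y‖ ≤ R. θ
  -- is 1 up to 2R and 0 beyond 4R, so that N + 1 - θ is a nowhere vanishing denominator equal to N
  -- near the domain.
  obtain ⟨χ, hχ, hχc, hχ01, hχ1, -⟩ := exists_cutoff (d := d) (6 * R) (by positivity)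
  obtain ⟨θ, hθ, -, hθ01, hθ1, hθ0⟩ := exists_cutoff (d := d) (2 * R) (by positivity)
  let K : Sp d → ℝ := fun z => χ z * kern ε z
  have hK : ContDiff ℝ ∞ K := hχ.mul (contDiff_kern hε)
  have hKc : HasCompactSupport K := hχc.mul_right
  have hK1 : ∀ z, ‖z‖ ≤ 6 * R → K z = kern ε z := fun z hz => by simp [K, hχ1 z hz]
  have hK0 : ∀ z, 0 ≤ K z := fun z => mul_nonneg (hχ01 z).1 (kern_pos hε z).le
  have hone : Integrable (fun _ : Sp d => (1 : ℝ)) μ := integrable_const 1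
  let A : Sp d → ℂ := fun x => ∫ y, K (x - y) • f y ∂μ
  let N : Sp d → ℝ := fun x => ∫ y, K (x - y) • (1 : ℝ) ∂μ
  have hA : ContDiff ℝ ∞ A := contDiff_integral_comp_sub hK hKc hf
  have hN : ContDiff ℝ ∞ N := contDiff_integral_comp_sub hK hKc hone
  have hsub : ∀ x : Sp d, ‖x‖ < 4 * R → ∀ᵐ y ∂μ, ‖x - y‖ < 6 * R := fun x hx => by
    filter_upwards [hμ] with y hy
    linarith [norm_sub_le x y]
  have hN1 : ∀ x, ‖x‖ < 4 * R → N x = kernMass μ ε x := fun x hx => by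
    refine integral_congr_ae ?_
    filter_upwards [hsub x hx] with y hy
    rw [hK1 _ hy.le, smul_eq_mul, mul_one]
  have hA1 : ∀ x, ‖x‖ < 4 * R → A x = ∫ y, kern ε (x - y) • f y ∂μ := fun x hx => by
    refine integral_congr_ae ?_
    filter_upwards [hsub x hx] with y hy
    rw [hK1 _ hy.le]
  have hD : ∀ x, N x + (1 - θ x) ≠ 0 := fun x => by
    have h1 := (hθ01 x).2
    rcases lt_or_ge ‖x‖ (4 * R) with h | h
    · have := kernMass_pos (μ := μ) hε x
      rw [hN1 x h]; linarith
    · have h0 : 0 ≤ N x := integral_nonneg fun y => by simpa using hK0 _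
      rw [hθ0 x (by linarith)]; linarith
  let u : Sp d → ℂ := fun x => (N x + (1 - θ x))⁻¹ • A x
  have hu : ContDiff ℝ ∞ u := ((hN.add (contDiff_const.sub hθ)).inv hD).smul hA
  have hu1 : ∀ x, ‖x‖ < 2 * R → u x = (N x)⁻¹ • A x := fun x hx => by
    simp [u, hθ1 x hx.le]
  refine ⟨u, hu, fun x hx => ?_⟩
  have hx2 : ‖x‖ < 2 * R := by linarith
  have hx4 : ‖x‖ < 4 * R := by linarith
  have hmass := kernMass_pos (μ := μ) hε x
  have hux : u x = ∫ y, f y ∂(kernAvg μ ε x) := by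
    rw [hu1 x hx2, hN1 x hx4, hA1 x hx4, integral_kernAvg hε]
  refine ⟨hux, fun ρ hρ hρr v => ?_⟩
  -- Differentiating A = N u expresses N Du as the integral of DK(x - y)(f(y) - u(x)). Only
  -- differences of f enter, which leads to the seminorm.
  have hev : A =ᶠ[𝓝 x] fun z => N z • u z := by
    filter_upwards [(isOpen_lt continuous_norm continuous_const).mem_nhds hx2] with z hz
    have hz' : ‖z‖ < 2 * R := hz
    rw [hu1 z hz', smul_smul, mul_inv_cancel₀, one_smul]
    rw [hN1 z (by linarith)]
    exact (kernMass_pos hε z).ne'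
  obtain ⟨hiA, hdA⟩ := hasFDerivAt_integral_comp_sub hK hKc hf x
  obtain ⟨hiN, hdN⟩ := hasFDerivAt_integral_comp_sub hK hKc hone x
  have hd := ((hdN.smul ((hu.differentiable (by simp)) x).hasFDerivAt).congr_of_eventuallyEq
    hev).unique hdA
  have hdv := congrArg (fun T : Sp d →L[ℝ] ℂ => T v) hd
  simp only [add_apply, smul_apply,
    ContinuousLinearMap.smulRight_apply, ContinuousLinearMap.integral_apply hiA,
    ContinuousLinearMap.integral_apply hiN] at hdv
  change N x • fderiv ℝ u x v + _ = _ at hdv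
  simp only [smul_eq_mul, mul_one] at hdv
  have hi1 : Integrable (fun y => fderiv ℝ K (x - y) v • f y) μ := by
    simpa using hiA.apply_continuousLinearMap v
  have hi2 : Integrable (fun y => fderiv ℝ K (x - y) v) μ := by
    simpa using hiN.apply_continuousLinearMap v
  have hrep : fderiv ℝ u x v =
      (kernMass μ ε x)⁻¹ • ∫ y, fderiv ℝ K (x - y) v • (f y - u x) ∂μ := by
    simp_rw [smul_sub]
    rw [integral_sub hi1 (hi2.smul_const _), ← hdv, integral_smul_const, hN1 x hx4]
    rw [add_sub_cancel_right, smul_smul, inv_mul_cancel₀ hmass.ne', one_smul]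
  have hbd : ∀ᵐ y ∂μ, ‖(kernMass μ ε x)⁻¹ • fderiv ℝ K (x - y) v • (f y - u x)‖ₑ ≤
      ENNReal.ofReal (2 * d / ρ * ‖v‖) *
        (ENNReal.ofReal (kern ε (x - y) / kernMass μ ε x) * ‖f y - u x‖ₑ) := by
    filter_upwards [hsub x hx4, hρr] with y hy hyρ
    have h1 : K =ᶠ[𝓝 (x - y)] kern ε := by
      filter_upwards [(isOpen_lt continuous_norm continuous_const).mem_nhds hy] with z hz
      exact hK1 z (le_of_lt hz)
    have h2 := abs_fderiv_kern_le hε hρ hyρ v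
    rw [h1.fderiv_eq, smul_smul, enorm_smul, ← mul_assoc, ← ENNReal.ofReal_mul (by positivity)]
    refine mul_le_mul_left ?_ _
    rw [← ofReal_norm, Real.norm_eq_abs, abs_mul, abs_of_pos (inv_pos.2 hmass)]
    refine ENNReal.ofReal_le_ofReal ?_
    calc _ ≤ (kernMass μ ε x)⁻¹ * (2 * d / ρ * ‖v‖ * kern ε (x - y)) :=
          mul_le_mul_of_nonneg_left h2 (inv_pos.2 hmass).le
      _ = _ := by ring
  rw [hrep, ← integral_smul]
  refine (enorm_integral_le_lintegral_enorm _).trans ((lintegral_mono_ae hbd).trans ?_)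
  rw [lintegral_const_mul' _ _ ENNReal.ofReal_ne_top, lintegral_kernAvg hε]
  exact (hf.aestronglyMeasurable.sub aestronglyMeasurable_const).enorm

end Kernel

end Acoustic

end

noncomputable section

namespace Acoustic

/-! ### Pointwise and integral estimates for the averaging kernels -/

section KernelEstimates

open Metric

variable {d : ℕ} {O : Set (Sp d)}

/-- Here ρ = √(δ² + ε²) with δ the distance of x to the boundary. On the ball of radius ρ about a
nearest boundary point the kernel is at least (4ρ²)^{-d}, and that ball has surface measure at least
cρ^{d-1}; so the total mass is at least of order ρ^{-(d+1)}. -/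
theorem exists_kern_div_le (hd : 1 ≤ d) (hO : IsOpen O) (hb : Bornology.IsBounded O)
    (hL : HasLipschitzBoundary O) [IsFiniteMeasure (surfaceMeasure O)]
    [NeZero (surfaceMeasure O)] (hne : (frontier O).Nonempty) {R : ℝ}
    (hR : ∀ y ∈ frontier O, ‖y‖ ≤ R) : ∃ C : ℝ, 0 < C ∧ ∀ ε, 0 < ε → ε ≤ 1 → ∀ x, ‖x‖ ≤ R →
      ∃ ρ, 0 < ρ ∧ (∀ y ∈ frontier O, ρ ≤ regNorm ε (x - y)) ∧ (x ∈ frontier O → ρ = ε) ∧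
        ∀ y, kern ε (x - y) / kernMass (surfaceMeasure O) ε x ≤
          C * (ρ ^ (d + 1) * kern ε (x - y)) := by
  obtain ⟨c, hc, hlow⟩ := exists_lower_regularity hd hO hb hL (2 * R + 1)
  set σ := surfaceMeasure O
  refine ⟨4 ^ d / c, by positivity, fun ε hε hε1 x hx => ?_⟩
  obtain ⟨y₀, hy₀, hy₀d⟩ := (isCompact_frontier_of_isBounded hb).exists_infDist_eq_dist hne x
  set δ := ‖x - y₀‖ with hδ
  have hδd : infDist x (frontier O) = δ := by rw [hy₀d, dist_eq_norm]
  set ρ := √(δ ^ 2 + ε ^ 2) with hρ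
  have hρ2 : ρ ^ 2 = δ ^ 2 + ε ^ 2 := Real.sq_sqrt (by positivity)
  have hρ0 : 0 < ρ := Real.sqrt_pos.2 (by positivity)
  have hδ0 : 0 ≤ δ := norm_nonneg _
  refine ⟨ρ, hρ0, fun y hy => ?_, fun hxf => ?_, fun y => ?_⟩
  · refine Real.sqrt_le_sqrt ?_
    have h1 : δ ≤ ‖x - y‖ := by
      rw [← hδd, ← dist_eq_norm]; exact infDist_le_dist_of_mem hy
    gcongr
  · have h1 : δ = 0 := by rw [← hδd]; exact infDist_zero_of_mem hxf
    rw [hρ, h1, zero_pow two_ne_zero, zero_add, Real.sqrt_sq hε.le]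
  have hρR : ρ ≤ 2 * R + 1 := by
    have h1 : δ ≤ 2 * R := by linarith [norm_sub_le x y₀, hR y₀ hy₀]
    nlinarith
  have hmass : (4 ^ d)⁻¹ * c * (ρ ^ (d + 1))⁻¹ ≤ kernMass σ ε x := by
    have h1 : ∀ y ∈ closedBall y₀ ρ, ((4 * ρ ^ 2) ^ d)⁻¹ ≤ kern ε (x - y) := fun y hy => by
      unfold kern
      have h2 : ‖x - y‖ ≤ δ + ρ := by
        have h3 := norm_sub_le_norm_sub_add_norm_sub x y₀ y
        rw [mem_closedBall', dist_eq_norm] at hy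
        linarith
      have h4 : ‖x - y‖ ^ 2 + ε ^ 2 ≤ 4 * ρ ^ 2 := by
        nlinarith [norm_nonneg (x - y), sq_nonneg (δ - ρ)]
      gcongr
    have h2 : ((4 * ρ ^ 2) ^ d)⁻¹ * σ.real (closedBall y₀ ρ) ≤ kernMass σ ε x := by
      calc _ = ∫ _ in closedBall y₀ ρ, ((4 * ρ ^ 2) ^ d)⁻¹ ∂σ := by
            rw [setIntegral_const, smul_eq_mul, mul_comm]
        _ ≤ ∫ y in closedBall y₀ ρ, kern ε (x - y) ∂σ :=
            setIntegral_mono_on (integrable_const _).integrableOn (integrable_kern hε x).integrableOn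
              isClosed_closedBall.measurableSet h1
        _ ≤ _ := setIntegral_le_integral (integrable_kern hε x)
            (Eventually.of_forall fun y => (kern_pos hε _).le)
    have h3 : c * ρ ^ (d - 1) ≤ σ.real (closedBall y₀ ρ) :=
      (ENNReal.ofReal_le_iff_le_toReal (measure_ne_top _ _)).1 (hlow y₀ hy₀ ρ hρ0 hρR)
    refine le_trans (le_of_eq ?_) ((mul_le_mul_of_nonneg_left h3 (by positivity)).trans h2)
    obtain ⟨n, rfl⟩ := Nat.exists_eq_add_of_le' hd
    rw [Nat.add_sub_cancel, mul_pow]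
    field_simp
    ring
  have hpos : 0 < (4 ^ d)⁻¹ * c * (ρ ^ (d + 1))⁻¹ := by positivity
  calc kern ε (x - y) / kernMass σ ε x ≤ kern ε (x - y) / ((4 ^ d)⁻¹ * c * (ρ ^ (d + 1))⁻¹) :=
        div_le_div_of_nonneg_left (kern_pos hε _).le hpos hmass
    _ = _ := by field_simp

/-- Used for the L² bound of the extension: the right side is locally integrable in ℝ^d, and ε has
disappeared. -/
theorem ofReal_kern_le_of_le {ε ρ : ℝ} (hd : 1 ≤ d) (hε : 0 < ε) (hρ : 0 < ρ) {z : Sp d}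
    (hz : ρ ≤ regNorm ε z) :
    ENNReal.ofReal (ρ ^ (d + 1) * kern ε z) ≤ (‖z‖ₑ ^ (d - 1))⁻¹ := by
  have hr := regNorm_pos hε z
  rw [ENNReal.le_inv_iff_mul_le, ← ofReal_norm, ← ENNReal.ofReal_pow (norm_nonneg _),
    ← ENNReal.ofReal_mul (mul_nonneg (by positivity) (kern_pos hε z).le), ← ENNReal.ofReal_one]
  refine ENNReal.ofReal_le_ofReal ?_
  rw [kern_eq, mul_right_comm, ← div_eq_mul_inv, div_le_one (by positivity)]
  calc ρ ^ (d + 1) * ‖z‖ ^ (d - 1) ≤ regNorm ε z ^ (d + 1) * regNorm ε z ^ (d - 1) := by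
        gcongr; exact norm_le_regNorm ε z
    _ = _ := by rw [← pow_add]; congr 1; omega

/-- Used on the boundary, where ρ = ε: one power of ε is left over, next to the kernel of the
Slobodeckij seminorm, and gives convergence to f. -/
theorem ofReal_kern_le_mul {ε : ℝ} (hε : 0 < ε) (z : Sp d) :
    ENNReal.ofReal (ε ^ (d + 1) * kern ε z) ≤ ENNReal.ofReal ε * (‖z‖ₑ ^ d)⁻¹ := by
  have hr := regNorm_pos hε z
  rw [pow_succ', mul_assoc, ENNReal.ofReal_mul hε.le]
  refine mul_le_mul_right ?_ _
  rw [ENNReal.le_inv_iff_mul_le, ← ofReal_norm, ← ENNReal.ofReal_pow (norm_nonneg _),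
    ← ENNReal.ofReal_mul (mul_nonneg (by positivity) (kern_pos hε z).le), ← ENNReal.ofReal_one]
  refine ENNReal.ofReal_le_ofReal ?_
  rw [kern_eq, mul_right_comm, ← div_eq_mul_inv, div_le_one (by positivity)]
  calc ε ^ d * ‖z‖ ^ d ≤ regNorm ε z ^ d * regNorm ε z ^ d := by
        gcongr
        · exact le_regNorm ε z
        · exact norm_le_regNorm ε z
    _ = _ := by rw [← pow_add, two_mul]

/-- Used for the gradient. With r, r' the regularized distances, ‖z‖ + ‖z - z'‖ ≤ 2r + r' and ρ ≤ r,
r' give sρ ≤ 3rr'; the power 2d of this turns into the factor 9^d. -/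
theorem ofReal_kern_mul_kern_le {ε ρ : ℝ} (hε : 0 < ε) (hρ : 0 < ρ) {z z' : Sp d}
    (hz : ρ ≤ regNorm ε z) (hz' : ρ ≤ regNorm ε z') :
    ENNReal.ofReal ((1 / ρ) ^ 2 * (ρ ^ (d + 1) * kern ε z) * (ρ ^ (d + 1) * kern ε z')) ≤
      ENNReal.ofReal (9 ^ d) * ((‖z‖ₑ + ‖z - z'‖ₑ) ^ (2 * d))⁻¹ := by
  have hr := regNorm_pos hε z
  have hr' := regNorm_pos hε z'
  have hk := kern_pos hε z
  have hk' := kern_pos hε z'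
  set r := regNorm ε z
  set r' := regNorm ε z'
  set s := ‖z‖ + ‖z - z'‖ with hs
  have hs0 : 0 ≤ s := by positivity
  have h1 : s * ρ ≤ 3 * (r * r') := by
    have h2 : s ≤ 2 * r + r' := by
      linarith [norm_sub_le z z', norm_le_regNorm ε z, norm_le_regNorm ε z']
    nlinarith
  have h3 : ‖z‖ₑ + ‖z - z'‖ₑ = ENNReal.ofReal s := by
    rw [hs, ENNReal.ofReal_add (norm_nonneg _) (norm_nonneg _), ofReal_norm, ofReal_norm]
  rw [h3, ← ENNReal.ofReal_pow hs0, ← div_eq_mul_inv, ENNReal.le_div_iff_mul_le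
    (Or.inr (by simp)) (Or.inl ENNReal.ofReal_ne_top), ← ENNReal.ofReal_mul (by positivity)]
  refine ENNReal.ofReal_le_ofReal ?_
  have h4 : (1 / ρ) ^ 2 * (ρ ^ (d + 1) * kern ε z) * (ρ ^ (d + 1) * kern ε z') * s ^ (2 * d) =
      (s * ρ) ^ (2 * d) / (r * r') ^ (2 * d) := by
    rw [show kern ε z = (r ^ (2 * d))⁻¹ from kern_eq ε z,
      show kern ε z' = (r' ^ (2 * d))⁻¹ from kern_eq ε z', mul_pow, mul_pow]
    field_simp
    ring
  rw [h4, div_le_iff₀ (by positivity)]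
  calc (s * ρ) ^ (2 * d) ≤ (3 * (r * r')) ^ (2 * d) := by gcongr
    _ = _ := by rw [mul_pow, pow_mul 3]; norm_num

/-- In polar coordinates the weight cancels the Jacobian t^{d-1}. -/
theorem exists_lintegral_inv_norm_le (hd : 1 ≤ d) (R : ℝ) : ∃ C : ℝ≥0∞, C ≠ ∞ ∧
    ∀ y : Sp d, ‖y‖ ≤ R → ∫⁻ x in closedBall (0 : Sp d) R, (‖x - y‖ₑ ^ (d - 1))⁻¹ ≤ C := by
  have : Nontrivial (Sp d) := Module.nontrivial_of_finrank_pos (R := ℝ) (by simp; omega)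
  have h1 : IntegrableOn (fun z : Sp d => (‖z‖ ^ (d - 1))⁻¹) (ball 0 (2 * R + 1)) := by
    refine (integrableOn_fun_norm_addHaar volume (f := fun t : ℝ => (t ^ (d - 1))⁻¹)).2 ?_
    refine (integrableOn_const (C := (1 : ℝ)) (s := Set.Ioo (0 : ℝ) (2 * R + 1))
      (by simp)).congr_fun (fun t ht => ?_) measurableSet_Ioo
    rw [finrank_euclideanSpace, Fintype.card_fin, smul_eq_mul,
      mul_inv_cancel₀ (pow_ne_zero _ ht.1.ne')]
  refine ⟨∫⁻ z in ball (0 : Sp d) (2 * R + 1), (‖z‖ₑ ^ (d - 1))⁻¹, ?_, fun y hy => ?_⟩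
  · refine ne_of_lt (lt_of_le_of_lt (le_of_eq ?_) h1.2)
    refine setLIntegral_congr_fun_ae measurableSet_ball ?_
    have : ∀ᵐ z : Sp d, z ≠ 0 := by simp [ae_iff]
    filter_upwards [this] with z hz _
    have h0 : 0 < ‖z‖ := norm_pos_iff.2 hz
    rw [← ofReal_norm, ← ofReal_norm, Real.norm_of_nonneg (by positivity),
      ENNReal.ofReal_inv_of_pos (by positivity), ENNReal.ofReal_pow h0.le]
  · rw [← lintegral_indicator isClosed_closedBall.measurableSet,
      ← lintegral_indicator measurableSet_ball, ← lintegral_sub_right_eq_self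
        ((ball (0 : Sp d) (2 * R + 1)).indicator fun z => (‖z‖ₑ ^ (d - 1))⁻¹) y]
    refine lintegral_mono fun x => ?_
    by_cases hx : x ∈ closedBall (0 : Sp d) R
    · rw [Set.indicator_of_mem hx, Set.indicator_of_mem]
      rw [mem_ball_zero_iff]
      rw [mem_closedBall_zero_iff] at hx
      linarith [norm_sub_le x y]
    · rw [Set.indicator_of_notMem hx]; exact zero_le

/-- Homogeneity: x = ‖a‖x' reduces the integral to that of (1 + ‖x'‖)^{-2d}, finite because 2d > d.
-/
theorem exists_lintegral_inv_add_norm_le (hd : 1 ≤ d) : ∃ C : ℝ≥0∞, C ≠ ∞ ∧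
    ∀ a : Sp d, a ≠ 0 → ∫⁻ x : Sp d, ((‖x‖ₑ + ‖a‖ₑ) ^ (2 * d))⁻¹ ≤ C * (‖a‖ₑ ^ d)⁻¹ := by
  have h1 : ∫⁻ x : Sp d, ENNReal.ofReal ((1 + ‖x‖) ^ (-((2 * d : ℕ) : ℝ))) < ∞ :=
    finite_integral_one_add_norm (by
      rw [finrank_euclideanSpace, Fintype.card_fin]; exact_mod_cast (by omega : d < 2 * d))
  refine ⟨_, h1.ne, fun a ha => ?_⟩
  have ha0 : 0 < ‖a‖ := norm_pos_iff.2 ha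
  have hae : ‖a‖ₑ ≠ 0 := by simpa using ha
  have h2 := lintegral_comp_smul_eq ha0 (H := fun x : Sp d => ((‖x‖ₑ + ‖a‖ₑ) ^ (2 * d))⁻¹)
    (by fun_prop)
  have h3 : ∀ x : Sp d, ((‖‖a‖ • x‖ₑ + ‖a‖ₑ) ^ (2 * d))⁻¹ =
      (‖a‖ₑ ^ (2 * d))⁻¹ * ENNReal.ofReal ((1 + ‖x‖) ^ (-((2 * d : ℕ) : ℝ))) := fun x => by
    rw [enorm_smul, enorm_norm, ← mul_add_one, mul_pow, ENNReal.mul_inv (by simp) (by simp),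
      Real.rpow_neg (by positivity), Real.rpow_natCast,
      ENNReal.ofReal_inv_of_pos (by positivity), ENNReal.ofReal_pow (by positivity),
      ENNReal.ofReal_add zero_le_one (norm_nonneg _), ofReal_norm, ENNReal.ofReal_one,
      add_comm ‖x‖ₑ]
  simp_rw [h3] at h2
  rw [lintegral_const_mul' _ _ (ENNReal.inv_ne_top.2 (pow_ne_zero _ hae)),
    ENNReal.ofReal_inv_of_pos (by positivity), ENNReal.ofReal_pow ha0.le, ofReal_norm] at h2
  have h4 : ∫⁻ x : Sp d, ((‖x‖ₑ + ‖a‖ₑ) ^ (2 * d))⁻¹ =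
      ‖a‖ₑ ^ d * ((‖a‖ₑ ^ d)⁻¹ * ∫⁻ x : Sp d, ((‖x‖ₑ + ‖a‖ₑ) ^ (2 * d))⁻¹) := by
    rw [← mul_assoc, ENNReal.mul_inv_cancel (pow_ne_zero _ hae) (by simp), one_mul]
  rw [h4, ← h2, ← mul_assoc, mul_comm _ (‖a‖ₑ ^ d)⁻¹]
  refine mul_le_mul_left (le_of_eq ?_) _
  rw [two_mul, pow_add, ENNReal.mul_inv (by simp) (by simp), ← mul_assoc,
    ENNReal.mul_inv_cancel (pow_ne_zero _ hae) (by simp), one_mul]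

/-- Jensen's inequality for the square, obtained from Cauchy-Schwarz. -/
theorem enorm_sub_integral_sq_le {X : Type*} [MeasurableSpace X] {m : Measure X}
    [IsProbabilityMeasure m] {f : X → ℂ} (hf : Integrable f m) (c : ℂ) :
    ‖c - ∫ y, f y ∂m‖ₑ ^ 2 ≤ ∫⁻ y, ‖c - f y‖ₑ ^ 2 ∂m := by
  have h1 : c - ∫ y, f y ∂m = ∫ y, (c - f y) ∂m := by
    rw [integral_sub (integrable_const c) hf, integral_const]; simp
  rw [h1]
  refine (pow_le_pow_left₀ zero_le (enorm_integral_le_lintegral_enorm _) 2).trans ?_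
  have := sq_lintegral_le (aestronglyMeasurable_const.sub
    hf.aestronglyMeasurable : AEStronglyMeasurable (fun y => c - f y) m).enorm
  rwa [measure_univ, one_mul] at this

end KernelEstimates

end Acoustic

end

noncomputable section

namespace Acoustic

/-! ### Smooth extensions, bounded uniformly in ε -/

section Lifting

open Metric
open scoped ContDiff

variable {d : ℕ} {O : Set (Sp d)}

/-- The squared Sobolev–Slobodeckij seminorm. -/
def slobodeckij (O : Set (Sp d)) (f : Sp d → ℂ) : ℝ≥0∞ :=
  ∫⁻ y, ∫⁻ y', ‖f y - f y'‖ₑ ^ 2 * (‖y - y'‖ₑ ^ d)⁻¹ ∂(surfaceMeasure O) ∂(surfaceMeasure O)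

theorem enorm_sq_classicalGrad_le {u : Sp d → ℂ} {x : Sp d} {a : ℝ≥0∞}
    (h : ∀ v : Sp d, ‖v‖ = 1 → ‖fderiv ℝ u x v‖ₑ ^ 2 ≤ a) : ‖classicalGrad u x‖ₑ ^ 2 ≤ d * a := by
  have h1 : ‖classicalGrad u x‖ₑ ^ 2 = ∑ i, ‖partialD i u x‖ₑ ^ 2 := by
    rw [← ofReal_norm, ← ENNReal.ofReal_pow (norm_nonneg _), EuclideanSpace.norm_sq_eq,
      ENNReal.ofReal_sum_of_nonneg fun i _ => by positivity]
    refine Finset.sum_congr rfl fun i _ => ?_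
    rw [ENNReal.ofReal_pow (norm_nonneg _), ofReal_norm]
    rfl
  rw [h1]
  refine (Finset.sum_le_sum fun i _ => h _ (by simp)).trans ?_
  simp

/-- Smooth approximations of the extension of a boundary function. -/
theorem exists_smooth_extension (hd : 1 ≤ d) (hO : IsOpen O) (hb : Bornology.IsBounded O)
    (hL : HasLipschitzBoundary O) [IsFiniteMeasure (surfaceMeasure O)]
    [NeZero (surfaceMeasure O)] (hne : (frontier O).Nonempty) :
    ∃ C : ℝ≥0∞, C ≠ ⊤ ∧ ∀ f : Sp d → ℂ, Measurable f → Integrable f (surfaceMeasure O) →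
      ∀ ε, 0 < ε → ε ≤ 1 → ∃ u : Sp d → ℂ, ContDiff ℝ ∞ u ∧
        (∫⁻ x in O, ‖u x‖ₑ ^ 2) ≤ C * ∫⁻ y, ‖f y‖ₑ ^ 2 ∂(surfaceMeasure O) ∧
        (∫⁻ x in O, ‖classicalGrad u x‖ₑ ^ 2) ≤ C * slobodeckij O f ∧
        (∫⁻ x, ‖f x - u x‖ₑ ^ 2 ∂(surfaceMeasure O)) ≤
          ENNReal.ofReal ε * (C * slobodeckij O f) := by
  obtain ⟨R, hR0, hRO⟩ : ∃ R : ℝ, 0 < R ∧ closure O ⊆ closedBall 0 R := by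
    obtain ⟨R, hR⟩ := hb.closure.subset_closedBall 0
    exact ⟨max R 1, lt_max_of_lt_right one_pos, hR.trans (closedBall_subset_closedBall (le_max_left _ _))⟩
  have hRx : ∀ x ∈ closure O, ‖x‖ ≤ R := fun x hx => mem_closedBall_zero_iff.1 (hRO hx)
  have hRf : ∀ y ∈ frontier O, ‖y‖ ≤ R := fun y hy => hRx y (frontier_subset_closure hy)
  obtain ⟨c, hc, hw⟩ := exists_kern_div_le hd hO hb hL hne hRf
  obtain ⟨C₁, hC₁, hI₁⟩ := exists_lintegral_inv_norm_le (d := d) hd R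
  obtain ⟨C₂, hC₂, hI₂⟩ := exists_lintegral_inv_add_norm_le (d := d) hd
  set σ := surfaceMeasure O
  have hfr : ∀ᵐ y ∂σ, y ∈ frontier O := surfaceMeasure_compl_frontier
  set A₁ := ENNReal.ofReal c
  set D := ENNReal.ofReal ((2 * d) ^ 2) * (A₁ * A₁) * ENNReal.ofReal (9 ^ d)
  have hD : D ≠ ⊤ := ENNReal.mul_ne_top (ENNReal.mul_ne_top ENNReal.ofReal_ne_top
    (ENNReal.mul_ne_top ENNReal.ofReal_ne_top ENNReal.ofReal_ne_top)) ENNReal.ofReal_ne_top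
  refine ⟨A₁ * C₁ + (d * (D * C₂) + A₁), ?_, fun f hf hfi ε hε hε1 => ?_⟩
  · refine ENNReal.add_ne_top.2 ⟨ENNReal.mul_ne_top ENNReal.ofReal_ne_top hC₁,
      ENNReal.add_ne_top.2 ⟨ENNReal.mul_ne_top (by simp) (ENNReal.mul_ne_top hD hC₂), ?_⟩⟩
    exact ENNReal.ofReal_ne_top
  obtain ⟨u, hu, hux⟩ := exists_smooth_average hε hR0 (hfr.mono fun y hy => hRf y hy) hfi
  have hprob : ∀ x, IsProbabilityMeasure (kernAvg σ ε x) := fun x =>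
    isProbabilityMeasure_kernAvg hε x
  have hfx : ∀ x, Integrable f (kernAvg σ ε x) := fun x => integrable_kernAvg hε x hfi
  have hwe : ∀ x y a, kern ε (x - y) / kernMass σ ε x ≤ c * a →
      ENNReal.ofReal (kern ε (x - y) / kernMass σ ε x) ≤ A₁ * ENNReal.ofReal a :=
    fun x y a h => (ENNReal.ofReal_le_ofReal h).trans (le_of_eq (ENNReal.ofReal_mul hc.le))
  refine ⟨u, hu, ?_, ?_, ?_⟩
  · refine le_trans ?_ (mul_le_mul_left (le_self_add : A₁ * C₁ ≤ _) _)
    have h1 : ∀ x ∈ O, ‖u x‖ₑ ^ 2 ≤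
        ∫⁻ y, A₁ * ((‖x - y‖ₑ ^ (d - 1))⁻¹ * ‖f y‖ₑ ^ 2) ∂σ := fun x hx => by
      have hxR := hRx x (subset_closure hx)
      obtain ⟨ρ, hρ, hρr, -, hk⟩ := hw ε hε hε1 x hxR
      have h2 := enorm_sub_integral_sq_le (hfx x) 0
      simp only [zero_sub, enorm_neg] at h2
      rw [(hux x hxR).1]
      refine h2.trans ?_
      rw [lintegral_kernAvg hε x (by fun_prop)]
      refine lintegral_mono_ae ?_
      filter_upwards [hfr] with y hy
      rw [← mul_assoc]
      refine mul_le_mul_left ((hwe x y _ (hk y)).trans (mul_le_mul_right ?_ _)) _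
      exact ofReal_kern_le_of_le hd hε hρ (hρr y hy)
    refine (setLIntegral_mono' hO.measurableSet h1).trans ?_
    rw [lintegral_lintegral_swap (by fun_prop), ← lintegral_const_mul _ (by fun_prop)]
    refine lintegral_mono_ae ?_
    filter_upwards [hfr] with y hy
    rw [lintegral_const_mul _ (by fun_prop), lintegral_mul_const _ (by fun_prop), mul_assoc]
    refine mul_le_mul_right (mul_le_mul_left (le_trans ?_ (hI₁ y (hRf y hy))) _) _
    exact lintegral_mono_set (subset_closure.trans hRO)
  · refine le_trans ?_ (mul_le_mul_left ((le_self_add : d * (D * C₂) ≤ _).trans le_add_self) _)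
    -- The gradient is at most (2d/ρ) times the mean oscillation of f, whose square is at most the
    -- double average of |f(y) - f(y')|². The weight obtained for the pair (y, y') integrates over x
    -- to a multiple of |y - y'|^{-d}.
    have h1 : ∀ x ∈ O, ‖classicalGrad u x‖ₑ ^ 2 ≤ d * (D * ∫⁻ y, ∫⁻ y',
        ((‖x - y‖ₑ + ‖y - y'‖ₑ) ^ (2 * d))⁻¹ * ‖f y - f y'‖ₑ ^ 2 ∂σ ∂σ) := fun x hx => by
      have hxR := hRx x (subset_closure hx)
      obtain ⟨ρ, hρ, hρr, -, hk⟩ := hw ε hε hε1 x hxR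
      refine enorm_sq_classicalGrad_le fun v hv => ?_
      have h2 := (hux x hxR).2 ρ hρ (hfr.mono fun y hy => hρr y hy) v
      rw [hv, mul_one] at h2
      have h3 : (∫⁻ y, ‖f y - u x‖ₑ ∂(kernAvg σ ε x)) ^ 2 ≤
          ∫⁻ y, ∫⁻ y', ‖f y - f y'‖ₑ ^ 2 ∂(kernAvg σ ε x) ∂(kernAvg σ ε x) := by
        refine (sq_lintegral_le (by fun_prop)).trans ?_
        rw [measure_univ, one_mul]
        refine lintegral_mono fun y => ?_
        rw [(hux x hxR).1]
        exact enorm_sub_integral_sq_le (hfx x) _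
      refine (pow_le_pow_left₀ zero_le h2 2).trans ?_
      rw [mul_pow, ← ENNReal.ofReal_pow (by positivity)]
      refine (mul_le_mul_right h3 _).trans ?_
      have hmeas : Measurable fun y => ∫⁻ y', ‖f y - f y'‖ₑ ^ 2 ∂(kernAvg σ ε x) :=
        Measurable.lintegral_prod_right' (f := fun p : Sp d × Sp d => ‖f p.1 - f p.2‖ₑ ^ 2)
          (by fun_prop)
      rw [lintegral_kernAvg hε x hmeas.aemeasurable,
        ← lintegral_const_mul' _ _ ENNReal.ofReal_ne_top, ← lintegral_const_mul' _ _ hD]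
      refine lintegral_mono_ae ?_
      filter_upwards [hfr] with y hy
      rw [lintegral_kernAvg hε x (by fun_prop), ← lintegral_const_mul' _ _ ENNReal.ofReal_ne_top,
        ← lintegral_const_mul' _ _ ENNReal.ofReal_ne_top, ← lintegral_const_mul' _ _ hD]
      refine lintegral_mono_ae ?_
      filter_upwards [hfr] with y' hy'
      have h4 := ofReal_kern_mul_kern_le hε hρ (hρr y hy) (hρr y' hy')
      rw [sub_sub_sub_cancel_left, ← enorm_neg (y' - y), neg_sub] at h4
      have hk0 : ∀ y, 0 ≤ ρ ^ (d + 1) * kern ε (x - y) := fun y =>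
        mul_nonneg (by positivity) (kern_pos hε _).le
      have h5 : ENNReal.ofReal ((2 * d / ρ) ^ 2) = ENNReal.ofReal ((2 * d) ^ 2) *
          ENNReal.ofReal ((1 / ρ) ^ 2) := by
        rw [← ENNReal.ofReal_mul (by positivity), ← mul_pow, mul_one_div]
      calc _ ≤ ENNReal.ofReal ((2 * d / ρ) ^ 2) *
            ((A₁ * ENNReal.ofReal (ρ ^ (d + 1) * kern ε (x - y))) *
              ((A₁ * ENNReal.ofReal (ρ ^ (d + 1) * kern ε (x - y'))) * ‖f y - f y'‖ₑ ^ 2)) := by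
            gcongr
            · exact hwe x y _ (hk y)
            · exact hwe x y' _ (hk y')
        _ = ENNReal.ofReal ((2 * d) ^ 2) * (A₁ * A₁) * ENNReal.ofReal ((1 / ρ) ^ 2 *
              (ρ ^ (d + 1) * kern ε (x - y)) * (ρ ^ (d + 1) * kern ε (x - y'))) *
                ‖f y - f y'‖ₑ ^ 2 := by
            rw [h5, ENNReal.ofReal_mul (mul_nonneg (by positivity) (hk0 y)),
              ENNReal.ofReal_mul (p := (1 / ρ) ^ 2) (by positivity)]
            ring
        _ ≤ ENNReal.ofReal ((2 * d) ^ 2) * (A₁ * A₁) * (ENNReal.ofReal (9 ^ d) *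
              ((‖x - y‖ₑ + ‖y - y'‖ₑ) ^ (2 * d))⁻¹) * ‖f y - f y'‖ₑ ^ 2 := by gcongr
        _ = _ := by simp only [D]; ring
    refine (setLIntegral_mono' hO.measurableSet h1).trans ?_
    rw [lintegral_const_mul' _ _ (by simp), lintegral_const_mul' _ _ hD,
      mul_assoc (d : ℝ≥0∞), mul_assoc D]
    refine mul_le_mul_right (mul_le_mul_right ?_ _) _
    have hm3 : Measurable fun p : (Sp d × Sp d) × Sp d =>
        ((‖p.1.1 - p.1.2‖ₑ + ‖p.1.2 - p.2‖ₑ) ^ (2 * d))⁻¹ * ‖f p.1.2 - f p.2‖ₑ ^ 2 := by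
      fun_prop
    rw [lintegral_lintegral_swap (f := fun x y => ∫⁻ y', ((‖x - y‖ₑ + ‖y - y'‖ₑ) ^ (2 * d))⁻¹ *
      ‖f y - f y'‖ₑ ^ 2 ∂σ) hm3.lintegral_prod_right'.aemeasurable, slobodeckij,
      ← lintegral_const_mul' _ _ hC₂]
    refine lintegral_mono fun y => ?_
    dsimp only
    rw [lintegral_lintegral_swap (by fun_prop), ← lintegral_const_mul' _ _ hC₂]
    refine lintegral_mono fun y' => ?_
    dsimp only
    rw [lintegral_mul_const _ (by fun_prop)]
    rcases eq_or_ne y y' with rfl | hyy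
    · simp
    rw [mul_left_comm, mul_comm]
    refine mul_le_mul_right (le_trans ?_ (hI₂ (y - y') (sub_ne_zero.2 hyy))) _
    rw [← lintegral_sub_right_eq_self (fun x => ((‖x‖ₑ + ‖y - y'‖ₑ) ^ (2 * d))⁻¹) y]
    exact setLIntegral_le_lintegral _ _
  · refine le_trans ?_ (mul_le_mul_right (mul_le_mul_left
      ((le_add_self : A₁ ≤ d * (D * C₂) + A₁).trans le_add_self) _) _)
    rw [slobodeckij, ← lintegral_const_mul' _ _ ENNReal.ofReal_ne_top,
      ← lintegral_const_mul' _ _ ENNReal.ofReal_ne_top]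
    refine lintegral_mono_ae ?_
    filter_upwards [hfr] with x hx
    have hxR := hRf x hx
    obtain ⟨ρ, hρ, hρr, hρε, hk⟩ := hw ε hε hε1 x hxR
    -- On the boundary δ = 0, so ρ = ε.
    rw [hρε hx] at hk
    rw [(hux x hxR).1, ← lintegral_const_mul' _ _ ENNReal.ofReal_ne_top,
      ← lintegral_const_mul' _ _ ENNReal.ofReal_ne_top]
    refine (enorm_sub_integral_sq_le (hfx x) _).trans ?_
    rw [lintegral_kernAvg hε x (by fun_prop)]
    refine lintegral_mono fun y => ?_
    dsimp only
    refine (mul_le_mul_left ((hwe x y _ (hk y)).trans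
      (mul_le_mul_right (ofReal_kern_le_mul hε _) _)) _).trans (le_of_eq ?_)
    ring

end Lifting

end Acoustic

end

noncomputable section

namespace Acoustic

/-! ### The lifting as a weak limit -/

section RightInverse

open scoped ContDiff

variable {d : ℕ} {O : Set (Sp d)}

theorem enorm_sq_eq_lintegral {X F : Type*} [MeasurableSpace X] [NormedAddCommGroup F]
    {μ : Measure X} {z : Lp F 2 μ} {u : X → F} (h : z =ᵐ[μ] u) :
    ‖z‖ₑ ^ 2 = ∫⁻ x, ‖u x‖ₑ ^ 2 ∂μ := by
  rw [Lp.enorm_def, eLpNorm_congr_ae h, sq_eLpNorm_two]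

theorem sq_norm_le_of_lintegral_le {X F : Type*} [MeasurableSpace X] [NormedAddCommGroup F]
    {μ : Measure X} {z : Lp F 2 μ} {u : X → F} (h : z =ᵐ[μ] u) {b : ℝ≥0∞} (hb : b ≠ ⊤)
    (hu : ∫⁻ x, ‖u x‖ₑ ^ 2 ∂μ ≤ b) : ‖z‖ ^ 2 ≤ b.toReal := by
  rw [← enorm_sq_eq_lintegral h] at hu
  have := ENNReal.toReal_mono hb hu
  rwa [ENNReal.toReal_pow, toReal_enorm] at this

theorem memLp_two_of_lintegral_lt_top {X F : Type*} [MeasurableSpace X] [NormedAddCommGroup F]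
    {μ : Measure X} {u : X → F} (hu : AEStronglyMeasurable u μ)
    (h : ∫⁻ x, ‖u x‖ₑ ^ 2 ∂μ < ⊤) : MemLp u 2 μ := by
  refine ⟨hu, ?_⟩
  rw [← sq_eLpNorm_two] at h
  exact (ENNReal.pow_lt_top_iff.1 h).resolve_right two_ne_zero

/-- Every function in `H^{1/2}(∂O)` is the trace of a function in `H¹(O)`. -/
theorem traceLifting (hd : 1 ≤ d) (hO : IsOpen O) (hb : Bornology.IsBounded O)
    (hL : HasLipschitzBoundary O) [IsFiniteMeasure (surfaceMeasure O)]
    [NeZero (surfaceMeasure O)] (hne : (frontier O).Nonempty) : TraceLifting O := by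
  obtain ⟨C, hC, hext⟩ := exists_smooth_extension hd hO hb hL hne
  set σ := surfaceMeasure O with hσ
  have hC0 : 0 ≤ C.toReal := ENNReal.toReal_nonneg
  refine ⟨2 * (2 * C.toReal + 1), by positivity, fun g => ?_⟩
  -- The function in the definition of `HHalf` may be changed on a null set into a measurable one;
  -- product null sets then take care of the difference quotient.
  obtain ⟨f, hf, hfm, hF⟩ : ∃ f : Sp d → ℂ, g.1.fst =ᵐ[σ] f ∧ Measurable f ∧
      g.1.snd =ᵐ[σ.prod σ] diffQuot f := by
    obtain ⟨f₀, hf₀, hF₀⟩ := g.2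
    have hm := Lp.aestronglyMeasurable g.1.fst
    refine ⟨hm.mk, hm.ae_eq_mk, hm.stronglyMeasurable_mk.measurable, ?_⟩
    have hff : f₀ =ᵐ[σ] hm.mk := hf₀.symm.trans hm.ae_eq_mk
    filter_upwards [hF₀, Measure.quasiMeasurePreserving_fst.ae hff,
      Measure.quasiMeasurePreserving_snd.ae hff] with q h1 h2 h3
    rw [h1, diffQuot, h2, h3]
  have hfL : MemLp f 2 σ := (memLp_congr_ae hf).1 (Lp.memLp g.1.fst)
  have hg2 : ‖g‖ ^ 2 = ‖g.1.fst‖ ^ 2 + ‖g.1.snd‖ ^ 2 := WithLp.prod_norm_sq_eq_of_L2 g.1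
  have hL2 : ∫⁻ y, ‖f y‖ₑ ^ 2 ∂σ = ‖g.1.fst‖ₑ ^ 2 := (enorm_sq_eq_lintegral hf).symm
  have hsl : slobodeckij O f = ‖g.1.snd‖ₑ ^ 2 := by
    have := measurable_diffQuot hfm
    rw [enorm_sq_eq_lintegral hF, lintegral_prod _ (by fun_prop)]
    simp_rw [enorm_sq_diffQuot]
    rfl
  have hfst : ‖g.1.fst‖ₑ ^ 2 ≠ ⊤ := by finiteness
  have hsnd : ‖g.1.snd‖ₑ ^ 2 ≠ ⊤ := by finiteness
  let ε : ℕ → ℝ := fun n => 1 / ((n : ℝ) + 1)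
  have hε : ∀ n, 0 < ε n := fun n => by positivity
  have hε1 : ∀ n, ε n ≤ 1 := fun n => by
    rw [div_le_one (by positivity)]; linarith [(Nat.cast_nonneg n : (0 : ℝ) ≤ n)]
  choose u hu hu1 hu2 hu3 using fun n =>
    hext f hfm (hfL.integrable one_le_two) (ε n) (hε n) (hε1 n)
  simp_rw [hL2] at hu1
  simp_rw [hsl] at hu2 hu3
  have hb1 : C * ‖g.1.fst‖ₑ ^ 2 ≠ ⊤ := ENNReal.mul_ne_top hC hfst
  have hb2 : C * ‖g.1.snd‖ₑ ^ 2 ≠ ⊤ := ENNReal.mul_ne_top hC hsnd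
  have hb3 : ∀ n, ENNReal.ofReal (ε n) * (C * ‖g.1.snd‖ₑ ^ 2) ≠ ⊤ := fun n =>
    ENNReal.mul_ne_top ENNReal.ofReal_ne_top hb2
  have m1 : ∀ n, MemLp (u n) 2 (volume.restrict O) := fun n =>
    memLp_two_of_lintegral_lt_top (hu n).continuous.aestronglyMeasurable
      ((hu1 n).trans_lt hb1.lt_top)
  have m2 : ∀ n, MemLp (classicalGrad (u n)) 2 (volume.restrict O) := fun n =>
    memLp_two_of_lintegral_lt_top (continuous_classicalGrad (hu n)).aestronglyMeasurable
      ((hu2 n).trans_lt hb2.lt_top)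
  have m3 : ∀ n, MemLp (u n) 2 σ := fun n => by
    have h := hfL.sub (memLp_two_of_lintegral_lt_top (hfm.aestronglyMeasurable.sub
      (hu n).continuous.aestronglyMeasurable) ((hu3 n).trans_lt (hb3 n).lt_top))
    rwa [sub_sub_cancel] at h
  let x : ℕ → WithLp 2 (L2 O × L2Vec O) := fun n =>
    WithLp.toLp 2 ((m1 n).toLp (u n), (m2 n).toLp (classicalGrad (u n)))
  let y : ℕ → L2Bdry O := fun n => (m3 n).toLp (u n)
  have hx : ∀ n, ‖x n‖ ≤ (2 * C.toReal + 1) * ‖g‖ := fun n => by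
    have h1 := sq_norm_le_of_lintegral_le (m1 n).coeFn_toLp hb1 (hu1 n)
    have h2 := sq_norm_le_of_lintegral_le (m2 n).coeFn_toLp hb2 (hu2 n)
    rw [ENNReal.toReal_mul, ENNReal.toReal_pow, toReal_enorm] at h1 h2
    have h3 : ‖x n‖ ^ 2 = ‖(m1 n).toLp (u n)‖ ^ 2 + ‖(m2 n).toLp (classicalGrad (u n))‖ ^ 2 :=
      WithLp.prod_norm_sq_eq_of_L2 (x n)
    refine (pow_le_pow_iff_left₀ (norm_nonneg _) (by positivity) two_ne_zero).1 ?_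
    rw [h3, mul_pow]
    have h4 : 0 ≤ ‖g‖ ^ 2 := by positivity
    nlinarith [mul_nonneg hC0 h4, mul_nonneg (mul_nonneg hC0 hC0) h4]
  have hy : Tendsto y atTop (𝓝 (HHalf.fn g)) := by
    rw [tendsto_iff_norm_sub_tendsto_zero]
    have h1 : ∀ n, ‖y n - HHalf.fn g‖ ≤ √(ε n * (C * ‖g.1.snd‖ₑ ^ 2).toReal) := fun n => by
      refine Real.le_sqrt_of_sq_le ?_
      rw [norm_sub_rev]
      have h2 : (HHalf.fn g - y n : L2Bdry O) =ᵐ[σ] fun z => f z - u n z := by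
        filter_upwards [Lp.coeFn_sub (HHalf.fn g) (y n), hf, (m3 n).coeFn_toLp] with z e1 e2 e3
        rw [e1, Pi.sub_apply, e3]
        exact congrArg (· - _) e2
      refine (sq_norm_le_of_lintegral_le h2 (hb3 n) (hu3 n)).trans (le_of_eq ?_)
      rw [ENNReal.toReal_mul, ENNReal.toReal_ofReal (hε n).le]
    refine squeeze_zero (fun n => norm_nonneg _) h1 ?_
    have h3 := (((tendsto_one_div_add_atTop_nhds_zero_nat (𝕜 := ℝ)).mul_const
      (C * ‖g.1.snd‖ₑ ^ 2).toReal).sqrt)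
    rwa [zero_mul, Real.sqrt_zero] at h3
  let T : (WithLp 2 (L2 O × L2Vec O)) × L2Bdry O →L[ℂ] (L2 O × L2Vec O) × L2Bdry O :=
    (WithLp.prodContinuousLinearEquiv 2 ℂ (L2 O) (L2Vec O)).toContinuousLinearMap.prodMap
      (ContinuousLinearMap.id ℂ (L2Bdry O))
  -- The extensions are bounded in H¹ and their boundary values converge in L²(∂O). The closed trace
  -- graph is weakly closed, so a weak limit has trace g and the same bound.
  obtain ⟨x₀, hx₀, hmem⟩ := exists_mem_of_bounded ((traceGraph O).comap T.toLinearMap)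
    ((isClosed_traceGraph hO).preimage T.continuous) hx hy fun n =>
      isTrace_of_contDiff (hu n) (m1 n).coeFn_toLp (m2 n).coeFn_toLp (m3 n).coeFn_toLp
  refine ⟨x₀.fst, x₀.snd, hmem.1, hmem.2, ?_⟩
  have h1 : ‖x₀.fst‖ ≤ ‖x₀‖ := WithLp.norm_fst_le _ x₀
  have h2 : ‖x₀.snd‖ ≤ ‖x₀‖ := WithLp.norm_snd_le _ x₀
  linarith

end RightInverse

/-! ### Nontriviality of the boundary and of its measure -/

section Frontier

variable {d : ℕ} {O : Set (Sp d)}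

theorem frontier_nonempty (hd : 1 ≤ d) (hb : Bornology.IsBounded O) (hne : O.Nonempty) :
    (frontier O).Nonempty := by
  have : Nontrivial (Sp d) := Module.nontrivial_of_finrank_pos (R := ℝ) (by simp; omega)
  rw [Set.nonempty_iff_ne_empty, Ne, frontier_eq_empty_iff, not_or]
  refine ⟨hne.ne_empty, ?_⟩
  rintro rfl
  exact NormedSpace.unbounded_univ ℝ (Sp d) hb

theorem surfaceMeasure_ne_zero (hd : 1 ≤ d) (hO : IsOpen O) (hb : Bornology.IsBounded O)
    (hL : HasLipschitzBoundary O) (hne : O.Nonempty) : surfaceMeasure O ≠ 0 := by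
  obtain ⟨y, hy⟩ := frontier_nonempty hd hb hne
  obtain ⟨c, hc, h⟩ := exists_lower_regularity hd hO hb hL 1
  intro h0
  have := h y hy 1 one_pos le_rfl
  rw [h0] at this
  simp at this
  linarith

end Frontier

end Acoustic

end

theorem theorem2p6 {d : ℕ} (hd : 2 ≤ d) (M : Acoustic.Medium d)
    {Ω : Type*} [MeasurableSpace Ω] (P : Measure Ω) [IsProbabilityMeasure P] [P.IsComplete]
    (V : Acoustic.L2Bdry M.dom ≃L[ℂ] Acoustic.HHalf M.dom)
    (K : Ω → Acoustic.L2Bdry M.dom →L[ℂ] Acoustic.L2Bdry M.dom) (hK : Acoustic.IsRandomContraction P K) :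
    Acoustic.IsRandomMDissipative P (fun ω => Acoustic.acousticOperator M V (K ω)) ∧
      ((∀ᵐ ω ∂P, K ω ∈ unitary (Acoustic.L2Bdry M.dom →L[ℂ] Acoustic.L2Bdry M.dom)) →
        Acoustic.IsRandomSelfAdjoint P (fun ω => Acoustic.acousticOperator M V (K ω))) := by
  have hd1 : 1 ≤ d := by omega
  have hne := M.isConnected_dom.nonempty
  have : IsFiniteMeasure (Acoustic.surfaceMeasure M.dom) :=
    ⟨Acoustic.surfaceMeasure_lt_top hd1 M.isOpen_dom M.isBounded_dom M.lipschitz_dom⟩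
  have : NeZero (Acoustic.surfaceMeasure M.dom) :=
    ⟨Acoustic.surfaceMeasure_ne_zero hd1 M.isOpen_dom M.isBounded_dom M.lipschitz_dom hne⟩
  -- Provides separability of L²(∂O), on which the measurability arguments rest.
  have : Fact ((2 : ℝ≥0∞) ≠ ∞) := ⟨by simp⟩
  exact (Acoustic.boundarySystem_acoustic V
    (Acoustic.traceBounded hd1 M.isOpen_dom M.isBounded_dom M.lipschitz_dom)
    (Acoustic.traceLifting hd1 M.isOpen_dom M.isBounded_dom M.lipschitz_dom
      (Acoustic.frontier_nonempty hd1 M.isBounded_dom hne))).main P hK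
    fun ω => Acoustic.isRestriction_acousticOperator V (K ω)
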